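/- Let $0\le\alpha<1$ and $s\in\mathbb R$. In $L^2((0,\infty),dr)$ (complex-valued functions) let $$h_{0,\alpha}=-\frac{d^2}{dr^2}+\frac{\alpha^2-\frac14}{r^2}$$ with domain the functions $\psi$ with compact support in $(0,\infty)$ such that $\psi$ and $\psi'$ are locally absolutely continuous and $h_{0,\alpha}\psi\in L^2$. Put $F_\alpha(r)=r^{\frac12+\alpha}$ and $G_\alpha(r)=F_\alpha(r)\int_r^1F_\alpha(t)^{-2}\,dt$, that is, $G_\alpha(r)=\frac1{2\alpha}\bigl(r^{\frac12-\alpha}-r^{\frac12+\alpha}\bigr)$ for $\alpha>0$ and $G_0(r)=-\sqrt r\,\ln r$. Let $\psi_{\alpha,s}=G_\alpha+sF_\alpha$, and let $h_{0,\alpha}(s)$ (the $\delta$-potential) be the self-adjoint extension of $h_{0,\alpha}$ that is the restriction of $h_{0,\alpha}^*$ to $$\mathcal D(h_{0,\alpha}(s))=\Bigl\{\psi\in\mathcal D(h_{0,\alpha}^*)\ :\ \lim_{r\downarrow0}\bigl(\psi_{\alpha,s}\psi'-\psi_{\alpha,s}'\psi\bigr)(r)=0\Bigr\}.$$ Let $k\in\mathbb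 C$ with $0<\arg k<\pi$, and put $$D(k,\alpha;s)=\Bigl(\frac k2\Bigr)^{-2\alpha}(2s\alpha-1)\,\frac1{\sin\pi\alpha}\,\frac{\Gamma(1+\alpha)}{\Gamma(1-\alpha)}+\cot\pi\alpha-i\qquad(0<\alpha<1),$$ with the principal branch of the power, and, as the limit $\alpha\downarrow0$, $D(k,0;s)=\frac2\pi\bigl(\ln\frac k{2i}+\gamma+s\bigr)$, where $\gamma$ is Euler's constant and $\ln$ is the principal logarithm. Then $k^2$ belongs to the resolvent set of $h_{0,\alpha}(s)$ if and only if $D(k,\alpha;s)\ne0$. In that case $(h_{0,\alpha}(s)-k^2)^{-1}$ is the integral operator on $L^2((0,\infty),dr)$ (with absolutely convergent integrals for every $r>0$) with kernel $$\frac{1}{h_{0,\alpha}(s)-k^2}(r,r')=\frac{i\pi}2\sqrt{rr'}\,J_\alpha(kr_<)\,H^{(1)}_\alpha(kr_>)-A(k,\alpha;s)\,\sqrt{rr'}\,H^{(1)}_\alpha(kr)\,H^{(1)}_\alpha(kr'),$$ where $r_<=\min(r,r')$, $r_>=\max(r,r')$, $J_\alpha$ and $H^{(1)}_\alpha$ are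 the Bessel function and the Hankel function of the first kind (principal branches), and $$A(k,\alpha;s)=\frac\pi2\,D(k,\alpha;s)^{-1}.$$ -/

import Mathlib

open MeasureTheory Set Filter Topology

noncomputable section

namespace AnyonDelta

/-! ### Bessel functions -/

/-- The Bessel function of the first kind `J_ν(z)`, by its power series, with the principal branch
of `(z / 2) ^ ν`. In Mathlib `Γ` is `0` at its poles, so `1 / Γ` has its correct value `0` there. -/
def besselJ (ν z : ℂ) : ℂ :=
  (z / 2) ^ ν *
    ∑' m : ℕ, (-1) ^ m / ((m.factorial : ℂ) * Complex.Gamma (ν + m + 1)) * (z / 2) ^ (2 * m)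

/-- The quotient `(J_ν(z) cos πν - J_{-ν}(z)) / sin πν`, meaningful when `ν` is not an integer. -/
def besselYQuot (ν z : ℂ) : ℂ :=
  (besselJ ν z * Complex.cos (Real.pi * ν) - besselJ (-ν) z) / Complex.sin (Real.pi * ν)

open Classical in
/-- The Bessel function of the second kind `Y_ν(z)`; at integers `ν` it is the limit in the order. -/
def besselY (ν z : ℂ) : ℂ :=
  if Complex.sin (Real.pi * ν) = 0 then limUnder (𝓝[≠] ν) (fun μ => besselYQuot μ z)
  else besselYQuot ν z

/-- The Hankel function of the first kind `H_ν^{(1)}(z) = J_ν(z) + i Y_ν(z)`. -/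
def hankelH1 (ν z : ℂ) : ℂ := besselJ ν z + Complex.I * besselY ν z

/-! ### The minimal operator -/

/-- Lebesgue measure on the half line `(0, ∞)`. -/
abbrev halfLine : Measure ℝ := volume.restrict (Ioi 0)

/-- The Hilbert space `L²((0, ∞), dr)` of complex-valued functions. -/
abbrev L2HalfLine : Type := Lp ℂ 2 halfLine

/-- Local absolute continuity on `(0, ∞)`. -/
def LocallyAC (u : ℝ → ℂ) : Prop :=
  ∀ a b : ℝ, 0 < a → a ≤ b → AbsolutelyContinuousOnInterval u a b

/-- The differential expression `-u'' + (α² - 1/4) / r² * u`. -/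
def radialExpr (α : ℝ) (u : ℝ → ℂ) (r : ℝ) : ℂ :=
  -deriv (deriv u) r + (((α ^ 2 - 1 / 4) / r ^ 2 : ℝ) : ℂ) * u r

/-- The functions in the domain of the minimal operator: `u` has compact support inside `(0, ∞)`
(it is extended by `0` to the line), it is differentiable, `u` and `u'` are locally absolutely
continuous, and `-u'' + (α² - 1/4) / r² * u` (where `u''` exists almost everywhere and is then the
distributional derivative of `u'`) is square integrable. -/
structure IsMinimalFunction (α : ℝ) (u : ℝ → ℂ) : Prop where
  hasCompactSupport : HasCompactSupport u
  tsupport_subset : tsupport u ⊆ Ioi 0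
  differentiable : Differentiable ℝ u
  locallyAC : LocallyAC u
  locallyAC_deriv : LocallyAC (deriv u)
  memLp : MemLp (radialExpr α u) 2 halfLine

theorem LocallyAC.ae_differentiableAt {u : ℝ → ℂ} (hu : LocallyAC u) :
    ∀ᵐ r ∂halfLine, DifferentiableAt ℝ u r := by
  rw [ae_restrict_iff' measurableSet_Ioi]
  have h : ∀ n : ℕ, ∀ᵐ r : ℝ, r ∈ uIcc (1 / ((n : ℝ) + 1)) ((n : ℝ) + 1) →
      DifferentiableAt ℝ u r := by
    intro n
    have h1 : (1 : ℝ) / ((n : ℝ) + 1) ≤ (n : ℝ) + 1 := by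
      rw [div_le_iff₀ (by positivity)]
      have : (0 : ℝ) ≤ n := n.cast_nonneg
      nlinarith
    exact (hu _ _ (by positivity) h1).boundedVariationOn.ae_differentiableAt_of_mem_uIcc
  filter_upwards [ae_all_iff.2 h] with r hr h0
  have h0' : 0 < r := h0
  obtain ⟨n, hn⟩ := exists_nat_gt (max r (1 / r))
  have hn1 : r < n := lt_of_le_of_lt (le_max_left _ _) hn
  have hn2 : 1 / r < n := lt_of_le_of_lt (le_max_right _ _) hn
  refine hr n (Icc_subset_uIcc ⟨?_, by linarith⟩)
  rw [div_lt_iff₀ h0'] at hn2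
  rw [div_le_iff₀ (by positivity)]
  nlinarith

theorem IsMinimalFunction.radialExpr_add {α : ℝ} {u v : ℝ → ℂ} (hu : IsMinimalFunction α u)
    (hv : IsMinimalFunction α v) :
    radialExpr α (u + v) =ᵐ[halfLine] radialExpr α u + radialExpr α v := by
  have h1 : deriv (u + v) = deriv u + deriv v := by
    funext r
    exact deriv_add (hu.differentiable r) (hv.differentiable r)
  filter_upwards [hu.locallyAC_deriv.ae_differentiableAt,
    hv.locallyAC_deriv.ae_differentiableAt] with r h2 h3
  have h4 : deriv (deriv u + deriv v) r = deriv (deriv u) r + deriv (deriv v) r :=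
    deriv_add h2 h3
  simp only [radialExpr, Pi.add_apply, h1, h4]
  ring

theorem radialExpr_smul (α : ℝ) (c : ℂ) (u : ℝ → ℂ) :
    radialExpr α (c • u) = c • radialExpr α u := by
  have h1 : ∀ w : ℝ → ℂ, deriv (c • w) = c • deriv w := by
    intro w
    funext r
    exact deriv_const_smul_field c w
  funext r
  simp only [radialExpr, h1, Pi.smul_apply, smul_eq_mul]
  ring

theorem IsMinimalFunction.continuous_memLp {α : ℝ} {u : ℝ → ℂ} (hu : IsMinimalFunction α u) :
    MemLp u 2 halfLine :=
  (hu.differentiable.continuous.memLp_of_hasCompactSupport hu.hasCompactSupport).restrict _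

/-- The complex vector space of functions in the domain of the minimal operator. -/
def minimalFunctions (α : ℝ) : Submodule ℂ (ℝ → ℂ) where
  carrier := {u | IsMinimalFunction α u}
  zero_mem' :=
    { hasCompactSupport := HasCompactSupport.zero
      tsupport_subset := by simp [tsupport]
      differentiable := differentiable_const _
      locallyAC := fun a b _ _ =>
        (LipschitzWith.const (0 : ℂ)).lipschitzOnWith.absolutelyContinuousOnInterval
      locallyAC_deriv := fun a b _ _ => by
        have h : deriv (0 : ℝ → ℂ) = fun _ => 0 := by
          funext r
          exact deriv_const r (0 : ℂ)
        rw [h]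
        exact (LipschitzWith.const (0 : ℂ)).lipschitzOnWith.absolutelyContinuousOnInterval
      memLp := by
        have h : radialExpr α 0 = 0 := by
          have := radialExpr_smul α 0 0
          simpa using this
        rw [h]
        exact MemLp.zero }
  add_mem' := fun {u v} hu hv =>
    { hasCompactSupport := hu.hasCompactSupport.add hv.hasCompactSupport
      tsupport_subset := (tsupport_add u v).trans
        (union_subset hu.tsupport_subset hv.tsupport_subset)
      differentiable := hu.differentiable.add hv.differentiable
      locallyAC := fun a b ha hab => (hu.locallyAC a b ha hab).add (hv.locallyAC a b ha hab)
      locallyAC_deriv := fun a b ha hab => by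
        have h1 : deriv (u + v) = deriv u + deriv v := by
          funext r
          exact deriv_add (hu.differentiable r) (hv.differentiable r)
        rw [h1]
        exact (hu.locallyAC_deriv a b ha hab).add (hv.locallyAC_deriv a b ha hab)
      memLp := (memLp_congr_ae (hu.radialExpr_add hv)).2 (hu.memLp.add hv.memLp) }
  smul_mem' := fun c {u} hu =>
    { hasCompactSupport := hu.hasCompactSupport.smul_left (f := fun _ => c)
      tsupport_subset := (closure_mono (Function.support_const_smul_subset c u)).trans
        hu.tsupport_subset
      differentiable := hu.differentiable.const_smul c
      locallyAC := fun a b ha hab => (hu.locallyAC a b ha hab).const_smul c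
      locallyAC_deriv := fun a b ha hab => by
        have h1 : deriv (c • u) = c • deriv u := by
          funext r
          exact deriv_const_smul_field c u
        rw [h1]
        exact (hu.locallyAC_deriv a b ha hab).const_smul c
      memLp := by
        rw [radialExpr_smul]
        exact hu.memLp.const_smul c }

/-- The class in `L²(0, ∞)` of a function in the domain of the minimal operator. -/
def minimalEmbedding (α : ℝ) : minimalFunctions α →ₗ[ℂ] L2HalfLine where
  toFun u := MemLp.toLp u.1 (IsMinimalFunction.continuous_memLp u.2)
  map_add' _ _ := rfl
  map_smul' _ _ := rfl

/-- The map `u ↦ -u'' + (α² - 1/4) / r² * u` into `L²(0, ∞)`. -/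
def minimalAction (α : ℝ) : minimalFunctions α →ₗ[ℂ] L2HalfLine where
  toFun u := MemLp.toLp (radialExpr α u.1) (IsMinimalFunction.memLp u.2)
  map_add' u v := by
    rw [← MemLp.toLp_add]
    exact MemLp.toLp_congr _ _ (IsMinimalFunction.radialExpr_add u.2 v.2)
  map_smul' c u := by
    rw [RingHom.id_apply, ← MemLp.toLp_const_smul]
    exact MemLp.toLp_congr _ _ (Eventually.of_forall fun r =>
      congrFun (radialExpr_smul α c u.1) r)

theorem minimalEmbedding_injective (α : ℝ) : Function.Injective (minimalEmbedding α) := by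
  rw [← LinearMap.ker_eq_bot, LinearMap.ker_eq_bot']
  rintro ⟨u, hu⟩ h
  have hu' : IsMinimalFunction α u := hu
  have h1 : u =ᵐ[halfLine] 0 := by
    have h2 : MemLp.toLp u hu'.continuous_memLp = 0 := h
    have h4 := hu'.continuous_memLp.coeFn_toLp
    rw [h2] at h4
    exact h4.symm.trans (Lp.coeFn_zero _ _ _)
  have h3 : EqOn u 0 (Ioi 0) :=
    Measure.eqOn_open_of_ae_eq h1 isOpen_Ioi
      hu'.differentiable.continuous.continuousOn continuousOn_const
  apply Subtype.ext
  funext r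
  by_cases hr : r ∈ Ioi (0 : ℝ)
  · exact h3 hr
  · exact image_eq_zero_of_notMem_tsupport fun h => hr (hu'.tsupport_subset h)

/-- The operator `h_{0,α} = -d²/dr² + (α² - 1/4) / r²` in `L²(0, ∞)`, with domain the (classes of)
functions of compact support inside `(0, ∞)` of `IsMinimalFunction`. -/
def minimalHamiltonian (α : ℝ) : L2HalfLine →ₗ.[ℂ] L2HalfLine where
  domain := LinearMap.range (minimalEmbedding α)
  toFun := (minimalAction α).comp
    (LinearEquiv.ofInjective (minimalEmbedding α) (minimalEmbedding_injective α)).symm.toLinearMap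

/-! ### The extensions -/

/-- The regular solution `F_α(r) = r^{1/2 + α}` of `h_{0,α} ψ = 0`. -/
def regularSol (α r : ℝ) : ℝ := r ^ (1 / 2 + α)

/-- The irregular solution `G_α = F_α ∫_r^1 F_α⁻²` of `h_{0,α} ψ = 0`. -/
def irregularSol (α r : ℝ) : ℝ :=
  if α = 0 then -(Real.sqrt r * Real.log r)
  else 1 / (2 * α) * (r ^ (1 / 2 - α) - r ^ (1 / 2 + α))

/-- The boundary function `ψ_{α,s} = G_α + s F_α`. -/
def boundaryFun (α s r : ℝ) : ℂ := ((irregularSol α r + s * regularSol α r : ℝ) : ℂ)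

/-- The Wronskian `W(f, g) = f g' - f' g`. -/
def wronskian (f g : ℝ → ℂ) (r : ℝ) : ℂ := f r * deriv g r - deriv f r * g r

/-- The `ψ ∈ L²(0, ∞)` whose continuously differentiable representative `u` on `(0, ∞)` satisfies
`W(ψ_{α,s}, u)(r) → 0` as `r ↓ 0`. -/
def boundaryCondition (α s : ℝ) : Submodule ℂ L2HalfLine where
  carrier := {ψ | ∃ u : ℝ → ℂ, ψ =ᵐ[halfLine] u ∧ ContDiffOn ℝ 1 u (Ioi 0) ∧
    Tendsto (wronskian (boundaryFun α s) u) (𝓝[>] 0) (𝓝 0)}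
  zero_mem' := by
    refine ⟨0, Lp.coeFn_zero _ _ _, contDiffOn_const, ?_⟩
    have h : wronskian (boundaryFun α s) 0 = fun _ => 0 := by
      funext r
      have h1 : deriv (0 : ℝ → ℂ) r = 0 := deriv_const r (0 : ℂ)
      simp [wronskian, h1]
    rw [h]
    exact tendsto_const_nhds
  add_mem' := by
    rintro ψ φ ⟨u, hu1, hu2, hu3⟩ ⟨v, hv1, hv2, hv3⟩
    refine ⟨u + v, (Lp.coeFn_add ψ φ).trans (hu1.add hv1), hu2.add hv2, ?_⟩
    have h := hu3.add hv3
    rw [add_zero] at h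
    refine h.congr' ?_
    filter_upwards [self_mem_nhdsWithin] with r hr
    have h1 : deriv (u + v) r = deriv u r + deriv v r :=
      deriv_add
        ((hu2.differentiableOn one_ne_zero r hr).differentiableAt (isOpen_Ioi.mem_nhds hr))
        ((hv2.differentiableOn one_ne_zero r hr).differentiableAt (isOpen_Ioi.mem_nhds hr))
    simp only [wronskian, Pi.add_apply, h1]
    ring
  smul_mem' := by
    rintro c ψ ⟨u, hu1, hu2, hu3⟩
    refine ⟨c • u, (Lp.coeFn_smul c ψ).trans (hu1.const_smul c), hu2.const_smul c, ?_⟩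
    have h := hu3.const_mul c
    rw [mul_zero] at h
    refine h.congr' (Eventually.of_forall fun r => ?_)
    have h1 : deriv (c • u) r = c • deriv u r := deriv_const_smul_field c u
    simp only [wronskian, Pi.smul_apply, h1, smul_eq_mul]
    ring

/-- The extension `h_{0,α}(s)`: the restriction of the adjoint of `h_{0,α}` to the `ψ` in its domain
with `lim_{r ↓ 0} W(ψ_{α,s}, ψ)(r) = 0`. -/
def deltaHamiltonian (α s : ℝ) : L2HalfLine →ₗ.[ℂ] L2HalfLine :=
  (minimalHamiltonian α).adjoint.domRestrict (boundaryCondition α s)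

/-! ### Resolvents and integral kernels -/

/-- The bounded operator `R` is the inverse of `T - z : D(T) → H`. -/
def IsResolventAt {H : Type*} [NormedAddCommGroup H] [NormedSpace ℂ H] (T : H →ₗ.[ℂ] H) (z : ℂ)
    (R : H →L[ℂ] H) : Prop :=
  (∀ η : H, ∃ h : R η ∈ T.domain, T ⟨R η, h⟩ - z • R η = η) ∧
    ∀ ψ : T.domain, R (T ψ - z • (ψ : H)) = ψ

/-- The resolvent set of an unbounded operator `T`. -/
def pmapResolventSet {H : Type*} [NormedAddCommGroup H] [NormedSpace ℂ H] (T : H →ₗ.[ℂ] H) :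
    Set ℂ :=
  {z | ∃ R : H →L[ℂ] H, IsResolventAt T z R}

/-- `R` is the integral operator with kernel `K`: `(R η)(r) = ∫_0^∞ K(r, r') η(r') dr'`, with
absolutely convergent integrals. -/
def HasIntegralKernel (R : L2HalfLine →L[ℂ] L2HalfLine) (K : ℝ → ℝ → ℂ) : Prop :=
  ∀ η : L2HalfLine, (∀ r : ℝ, 0 < r → Integrable (fun r' => K r r' * η r') halfLine) ∧
    R η =ᵐ[halfLine] fun r => ∫ r', K r r' * η r' ∂halfLine

/-! ### The explicit kernel -/

/-- The bracket whose inverse occurs in `A(k, α; s)`; at `α = 0`, where the general expression is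
undefined, its limit as `α ↓ 0`. -/
def deltaBracket (k : ℂ) (α s : ℝ) : ℂ :=
  if α = 0 then
    2 / Real.pi * (Complex.log (k / (2 * Complex.I)) + Real.eulerMascheroniConstant + s)
  else
    (k / 2) ^ (-2 * α : ℂ) * (2 * s * α - 1) * (1 / Complex.sin (Real.pi * α)) *
        (Complex.Gamma (1 + α) / Complex.Gamma (1 - α)) +
      Complex.cot (Real.pi * α) - Complex.I

/-- The coefficient `A(k, α; s)`. -/
def deltaA (k : ℂ) (α s : ℝ) : ℂ := Real.pi / 2 * (deltaBracket k α s)⁻¹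

/-- The kernel
`(iπ/2) √(r r') J_α(k r_<) H_α^{(1)}(k r_>) - A(k, α; s) √(r r') H_α^{(1)}(k r) H_α^{(1)}(k r')`. -/
def deltaKernel (k : ℂ) (α s : ℝ) (r r' : ℝ) : ℂ :=
  Complex.I * Real.pi / 2 * Real.sqrt (r * r') * besselJ α (k * (min r r' : ℝ)) *
      hankelH1 α (k * (max r r' : ℝ)) -
    deltaA k α s * Real.sqrt (r * r') * hankelH1 α (k * r) * hankelH1 α (k * r')

end AnyonDelta

end

namespace AnyonDelta

/-! ### Absolutely continuous complex functions -/

theorem _root_.AbsolutelyContinuousOnInterval.comp_lipschitzWith {X Y : Type*}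
    [PseudoMetricSpace X] [PseudoMetricSpace Y] {f : ℝ → X} {g : X → Y} {a b : ℝ}
    (hg : LipschitzWith 1 g) (hf : AbsolutelyContinuousOnInterval f a b) :
    AbsolutelyContinuousOnInterval (fun x => g (f x)) a b := by
  rw [absolutelyContinuousOnInterval_iff] at hf ⊢
  intro ε hε
  obtain ⟨δ, hδ, h⟩ := hf ε hε
  refine ⟨δ, hδ, fun E hE hE' => lt_of_le_of_lt ?_ (h E hE hE')⟩
  exact Finset.sum_le_sum fun i _ => by simpa using hg.dist_le_mul (f (E.2 i).1) (f (E.2 i).2)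

theorem lipschitzWith_re : LipschitzWith 1 Complex.re :=
  LipschitzWith.of_dist_le_mul fun x y => by
    simpa [dist_eq_norm, Real.norm_eq_abs] using Complex.abs_re_le_norm (x - y)

theorem lipschitzWith_im : LipschitzWith 1 Complex.im :=
  LipschitzWith.of_dist_le_mul fun x y => by
    simpa [dist_eq_norm, Real.norm_eq_abs] using Complex.abs_im_le_norm (x - y)

theorem _root_.AbsolutelyContinuousOnInterval.integral_real_eq_sub {f f' : ℝ → ℝ} {a b : ℝ}
    (hf : AbsolutelyContinuousOnInterval f a b)
    (h : ∀ᵐ x, x ∈ uIcc a b → HasDerivAt f (f' x) x) :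
    IntervalIntegrable f' volume a b ∧ ∫ x in a..b, f' x = f b - f a := by
  have h1 : ∀ᵐ x, x ∈ uIoc a b → deriv f x = f' x := by
    filter_upwards [h] with x hx hx'
    exact (hx (uIoc_subset_uIcc hx')).deriv
  constructor
  · exact hf.intervalIntegrable_deriv.congr_ae ((ae_restrict_iff' measurableSet_uIoc).2 h1)
  · rw [← hf.integral_deriv_eq_sub]
    exact (intervalIntegral.integral_congr_ae h1).symm

/-- The fundamental theorem of calculus for absolutely continuous complex functions. -/
theorem _root_.AbsolutelyContinuousOnInterval.integral_complex_eq_sub {f f' : ℝ → ℂ} {a b : ℝ}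
    (hf : AbsolutelyContinuousOnInterval f a b)
    (h : ∀ᵐ x, x ∈ uIcc a b → HasDerivAt f (f' x) x) :
    IntervalIntegrable f' volume a b ∧ ∫ x in a..b, f' x = f b - f a := by
  have hre := (hf.comp_lipschitzWith lipschitzWith_re).integral_real_eq_sub
    (f' := fun x => (f' x).re) (by
      filter_upwards [h] with x hx hx'
      exact (Complex.reCLM.hasFDerivAt.comp_hasDerivAt x (hx hx')))
  have him := (hf.comp_lipschitzWith lipschitzWith_im).integral_real_eq_sub
    (f' := fun x => (f' x).im) (by
      filter_upwards [h] with x hx hx'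
      exact (Complex.imCLM.hasFDerivAt.comp_hasDerivAt x (hx hx')))
  have hi : IntervalIntegrable f' volume a b := by
    have h1 : IntervalIntegrable (fun x => ((f' x).re : ℂ)) volume a b :=
      ⟨hre.1.1.ofReal, hre.1.2.ofReal⟩
    have h2 : IntervalIntegrable (fun x => ((f' x).im : ℂ)) volume a b :=
      ⟨him.1.1.ofReal, him.1.2.ofReal⟩
    exact (h1.add (h2.mul_const Complex.I)).congr fun x _ => Complex.re_add_im _
  refine ⟨hi, Complex.ext ?_ ?_⟩
  · have := Complex.reCLM.intervalIntegral_comp_comm hi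
    simp only [Complex.reCLM_apply] at this
    rw [← this, hre.2, Complex.sub_re]
  · have := Complex.imCLM.intervalIntegral_comp_comm hi
    simp only [Complex.imCLM_apply] at this
    rw [← this, him.2, Complex.sub_im]

theorem absolutelyContinuousOnInterval_primitive {f : ℝ → ℂ} {a b : ℝ}
    (h : IntervalIntegrable f volume a b) :
    AbsolutelyContinuousOnInterval (fun x => ∫ v in a..x, f v) a b := by
  have hre : IntervalIntegrable (fun x => (f x).re) volume a b := ⟨h.1.re, h.2.re⟩
  have him : IntervalIntegrable (fun x => (f x).im) volume a b := ⟨h.1.im, h.2.im⟩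
  have h1 := (hre.absolutelyContinuousOnInterval_intervalIntegral
    (c := a) left_mem_uIcc).comp_lipschitzWith (g := ((↑) : ℝ → ℂ))
      Complex.isometry_ofReal.lipschitz
  have h2 := ((him.absolutelyContinuousOnInterval_intervalIntegral
    (c := a) left_mem_uIcc).comp_lipschitzWith (g := ((↑) : ℝ → ℂ))
      Complex.isometry_ofReal.lipschitz).const_smul Complex.I
  have h3 := h1.add h2
  have h4 : ∀ x ∈ uIcc a b, (∫ v in a..x, f v) =
      ((fun x => ((∫ v in a..x, (f v).re : ℝ) : ℂ)) +
        Complex.I • fun x => ((∫ v in a..x, (f v).im : ℝ) : ℂ)) x := by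
    intro x hx
    have hfx : IntervalIntegrable f volume a x := h.mono_set (uIcc_subset_uIcc_left hx)
    have e1 := Complex.reCLM.intervalIntegral_comp_comm hfx
    have e2 := Complex.imCLM.intervalIntegral_comp_comm hfx
    simp only [Complex.reCLM_apply, Complex.imCLM_apply] at e1 e2
    simp only [Pi.add_apply, Pi.smul_apply, smul_eq_mul, e1, e2]
    rw [mul_comm]
    exact (Complex.re_add_im _).symm
  rw [absolutelyContinuousOnInterval_iff] at h3 ⊢
  intro ε hε
  obtain ⟨δ, hδ, h⟩ := h3 ε hε
  refine ⟨δ, hδ, fun E hE hE' => lt_of_le_of_lt (le_of_eq ?_) (h E hE hE')⟩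
  refine Finset.sum_congr rfl fun i hi => ?_
  rw [h4 _ (hE.1 i hi).1, h4 _ (hE.1 i hi).2]
  rfl

theorem LocallyAC.of_hasDerivAt {u v : ℝ → ℂ} (h : ∀ r, 0 < r → HasDerivAt u (v r) r)
    (hv : ContinuousOn v (Ioi 0)) : LocallyAC u := by
  intro a b ha hab
  have hsub : uIcc a b ⊆ Ioi 0 := by
    rw [uIcc_of_le hab]
    exact fun x hx => lt_of_lt_of_le ha hx.1
  obtain ⟨C, hC⟩ := isCompact_uIcc.exists_bound_of_continuousOn (hv.mono hsub)
  have : LipschitzOnWith (Real.toNNReal C) u (uIcc a b) := by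
    refine (convex_uIcc a b).lipschitzOnWith_of_nnnorm_hasDerivWithin_le
      (f' := v) (fun x hx => (h x (hsub hx)).hasDerivWithinAt) (fun x hx => ?_)
    rw [← NNReal.coe_le_coe, coe_nnnorm]
    exact (hC x hx).trans (Real.le_coe_toNNReal C)
  exact this.absolutelyContinuousOnInterval

theorem LocallyAC.conj {u : ℝ → ℂ} (h : LocallyAC u) :
    LocallyAC (fun r => (starRingEnd ℂ) (u r)) := fun a b ha hab =>
  (h a b ha hab).comp_lipschitzWith Complex.isometry_conj.lipschitz

theorem LocallyAC.continuousOn {u : ℝ → ℂ} (h : LocallyAC u) : ContinuousOn u (Ioi 0) := by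
  intro x hx
  have hx : 0 < x := hx
  have h1 := (h (x / 2) (2 * x) (by positivity) (by linarith)).continuousOn
  rw [uIcc_of_le (by linarith)] at h1
  exact (h1.continuousAt (Icc_mem_nhds (by linarith) (by linarith))).continuousWithinAt

theorem LocallyAC.mul {u v : ℝ → ℂ} (hu : LocallyAC u) (hv : LocallyAC v) :
    LocallyAC (fun r => u r * v r) := fun a b ha hab => (hu a b ha hab).smul (hv a b ha hab)

theorem LocallyAC.add {u v : ℝ → ℂ} (hu : LocallyAC u) (hv : LocallyAC v) :
    LocallyAC (fun r => u r + v r) := fun a b ha hab => (hu a b ha hab).add (hv a b ha hab)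

theorem LocallyAC.sub {u v : ℝ → ℂ} (hu : LocallyAC u) (hv : LocallyAC v) :
    LocallyAC (fun r => u r - v r) := fun a b ha hab => (hu a b ha hab).sub (hv a b ha hab)

theorem ae_halfLine_of_Icc {p : ℝ → Prop} (h : ∀ᵐ r ∂halfLine, p r) {a b : ℝ} (ha : 0 < a)
    (hab : a ≤ b) : ∀ᵐ x, x ∈ uIcc a b → p x := by
  rw [ae_restrict_iff' measurableSet_Ioi] at h
  filter_upwards [h] with x hx hx'
  rw [uIcc_of_le hab] at hx'
  exact hx (lt_of_lt_of_le ha hx'.1)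

/-! ### Strong solutions -/

/-- The potential `(α² - 1/4) / r²`. -/
noncomputable def radialPot (α r : ℝ) : ℂ := (((α ^ 2 - 1 / 4) / r ^ 2 : ℝ) : ℂ)

theorem continuousOn_radialPot (α : ℝ) : ContinuousOn (radialPot α) (Ioi 0) := by
  unfold radialPot
  refine Complex.continuous_ofReal.comp_continuousOn (continuousOn_const.div (by fun_prop) ?_)
  intro x hx
  have : (0 : ℝ) < x := hx
  positivity

theorem conj_radialPot (α r : ℝ) : (starRingEnd ℂ) (radialPot α r) = radialPot α r :=
  Complex.conj_ofReal _

/-- `u` is a solution of `-u'' + V u = z u + η` on `(0, ∞)` with derivative `v`. -/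
structure IsStrongSol (α : ℝ) (z : ℂ) (η u v : ℝ → ℂ) : Prop where
  hasDerivAt : ∀ r, 0 < r → HasDerivAt u (v r) r
  locallyAC : LocallyAC v
  ae_hasDerivAt : ∀ᵐ r ∂halfLine, HasDerivAt v ((radialPot α r - z) * u r - η r) r

theorem IsStrongSol.conj {α : ℝ} {z : ℂ} {η u v : ℝ → ℂ} (h : IsStrongSol α z η u v) :
    IsStrongSol α ((starRingEnd ℂ) z) (fun r => (starRingEnd ℂ) (η r))
      (fun r => (starRingEnd ℂ) (u r)) (fun r => (starRingEnd ℂ) (v r)) where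
  hasDerivAt r hr := (h.hasDerivAt r hr).star
  locallyAC := h.locallyAC.conj
  ae_hasDerivAt := by
    filter_upwards [h.ae_hasDerivAt] with r hr
    convert! hr.star using 1
    simp [conj_radialPot]

theorem radialExpr_eq_zero_of_notMem {α : ℝ} {φ : ℝ → ℂ} {r : ℝ} (h : r ∉ tsupport φ) :
    radialExpr α φ r = 0 := by
  have h1 : φ =ᶠ[𝓝 r] 0 := notMem_tsupport_iff_eventuallyEq.1 h
  have h2 : deriv φ =ᶠ[𝓝 r] 0 := by
    refine h1.deriv.trans (Eventually.of_forall fun x => ?_)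
    exact deriv_const x (0 : ℂ)
  have h3 : deriv (deriv φ) r = 0 := by
    rw [h2.deriv_eq]
    exact deriv_const r (0 : ℂ)
  simp [radialExpr, h3, h1.eq_of_nhds]

/-- Green's formula on a compact interval. -/
theorem IsStrongSol.green {α : ℝ} {z : ℂ} {η u v φ : ℝ → ℂ} (h : IsStrongSol α z η u v)
    (hφ : IsMinimalFunction α φ) {a b : ℝ} (ha : 0 < a) (hab : a ≤ b) :
    ∫ r in a..b, (u r * (radialExpr α φ r - z * φ r) - η r * φ r) =
      (u a * deriv φ a - v a * φ a) - (u b * deriv φ b - v b * φ b) := by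
  have hu : LocallyAC u := LocallyAC.of_hasDerivAt h.hasDerivAt h.locallyAC.continuousOn
  have hF := ((hu.mul hφ.locallyAC_deriv).sub (h.locallyAC.mul hφ.locallyAC)) a b ha hab
  have h1 := hF.integral_complex_eq_sub
    (f' := fun r => -(u r * (radialExpr α φ r - z * φ r) - η r * φ r)) (by
      filter_upwards [ae_halfLine_of_Icc hφ.locallyAC_deriv.ae_differentiableAt ha hab,
        ae_halfLine_of_Icc h.ae_hasDerivAt ha hab] with r h1 h2 hr
      have hr0 : 0 < r := by
        rw [uIcc_of_le hab] at hr
        exact lt_of_lt_of_le ha hr.1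
      convert! ((h.hasDerivAt r hr0).mul (h1 hr).hasDerivAt).sub
        ((h2 hr).mul (hφ.differentiable r).hasDerivAt) using 1
      simp only [radialExpr, radialPot]
      ring)
  have h2 := h1.2
  rw [intervalIntegral.integral_neg] at h2
  linear_combination -h2

theorem exists_Icc_of_compact {K : Set ℝ} (hK : IsCompact K) (h0 : K ⊆ Ioi 0) :
    ∃ a b : ℝ, 0 < a ∧ a < b ∧ K ⊆ Ioo a b := by
  rcases K.eq_empty_or_nonempty with rfl | hne
  · exact ⟨1, 2, by norm_num, by norm_num, empty_subset _⟩
  · obtain ⟨m, hm, hm'⟩ := hK.exists_isLeast hne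
    obtain ⟨M, hM, hM'⟩ := hK.exists_isGreatest hne
    have h0m : (0 : ℝ) < m := h0 hm
    have := hm' hM
    refine ⟨m / 2, M + 1, by positivity, by linarith, fun x hx => ⟨?_, ?_⟩⟩
    · have := hm' hx
      linarith
    · have := hM' hx
      linarith

theorem IsStrongSol.integral_eq {α : ℝ} {z : ℂ} {η u v φ : ℝ → ℂ} (h : IsStrongSol α z η u v)
    (hφ : IsMinimalFunction α φ) :
    ∫ r, (u r * (radialExpr α φ r - z * φ r) - η r * φ r) ∂halfLine = 0 := by
  obtain ⟨a, b, ha, hab, hK⟩ := exists_Icc_of_compact hφ.hasCompactSupport hφ.tsupport_subset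
  have h0 : ∀ r, r ∉ Ioo a b → φ r = 0 ∧ deriv φ r = 0 ∧ radialExpr α φ r = 0 := fun r hr =>
    have hr' : r ∉ tsupport φ := fun h => hr (hK h)
    ⟨image_eq_zero_of_notMem_tsupport hr',
      image_eq_zero_of_notMem_tsupport fun h => hr' (tsupport_deriv_subset h),
      radialExpr_eq_zero_of_notMem hr'⟩
  have h1 := h.green hφ ha hab.le
  obtain ⟨ha1, ha2, -⟩ := h0 a (by simp)
  obtain ⟨hb1, hb2, -⟩ := h0 b (by simp)
  rw [ha1, ha2, hb1, hb2, intervalIntegral.integral_of_le hab.le] at h1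
  rw [setIntegral_eq_of_subset_of_forall_sdiff_eq_zero (s := Ioc a b) measurableSet_Ioi
    (fun x hx => ha.trans hx.1), h1]
  · ring
  · intro x hx
    obtain ⟨h2, -, h3⟩ := h0 x fun h => hx.2 ⟨h.1, h.2.le⟩
    simp [h2, h3]

/-! ### Smooth functions in the minimal domain -/

theorem IsMinimalFunction.of_contDiff {α : ℝ} {φ : ℝ → ℂ} (h : ContDiff ℝ 2 φ)
    (hc : HasCompactSupport φ) (hs : tsupport φ ⊆ Ioi 0) : IsMinimalFunction α φ where
  hasCompactSupport := hc
  tsupport_subset := hs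
  differentiable := h.differentiable (by norm_num)
  locallyAC a b _ _ := (h.of_le (by norm_num)).contDiffOn.absolutelyContinuousOnInterval
  locallyAC_deriv a b _ _ := by
    have : ContDiff ℝ 1 (deriv φ) := by
      have h' : ContDiff ℝ (1 + 1) φ := by
        norm_num
        exact h
      exact (contDiff_succ_iff_deriv.1 h').2.2
    exact this.contDiffOn.absolutelyContinuousOnInterval
  memLp := by
    have h' : ContDiff ℝ (1 + 1) φ := by
      norm_num
      exact h
    have h1 : ContDiff ℝ 1 (deriv φ) := (contDiff_succ_iff_deriv.1 h').2.2
    have h2 : Continuous (deriv (deriv φ)) := h1.continuous_deriv le_rfl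
    have h3 : Continuous fun r => radialPot α r * φ r := by
      refine continuous_of_tsupport fun x hx => ?_
      have hx' : x ∈ Ioi (0 : ℝ) := hs (tsupport_mul_subset_right hx)
      exact ((continuousOn_radialPot α).continuousAt (isOpen_Ioi.mem_nhds hx')).mul
        h.continuous.continuousAt
    have h4 : Continuous (radialExpr α φ) := h2.neg.add h3
    refine (h4.memLp_of_hasCompactSupport ?_).restrict _
    refine hc.mono' fun x hx => ?_
    by_contra hx'
    exact hx (radialExpr_eq_zero_of_notMem hx')

theorem tsupport_ofReal (g : ℝ → ℝ) : tsupport (fun r => (g r : ℂ)) = tsupport g := by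
  unfold tsupport
  congr 1
  ext x
  simp

theorem IsMinimalFunction.of_real {α : ℝ} {g : ℝ → ℝ} (h : ContDiff ℝ 2 g)
    (hc : HasCompactSupport g) (hs : tsupport g ⊆ Ioi 0) :
    IsMinimalFunction α (fun r => (g r : ℂ)) := by
  refine .of_contDiff ?_ ?_ ?_
  · exact Complex.ofRealCLM.contDiff.comp h
  · rw [HasCompactSupport, tsupport_ofReal]
    exact hc
  · rw [tsupport_ofReal]
    exact hs

theorem minimalHamiltonian_dense (α : ℝ) :
    Dense ((minimalHamiltonian α).domain : Set L2HalfLine) := by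
  rw [Submodule.dense_iff_topologicalClosure_eq_top, Submodule.topologicalClosure_eq_top_iff,
    Submodule.eq_bot_iff]
  intro f hf
  have hf2 : LocallyIntegrableOn f (Ioi 0) volume :=
    locallyIntegrableOn_of_locallyIntegrable_restrict
      ((Lp.memLp f).locallyIntegrable (by norm_num))
  have h := isOpen_Ioi.ae_eq_zero_of_integral_contDiff_smul_eq_zero hf2 (by
    intro g hg hgc hgs
    have hm : IsMinimalFunction α (fun r => (g r : ℂ)) :=
      .of_real (contDiff_infty.1 hg 2) hgc hgs
    have h1 := (Submodule.mem_orthogonal _ _).1 hf (minimalEmbedding α ⟨_, hm⟩) ⟨⟨_, hm⟩, rfl⟩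
    rw [L2.inner_def] at h1
    rw [← setIntegral_eq_integral_of_forall_compl_eq_zero (s := Ioi 0), ← h1]
    · refine integral_congr_ae ?_
      filter_upwards [hm.continuous_memLp.coeFn_toLp] with r hr
      have hr' : (minimalEmbedding α ⟨_, hm⟩ : L2HalfLine) r = (g r : ℂ) := hr
      rw [hr']
      simp [mul_comm]
    · intro x hx
      rw [image_eq_zero_of_notMem_tsupport fun h => hx (hgs h), zero_smul])
  have h' : f =ᵐ[halfLine] 0 := (ae_restrict_iff' measurableSet_Ioi).2 h
  exact (Lp.eq_zero_iff_ae_eq_zero).2 h'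

theorem minimalHamiltonian_apply {α : ℝ} (φ : minimalFunctions α)
    (h : minimalEmbedding α φ ∈ (minimalHamiltonian α).domain) :
    minimalHamiltonian α ⟨minimalEmbedding α φ, h⟩ = minimalAction α φ := by
  have : (LinearEquiv.ofInjective (minimalEmbedding α) (minimalEmbedding_injective α)).symm
      ⟨minimalEmbedding α φ, h⟩ = φ := by
    rw [LinearEquiv.symm_apply_eq]
    rfl
  exact congrArg (minimalAction α) this

theorem inner_toLp {f g : ℝ → ℂ} (hf : MemLp f 2 halfLine) (hg : MemLp g 2 halfLine) :
    inner ℂ (hf.toLp f) (hg.toLp g) = ∫ r, (starRingEnd ℂ) (f r) * g r ∂halfLine := by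
  rw [L2.inner_def]
  refine integral_congr_ae ?_
  filter_upwards [hf.coeFn_toLp, hg.coeFn_toLp] with r h1 h2
  rw [h1, h2]
  simp [mul_comm]

theorem memLp_conj {f : ℝ → ℂ} (hf : MemLp f 2 halfLine) :
    MemLp (fun r => (starRingEnd ℂ) (f r)) 2 halfLine := hf.star

theorem IsStrongSol.inner_eq {α : ℝ} {z : ℂ} {η u v : ℝ → ℂ} (h : IsStrongSol α z η u v)
    (hu : MemLp u 2 halfLine) (hη : MemLp η 2 halfLine) (x : (minimalHamiltonian α).domain) :
    inner ℂ (z • hu.toLp u + hη.toLp η) (x : L2HalfLine) =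
      inner ℂ (hu.toLp u) (minimalHamiltonian α x) := by
  obtain ⟨x, hx⟩ := x
  have hx' : x ∈ LinearMap.range (minimalEmbedding α) := hx
  obtain ⟨⟨φ, hφ⟩, rfl⟩ := hx'
  have hφ' : IsMinimalFunction α φ := hφ
  rw [minimalHamiltonian_apply]
  change inner ℂ _ (hφ'.continuous_memLp.toLp φ) = inner ℂ _ (hφ'.memLp.toLp _)
  rw [inner_add_left, inner_smul_left, inner_toLp, inner_toLp, inner_toLp]
  have i1 : Integrable (fun r => (starRingEnd ℂ) (u r) * φ r) halfLine :=
    (memLp_conj hu).integrable_mul hφ'.continuous_memLp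
  have i2 : Integrable (fun r => (starRingEnd ℂ) (η r) * φ r) halfLine :=
    (memLp_conj hη).integrable_mul hφ'.continuous_memLp
  have i3 : Integrable (fun r => (starRingEnd ℂ) (u r) * radialExpr α φ r) halfLine :=
    (memLp_conj hu).integrable_mul hφ'.memLp
  have h1 := h.conj.integral_eq hφ'
  have h2 : (fun r => (starRingEnd ℂ) (u r) * (radialExpr α φ r - (starRingEnd ℂ) z * φ r) -
      (starRingEnd ℂ) (η r) * φ r) = fun r => ((starRingEnd ℂ) (u r) * radialExpr α φ r -
        (starRingEnd ℂ) z * ((starRingEnd ℂ) (u r) * φ r)) - (starRingEnd ℂ) (η r) * φ r := by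
    funext r
    ring
  have i4 : Integrable (fun r => (starRingEnd ℂ) (u r) * radialExpr α φ r -
      (starRingEnd ℂ) z * ((starRingEnd ℂ) (u r) * φ r)) halfLine := i3.sub (i1.const_mul _)
  rw [h2, integral_sub i4 i2, integral_sub i3 (i1.const_mul _), integral_const_mul] at h1
  linear_combination -h1

theorem IsStrongSol.mem_adjoint_domain {α : ℝ} {z : ℂ} {η u v : ℝ → ℂ}
    (h : IsStrongSol α z η u v) (hu : MemLp u 2 halfLine) (hη : MemLp η 2 halfLine) :
    hu.toLp u ∈ (minimalHamiltonian α).adjoint.domain :=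
  LinearPMap.mem_adjoint_domain_of_exists _ ⟨_, h.inner_eq hu hη⟩

theorem IsStrongSol.adjoint_apply {α : ℝ} {z : ℂ} {η u v : ℝ → ℂ}
    (h : IsStrongSol α z η u v) (hu : MemLp u 2 halfLine) (hη : MemLp η 2 halfLine)
    (hd : hu.toLp u ∈ (minimalHamiltonian α).adjoint.domain) :
    (minimalHamiltonian α).adjoint ⟨hu.toLp u, hd⟩ = z • hu.toLp u + hη.toLp η :=
  LinearPMap.adjoint_apply_eq (minimalHamiltonian_dense α) _ (h.inner_eq hu hη)

/-! ### Weak solutions of the eigenvalue equation -/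

/-- A pair of classical solutions `f₁, f₂` (with derivatives `g₁, g₂`) of `-u'' + V u = z u` on
`(0, ∞)` with constant Wronskian `c ≠ 0`. -/
structure IsFundamentalPair (α : ℝ) (z c : ℂ) (f₁ g₁ f₂ g₂ : ℝ → ℂ) : Prop where
  deriv₁ : ∀ r, 0 < r → HasDerivAt f₁ (g₁ r) r
  deriv₁' : ∀ r, 0 < r → HasDerivAt g₁ ((radialPot α r - z) * f₁ r) r
  deriv₂ : ∀ r, 0 < r → HasDerivAt f₂ (g₂ r) r
  deriv₂' : ∀ r, 0 < r → HasDerivAt g₂ ((radialPot α r - z) * f₂ r) r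
  wronskian_eq : ∀ r, 0 < r → f₁ r * g₂ r - g₁ r * f₂ r = c
  ne_zero : c ≠ 0

namespace IsFundamentalPair

variable {α : ℝ} {z c : ℂ} {f₁ g₁ f₂ g₂ : ℝ → ℂ}

theorem conj (h : IsFundamentalPair α z c f₁ g₁ f₂ g₂) :
    IsFundamentalPair α ((starRingEnd ℂ) z) ((starRingEnd ℂ) c)
      (fun r => (starRingEnd ℂ) (f₁ r)) (fun r => (starRingEnd ℂ) (g₁ r))
      (fun r => (starRingEnd ℂ) (f₂ r)) (fun r => (starRingEnd ℂ) (g₂ r)) where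
  deriv₁ r hr := (h.deriv₁ r hr).star
  deriv₁' r hr := by
    convert! (h.deriv₁' r hr).star using 1
    simp [conj_radialPot]
  deriv₂ r hr := (h.deriv₂ r hr).star
  deriv₂' r hr := by
    convert! (h.deriv₂' r hr).star using 1
    simp [conj_radialPot]
  wronskian_eq r hr := by
    rw [← h.wronskian_eq r hr]
    simp
  ne_zero := by simpa using h.ne_zero

theorem cont₁ (h : IsFundamentalPair α z c f₁ g₁ f₂ g₂) : ContinuousOn f₁ (Ioi 0) :=
  fun r hr => (h.deriv₁ r hr).continuousAt.continuousWithinAt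

theorem cont₂ (h : IsFundamentalPair α z c f₁ g₁ f₂ g₂) : ContinuousOn f₂ (Ioi 0) :=
  fun r hr => (h.deriv₂ r hr).continuousAt.continuousWithinAt

theorem cont₁' (h : IsFundamentalPair α z c f₁ g₁ f₂ g₂) : ContinuousOn g₁ (Ioi 0) :=
  fun r hr => (h.deriv₁' r hr).continuousAt.continuousWithinAt

theorem cont₂' (h : IsFundamentalPair α z c f₁ g₁ f₂ g₂) : ContinuousOn g₂ (Ioi 0) :=
  fun r hr => (h.deriv₂' r hr).continuousAt.continuousWithinAt

end IsFundamentalPair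

theorem continuous_mul_of_tsupport {f g : ℝ → ℂ} (hf : ContinuousOn f (Ioi 0)) (hg : Continuous g)
    (hs : tsupport g ⊆ Ioi 0) : Continuous fun r => f r * g r := by
  refine continuous_of_tsupport fun x hx => ?_
  have hx' : x ∈ Ioi (0 : ℝ) := hs (tsupport_mul_subset_right hx)
  exact (hf.continuousAt (isOpen_Ioi.mem_nhds hx')).mul hg.continuousAt

/-- The inhomogeneous equation has a solution of compact support when the right-hand side is
orthogonal to the solutions of the homogeneous equation. -/
theorem IsFundamentalPair.exists_minimal {α : ℝ} {z c : ℂ} {f₁ g₁ f₂ g₂ : ℝ → ℂ}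
    (h : IsFundamentalPair α z c f₁ g₁ f₂ g₂) {g : ℝ → ℂ} (hg : Continuous g)
    (hc : HasCompactSupport g) (hs : tsupport g ⊆ Ioi 0)
    (h1 : ∫ r, f₁ r * g r ∂halfLine = 0) (h2 : ∫ r, f₂ r * g r ∂halfLine = 0) :
    ∃ φ : ℝ → ℂ, IsMinimalFunction α φ ∧ ∀ r, 0 < r → radialExpr α φ r - z * φ r = g r := by
  obtain ⟨a, b, ha, hab, hK⟩ := exists_Icc_of_compact hc hs
  have hg0 : ∀ r, r ∉ Ioo a b → g r = 0 := fun r hr =>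
    image_eq_zero_of_notMem_tsupport fun h => hr (hK h)
  have key : ∀ f : ℝ → ℂ, ContinuousOn f (Ioi 0) → ∫ r, f r * g r ∂halfLine = 0 →
      (∀ r, HasDerivAt (fun x => ∫ t in a..x, f t * g t) (f r * g r) r) ∧
      ∀ r, r ∉ Ioo a b → ∫ t in a..r, f t * g t = 0 := by
    intro f hf hf0
    have hcont := continuous_mul_of_tsupport hf hg hs
    refine ⟨fun r => intervalIntegral.integral_hasDerivAt_right (hcont.intervalIntegrable _ _)
      (hcont.stronglyMeasurableAtFilter _ _) hcont.continuousAt, fun r hr => ?_⟩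
    rcases le_or_gt r a with hra | hra
    · rw [intervalIntegral.integral_of_ge hra, setIntegral_eq_zero_of_forall_eq_zero, neg_zero]
      intro x hx
      rw [hg0 x fun h => absurd h.1 (not_lt.2 hx.2), mul_zero]
    · rw [intervalIntegral.integral_of_le hra.le, ← hf0]
      refine (setIntegral_eq_of_subset_of_forall_sdiff_eq_zero measurableSet_Ioi
        (fun x hx => ha.trans hx.1) fun x hx => ?_).symm
      rw [hg0 x fun h => ?_, mul_zero]
      have hbr : b ≤ r := not_lt.1 fun h' => hr ⟨hra, h'⟩
      exact hx.2 ⟨h.1, h.2.le.trans hbr⟩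
  obtain ⟨d1, e1⟩ := key f₁ h.cont₁ h1
  obtain ⟨d2, e2⟩ := key f₂ h.cont₂ h2
  set P₁ := fun x => ∫ t in a..x, f₁ t * g t with hP₁
  set P₂ := fun x => ∫ t in a..x, f₂ t * g t with hP₂
  set φ : ℝ → ℂ := fun r => -c⁻¹ * (f₂ r * P₁ r - f₁ r * P₂ r) with hφ
  set φ' : ℝ → ℂ := fun r => -c⁻¹ * (g₂ r * P₁ r - g₁ r * P₂ r) with hφ'
  set φ'' : ℝ → ℂ := fun r => (radialPot α r - z) * φ r - g r with hφ''
  have hout : ∀ r, r ∉ Ioo a b → φ r = 0 ∧ φ' r = 0 ∧ φ'' r = 0 := by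
    intro r hr
    have hp1 : P₁ r = 0 := e1 r hr
    have hp2 : P₂ r = 0 := e2 r hr
    simp [hφ, hφ', hφ'', hp1, hp2, hg0 r hr]
  have hev : ∀ r, r ≤ 0 → ∀ᶠ x in 𝓝 r, x ∉ Ioo a b := by
    intro r hr
    filter_upwards [Iio_mem_nhds (lt_of_le_of_lt hr ha)] with x hx h'
    exact lt_asymm hx h'.1
  have hd : ∀ r, HasDerivAt φ (φ' r) r := by
    intro r
    rcases lt_or_ge 0 r with hr | hr
    · convert! (((h.deriv₂ r hr).mul (d1 r)).sub ((h.deriv₁ r hr).mul (d2 r))).const_mul (-c⁻¹)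
        using 1
      simp only [hφ', hP₁, hP₂]
      ring
    · have h0 : φ =ᶠ[𝓝 r] fun _ => 0 := (hev r hr).mono fun x hx => (hout x hx).1
      rw [(hout r (hev r hr).self_of_nhds).2.1]
      exact (hasDerivAt_const r (0 : ℂ)).congr_of_eventuallyEq h0
  have hd' : ∀ r, HasDerivAt φ' (φ'' r) r := by
    intro r
    rcases lt_or_ge 0 r with hr | hr
    · convert! (((h.deriv₂' r hr).mul (d1 r)).sub ((h.deriv₁' r hr).mul (d2 r))).const_mul (-c⁻¹)
        using 1
      have hw := h.wronskian_eq r hr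
      have hc0 : c⁻¹ * (f₁ r * g₂ r - g₁ r * f₂ r) = 1 := by rw [hw, inv_mul_cancel₀ h.ne_zero]
      simp only [hφ'', hφ, hP₁, hP₂]
      linear_combination g r * hc0
    · have h0 : φ' =ᶠ[𝓝 r] fun _ => 0 := (hev r hr).mono fun x hx => (hout x hx).2.1
      rw [(hout r (hev r hr).self_of_nhds).2.2]
      exact (hasDerivAt_const r (0 : ℂ)).congr_of_eventuallyEq h0
  have hφd : deriv φ = φ' := funext fun r => (hd r).deriv
  have hφd' : deriv φ' = φ'' := funext fun r => (hd' r).deriv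
  have hsup : tsupport φ ⊆ Icc a b :=
    closure_minimal (fun x hx => by
      by_contra h'
      exact hx (hout x fun h => h' ⟨h.1.le, h.2.le⟩).1) isClosed_Icc
  have hcs : HasCompactSupport φ :=
    isCompact_Icc.of_isClosed_subset (isClosed_tsupport φ) hsup
  have hs0 : tsupport φ ⊆ Ioi 0 := fun x hx => lt_of_lt_of_le ha (hsup hx).1
  have hcφ : Continuous φ := continuous_iff_continuousAt.2 fun r => (hd r).continuousAt
  have hcφ'' : Continuous φ'' := by
    have : Continuous fun r => (radialPot α r - z) * φ r :=
      continuous_mul_of_tsupport ((continuousOn_radialPot α).sub continuousOn_const) hcφ hs0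
    exact this.sub hg
  have hC : ContDiff ℝ 2 φ := by
    have h1 : ContDiff ℝ 1 φ' := by
      rw [contDiff_one_iff_deriv, hφd']
      exact ⟨fun r => (hd' r).differentiableAt, hcφ''⟩
    have : ContDiff ℝ (1 + 1) φ := by
      rw [contDiff_succ_iff_deriv, hφd]
      exact ⟨fun r => (hd r).differentiableAt, by simp, h1⟩
    norm_num at this
    exact this
  refine ⟨φ, .of_contDiff hC hcs hs0, fun r hr => ?_⟩
  simp only [radialExpr, hφd, hφd', hφ'']
  unfold radialPot
  ring

/-- The space of continuous functions with compact support in `(0, ∞)`. -/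
def testFunctions : Submodule ℂ (ℝ → ℂ) where
  carrier := {g | Continuous g ∧ HasCompactSupport g ∧ tsupport g ⊆ Ioi 0}
  zero_mem' := ⟨continuous_zero, HasCompactSupport.zero, by simp [tsupport]⟩
  add_mem' := fun {u v} hu hv => ⟨hu.1.add hv.1, hu.2.1.add hv.2.1,
    (tsupport_add u v).trans (union_subset hu.2.2 hv.2.2)⟩
  smul_mem' := fun c {u} hu => ⟨hu.1.const_smul c, hu.2.1.smul_left (f := fun _ => c),
    (closure_mono (Function.support_const_smul_subset c u)).trans hu.2.2⟩

theorem integrable_mul_test {f g : ℝ → ℂ} (hf : LocallyIntegrableOn f (Ioi 0) volume)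
    (hg : g ∈ testFunctions) : Integrable (fun r => f r * g r) halfLine := by
  obtain ⟨hc, hs, h0⟩ := hg
  have h1 : IntegrableOn f (tsupport g) volume := hf.integrableOn_compact_subset h0 hs
  have h2 : IntegrableOn (fun r => f r * g r) (tsupport g) volume :=
    h1.mul_continuousOn hc.continuousOn hs
  have h3 : Integrable (fun r => f r * g r) volume :=
    (integrableOn_iff_integrable_of_support_subset fun x hx =>
      subset_tsupport g (right_ne_zero_of_mul hx)).1 h2
  exact h3.integrableOn

/-- The functional on test functions given by a locally integrable function. -/
noncomputable def testPairing (f : ℝ → ℂ) (hf : LocallyIntegrableOn f (Ioi 0) volume) :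
    testFunctions →ₗ[ℂ] ℂ where
  toFun g := ∫ r, f r * g.1 r ∂halfLine
  map_add' g g' := by
    rw [← integral_add (integrable_mul_test hf g.2) (integrable_mul_test hf g'.2)]
    congr 1
    funext r
    simp [mul_add]
  map_smul' c g := by
    simp only [Submodule.coe_smul, Pi.smul_apply, smul_eq_mul, RingHom.id_apply]
    rw [← integral_const_mul]
    congr 1
    funext r
    ring

/-- Weyl's lemma for the radial operator. -/
theorem IsFundamentalPair.eq_of_weak {α : ℝ} {z c : ℂ} {f₁ g₁ f₂ g₂ : ℝ → ℂ}
    (h : IsFundamentalPair α z c f₁ g₁ f₂ g₂) {u : ℝ → ℂ}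
    (hu : LocallyIntegrableOn u (Ioi 0) volume)
    (hw : ∀ φ, IsMinimalFunction α φ →
      ∫ r, u r * (radialExpr α φ r - z * φ r) ∂halfLine = 0) :
    ∃ c₁ c₂ : ℂ, u =ᵐ[halfLine] fun r => c₁ * f₁ r + c₂ * f₂ r := by
  have hl₁ := h.cont₁.locallyIntegrableOn (μ := volume) measurableSet_Ioi
  have hl₂ := h.cont₂.locallyIntegrableOn (μ := volume) measurableSet_Ioi
  let L : Fin 2 → testFunctions →ₗ[ℂ] ℂ := ![testPairing f₁ hl₁, testPairing f₂ hl₂]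
  have hk : testPairing u hu ∈ Submodule.span ℂ (range L) := by
    refine mem_span_of_iInf_ker_le_ker fun g hg => ?_
    simp only [Submodule.mem_iInf, LinearMap.mem_ker] at hg
    obtain ⟨φ, hφ, hφg⟩ := h.exists_minimal g.2.1 g.2.2.1 g.2.2.2 (hg 0) (hg 1)
    rw [LinearMap.mem_ker, ← hw φ hφ]
    refine setIntegral_congr_fun measurableSet_Ioi fun r hr => ?_
    simp only [hφg r hr]
  rw [show range L = {testPairing f₁ hl₁, testPairing f₂ hl₂} by
    simp [L, Matrix.range_cons, pair_comm], Submodule.mem_span_pair] at hk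
  obtain ⟨c₁, c₂, hk⟩ := hk
  refine ⟨c₁, c₂, ?_⟩
  have hl : LocallyIntegrableOn (fun r => u r - (c₁ * f₁ r + c₂ * f₂ r)) (Ioi 0) volume :=
    hu.sub ((continuousOn_const.mul h.cont₁).add (continuousOn_const.mul h.cont₂)
      |>.locallyIntegrableOn measurableSet_Ioi)
  have h0 := isOpen_Ioi.ae_eq_zero_of_integral_contDiff_smul_eq_zero hl (by
    intro g hg hgc hgs
    have hm : (fun r => (g r : ℂ)) ∈ testFunctions :=
      ⟨Complex.continuous_ofReal.comp hg.continuous, by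
        rw [HasCompactSupport, tsupport_ofReal]
        exact hgc, by
        rw [tsupport_ofReal]
        exact hgs⟩
    have e := congrArg (fun T => T ⟨_, hm⟩) hk
    simp only [LinearMap.add_apply, LinearMap.smul_apply, smul_eq_mul] at e
    change c₁ * (∫ r, f₁ r * (g r : ℂ) ∂halfLine) + c₂ * (∫ r, f₂ r * (g r : ℂ) ∂halfLine) =
      ∫ r, u r * (g r : ℂ) ∂halfLine at e
    have i1 := integrable_mul_test hl₁ hm
    have i2 := integrable_mul_test hl₂ hm
    have i3 := integrable_mul_test hu hm
    have i4 : Integrable (fun r => c₁ * (f₁ r * (g r : ℂ)) + c₂ * (f₂ r * (g r : ℂ))) halfLine :=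
      (i1.const_mul _).add (i2.const_mul _)
    rw [← integral_const_mul, ← integral_const_mul,
      ← integral_add (i1.const_mul _) (i2.const_mul _), eq_comm, ← sub_eq_zero,
      ← integral_sub i3 i4] at e
    rw [← setIntegral_eq_integral_of_forall_compl_eq_zero (s := Ioi 0), ← e]
    · congr 1
      funext r
      rw [Complex.real_smul]
      ring
    · intro x hx
      rw [image_eq_zero_of_notMem_tsupport fun h => hx (hgs h), zero_smul])
  have h1 : ∀ᵐ r ∂halfLine, u r - (c₁ * f₁ r + c₂ * f₂ r) = 0 :=
    (ae_restrict_iff' measurableSet_Ioi).2 h0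
  filter_upwards [h1] with r hr
  exact sub_eq_zero.1 hr

end AnyonDelta

open scoped ENNReal
namespace AnyonDelta

/-! ### Integral operators with an exponentially decaying kernel -/

theorem lintegral_mul_sq_le {X : Type*} [MeasurableSpace X] (μ : Measure X) {f g : X → ℝ≥0∞}
    (hf : AEMeasurable f μ) (hg : AEMeasurable g μ) :
    (∫⁻ x, f x * g x ∂μ) ^ 2 ≤ (∫⁻ x, f x ^ 2 ∂μ) * ∫⁻ x, g x ^ 2 ∂μ := by
  have h := ENNReal.lintegral_mul_le_Lp_mul_Lq μ Real.HolderConjugate.two_two hf hg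
  calc (∫⁻ x, f x * g x ∂μ) ^ 2
      ≤ ((∫⁻ x, f x ^ (2 : ℝ) ∂μ) ^ (1 / 2 : ℝ) * (∫⁻ x, g x ^ (2 : ℝ) ∂μ) ^ (1 / 2 : ℝ)) ^ 2 := by
        gcongr
        exact h
    _ = _ := by
        rw [mul_pow, ← ENNReal.rpow_two, ← ENNReal.rpow_two, ← ENNReal.rpow_mul,
          ← ENNReal.rpow_mul]
        norm_num

/-- A nonnegative weight `w` is admissible for the rate `b` when `∫ w(r)² e^{-b|r-t|} dr` is
bounded in `t`. -/
structure IsAdmissibleWeight (b M : ℝ) (w : ℝ → ℝ) : Prop where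
  pos : 0 < b
  nonneg : ∀ r, 0 ≤ w r
  measurable : Measurable w
  bound : ∀ t : ℝ, ∫⁻ r, ENNReal.ofReal (w r ^ 2 * Real.exp (-b * |r - t|)) ∂halfLine ≤
    ENNReal.ofReal M

theorem IsAdmissibleWeight.schur {b M : ℝ} {w : ℝ → ℝ} (hw : IsAdmissibleWeight b M w)
    {η : ℝ → ℂ} (hη : AEMeasurable η halfLine) :
    ∫⁻ r, (∫⁻ t, ENNReal.ofReal (w r * w t * Real.exp (-b * |r - t|)) * ‖η t‖ₑ ∂halfLine) ^ 2
      ∂halfLine ≤ ENNReal.ofReal M ^ 2 * ∫⁻ t, ‖η t‖ₑ ^ 2 ∂halfLine := by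
  have hm := hw.measurable
  set W : ℝ → ℝ≥0∞ := fun r => ENNReal.ofReal (w r) with hW
  set e : ℝ → ℝ → ℝ≥0∞ := fun r t => ENNReal.ofReal (Real.exp (-b * |r - t| / 2)) with he
  have hWm : Measurable W := hm.ennreal_ofReal
  have hem : Measurable (Function.uncurry e) := by
    simp only [he, Function.uncurry_def]
    fun_prop
  have hsplit : ∀ r t, ENNReal.ofReal (w r * w t * Real.exp (-b * |r - t|)) =
      W r * (W t * e r t) * e r t := by
    intro r t
    simp only [hW, he]
    rw [mul_assoc, mul_assoc (ENNReal.ofReal (w r)), mul_assoc (ENNReal.ofReal (w t)),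
      ← ENNReal.ofReal_mul (Real.exp_nonneg _), ← Real.exp_add,
      ← ENNReal.ofReal_mul (hw.nonneg t),
      ← ENNReal.ofReal_mul (hw.nonneg r)]
    congr 4
    ring
  have hsq : ∀ r t, ENNReal.ofReal (w r ^ 2 * Real.exp (-b * |r - t|)) = W r ^ 2 * e r t ^ 2 := by
    intro r t
    simp only [hW, he]
    rw [ENNReal.ofReal_mul (sq_nonneg _), ENNReal.ofReal_pow (hw.nonneg r),
      ← ENNReal.ofReal_pow (Real.exp_nonneg _), ← Real.exp_nat_mul]
    congr 3
    push_cast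
    ring
  have hsymm : ∀ r t, e r t = e t r := fun r t => by
    simp only [he]
    rw [abs_sub_comm]
  have hb1 : ∀ t, ∫⁻ r, W r ^ 2 * e r t ^ 2 ∂halfLine ≤ ENNReal.ofReal M := fun t => by
    simpa only [hsq] using hw.bound t
  have step : ∀ r, (∫⁻ t, ENNReal.ofReal (w r * w t * Real.exp (-b * |r - t|)) * ‖η t‖ₑ
      ∂halfLine) ^ 2 ≤
      ENNReal.ofReal M * ∫⁻ t, W r ^ 2 * (e r t ^ 2 * ‖η t‖ₑ ^ 2) ∂halfLine := by
    intro r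
    have her : Measurable (e r) := hem.of_uncurry_left
    have e1 : ∫⁻ t, ENNReal.ofReal (w r * w t * Real.exp (-b * |r - t|)) * ‖η t‖ₑ ∂halfLine =
        W r * ∫⁻ t, (W t * e r t) * (e r t * ‖η t‖ₑ) ∂halfLine := by
      rw [← lintegral_const_mul' _ _ (by simp [hW])]
      refine lintegral_congr fun t => ?_
      rw [hsplit]
      ring
    have e2 : ∫⁻ t, W r ^ 2 * (e r t ^ 2 * ‖η t‖ₑ ^ 2) ∂halfLine =
        W r ^ 2 * ∫⁻ t, (e r t * ‖η t‖ₑ) ^ 2 ∂halfLine := by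
      rw [← lintegral_const_mul' _ _ (by simp [hW])]
      simp only [mul_pow]
    rw [e1, e2, mul_pow]
    calc W r ^ 2 * (∫⁻ t, (W t * e r t) * (e r t * ‖η t‖ₑ) ∂halfLine) ^ 2
        ≤ W r ^ 2 * ((∫⁻ t, (W t * e r t) ^ 2 ∂halfLine) *
            ∫⁻ t, (e r t * ‖η t‖ₑ) ^ 2 ∂halfLine) := by
          gcongr
          exact lintegral_mul_sq_le _ (hWm.mul her).aemeasurable
            (her.aemeasurable.mul hη.enorm)
      _ ≤ W r ^ 2 * (ENNReal.ofReal M * ∫⁻ t, (e r t * ‖η t‖ₑ) ^ 2 ∂halfLine) := by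
          gcongr
          refine le_trans (le_of_eq ?_) (hb1 r)
          refine lintegral_congr fun t => ?_
          rw [mul_pow, hsymm]
      _ = _ := by ring
  calc _ ≤ ∫⁻ r, ENNReal.ofReal M * ∫⁻ t, W r ^ 2 * (e r t ^ 2 * ‖η t‖ₑ ^ 2) ∂halfLine
        ∂halfLine := lintegral_mono step
    _ = ENNReal.ofReal M * ∫⁻ t, ∫⁻ r, W r ^ 2 * (e r t ^ 2 * ‖η t‖ₑ ^ 2) ∂halfLine
        ∂halfLine := by
        rw [lintegral_const_mul' _ _ ENNReal.ofReal_ne_top, lintegral_lintegral_swap]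
        refine AEMeasurable.mul (hWm.comp measurable_fst |>.pow_const 2).aemeasurable
          (AEMeasurable.mul (hem.pow_const 2).aemeasurable ?_)
        exact (hη.enorm.pow_const 2).comp_snd
    _ ≤ ENNReal.ofReal M * ∫⁻ t, ENNReal.ofReal M * ‖η t‖ₑ ^ 2 ∂halfLine := by
        gcongr with t
        calc ∫⁻ r, W r ^ 2 * (e r t ^ 2 * ‖η t‖ₑ ^ 2) ∂halfLine
            = (∫⁻ r, W r ^ 2 * e r t ^ 2 ∂halfLine) * ‖η t‖ₑ ^ 2 := by
              rw [← lintegral_mul_const' _ _ (by simp)]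
              simp only [mul_assoc]
          _ ≤ _ := by
              gcongr
              exact hb1 t
    _ = _ := by
        rw [lintegral_const_mul' _ _ ENNReal.ofReal_ne_top]
        ring

theorem memLp_two_of_lintegral {μ : Measure ℝ} {f : ℝ → ℂ} (hf : AEStronglyMeasurable f μ)
    (h : ∫⁻ x, ‖f x‖ₑ ^ 2 ∂μ < ∞) : MemLp f 2 μ := by
  refine ⟨hf, ?_⟩
  rw [eLpNorm_lt_top_iff_lintegral_rpow_enorm_lt_top (by norm_num) (by norm_num)]
  simpa using h

theorem lintegral_sq_eq {μ : Measure ℝ} {f : ℝ → ℂ} :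
    ∫⁻ x, ‖f x‖ₑ ^ 2 ∂μ = eLpNorm f 2 μ ^ 2 := by
  have := eLpNorm_nnreal_pow_eq_lintegral (f := f) (μ := μ) (p := 2) (by norm_num)
  simp only [NNReal.coe_ofNat, ENNReal.rpow_ofNat, ENNReal.coe_ofNat] at this
  exact this.symm

/-- The kernel `g(r_<) h(r_>)`. -/
def greenKernel (g h : ℝ → ℂ) (r t : ℝ) : ℂ := g (min r t) * h (max r t)

/-- The bounds under which `greenKernel g h` is the kernel of a bounded operator. -/
structure HasKernelBounds (b M : ℝ) (w : ℝ → ℝ) (g h : ℝ → ℂ) : Prop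
    extends IsAdmissibleWeight b M w where
  cont_left : ContinuousOn g (Ioi 0)
  cont_right : ContinuousOn h (Ioi 0)
  bound_left : ∀ r, 0 < r → ‖g r‖ ≤ w r * Real.exp (b * r)
  bound_right : ∀ r, 0 < r → ‖h r‖ ≤ w r * Real.exp (-b * r)

namespace HasKernelBounds

variable {b M : ℝ} {w : ℝ → ℝ} {g h : ℝ → ℂ}

theorem norm_greenKernel_le (H : HasKernelBounds b M w g h) {r t : ℝ} (hr : 0 < r) (ht : 0 < t) :
    ‖greenKernel g h r t‖ ≤ w r * w t * Real.exp (-b * |r - t|) := by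
  rw [greenKernel, norm_mul]
  rcases le_total r t with hrt | hrt
  · rw [min_eq_left hrt, max_eq_right hrt]
    calc _ ≤ (w r * Real.exp (b * r)) * (w t * Real.exp (-b * t)) :=
          mul_le_mul (H.bound_left r hr) (H.bound_right t ht) (norm_nonneg _)
            (mul_nonneg (H.nonneg r) (Real.exp_nonneg _))
      _ = w r * w t * (Real.exp (b * r) * Real.exp (-b * t)) := by ring
      _ = _ := by
          rw [← Real.exp_add, abs_of_nonpos (sub_nonpos.2 hrt)]
          congr 2
          ring
  · rw [min_eq_right hrt, max_eq_left hrt]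
    calc _ ≤ (w t * Real.exp (b * t)) * (w r * Real.exp (-b * r)) :=
          mul_le_mul (H.bound_left t ht) (H.bound_right r hr) (norm_nonneg _)
            (mul_nonneg (H.nonneg t) (Real.exp_nonneg _))
      _ = w r * w t * (Real.exp (b * t) * Real.exp (-b * r)) := by ring
      _ = _ := by
          rw [← Real.exp_add, abs_of_nonneg (sub_nonneg.2 hrt)]
          congr 2
          ring

theorem memLp_right (H : HasKernelBounds b M w g h) : MemLp h 2 halfLine := by
  refine memLp_two_of_lintegral (H.cont_right.aestronglyMeasurable measurableSet_Ioi) ?_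
  refine lt_of_le_of_lt ?_ (lt_of_le_of_lt (H.bound 0) ENNReal.ofReal_lt_top)
  refine setLIntegral_mono_ae' measurableSet_Ioi (Eventually.of_forall fun r hr => ?_)
  have hr : 0 < r := hr
  rw [← ofReal_norm, ← ENNReal.ofReal_pow (norm_nonneg _)]
  refine ENNReal.ofReal_le_ofReal ?_
  calc ‖h r‖ ^ 2 ≤ (w r * Real.exp (-b * r)) ^ 2 := by
        gcongr
        exact H.bound_right r hr
    _ = w r ^ 2 * (Real.exp (-b * r) * Real.exp (-b * r)) := by ring
    _ ≤ w r ^ 2 * (1 * Real.exp (-b * r)) := by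
        gcongr
        rw [Real.exp_le_one_iff]
        have := H.pos
        nlinarith
    _ = _ := by rw [sub_zero, abs_of_pos hr, one_mul]

theorem memLp_left (H : HasKernelBounds b M w g h) (R : ℝ) :
    MemLp g 2 (volume.restrict (Ioc 0 R)) := by
  have hsub : Ioc 0 R ⊆ Ioi (0 : ℝ) := fun x hx => hx.1
  refine memLp_two_of_lintegral ((H.cont_left.mono hsub).aestronglyMeasurable measurableSet_Ioc) ?_
  have h1 : ∫⁻ r, ENNReal.ofReal (Real.exp (3 * b * |R|)) *
      ENNReal.ofReal (w r ^ 2 * Real.exp (-b * |r - 0|)) ∂halfLine < ∞ := by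
    rw [lintegral_const_mul' _ _ ENNReal.ofReal_ne_top]
    exact ENNReal.mul_lt_top ENNReal.ofReal_lt_top
      (lt_of_le_of_lt (H.bound 0) ENNReal.ofReal_lt_top)
  refine lt_of_le_of_lt ?_ h1
  refine le_trans ?_ (lintegral_mono_set hsub)
  refine setLIntegral_mono_ae' measurableSet_Ioc (Eventually.of_forall fun r hr => ?_)
  rw [← ofReal_norm, ← ENNReal.ofReal_pow (norm_nonneg _),
    ← ENNReal.ofReal_mul (Real.exp_nonneg _)]
  refine ENNReal.ofReal_le_ofReal ?_
  have hb := H.pos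
  calc ‖g r‖ ^ 2 ≤ (w r * Real.exp (b * r)) ^ 2 := by
        gcongr
        exact H.bound_left r hr.1
    _ = w r ^ 2 * (Real.exp (b * r) * Real.exp (b * r)) := by ring
    _ ≤ w r ^ 2 * (Real.exp (3 * b * |R|) * Real.exp (-b * |r - 0|)) := by
        gcongr w r ^ 2 * ?_
        rw [← Real.exp_add, ← Real.exp_add, Real.exp_le_exp, sub_zero, abs_of_pos hr.1,
          abs_of_pos (hr.1.trans_le hr.2)]
        nlinarith [hr.2, hr.1]
    _ = _ := by ring

theorem aestronglyMeasurable_greenKernel (H : HasKernelBounds b M w g h) {r : ℝ} (hr : 0 < r) :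
    AEStronglyMeasurable (greenKernel g h r) halfLine := by
  refine ContinuousOn.aestronglyMeasurable ?_ measurableSet_Ioi
  refine ContinuousOn.mul ?_ ?_
  · exact H.cont_left.comp (by fun_prop) fun t ht => lt_min hr ht
  · exact H.cont_right.comp (by fun_prop) fun t ht => lt_of_lt_of_le hr (le_max_left _ _)

theorem memLp_greenKernel (H : HasKernelBounds b M w g h) {r : ℝ} (hr : 0 < r) :
    MemLp (greenKernel g h r) 2 halfLine := by
  refine memLp_two_of_lintegral (H.aestronglyMeasurable_greenKernel hr) ?_
  have h1 : ∫⁻ t, ENNReal.ofReal (w r ^ 2) *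
      ENNReal.ofReal (w t ^ 2 * Real.exp (-b * |t - r|)) ∂halfLine < ∞ := by
    rw [lintegral_const_mul' _ _ ENNReal.ofReal_ne_top]
    exact ENNReal.mul_lt_top ENNReal.ofReal_lt_top
      (lt_of_le_of_lt (H.bound r) ENNReal.ofReal_lt_top)
  refine lt_of_le_of_lt ?_ h1
  refine setLIntegral_mono_ae' measurableSet_Ioi (Eventually.of_forall fun t ht => ?_)
  rw [← ofReal_norm, ← ENNReal.ofReal_pow (norm_nonneg _), ← ENNReal.ofReal_mul (sq_nonneg _)]
  refine ENNReal.ofReal_le_ofReal ?_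
  have hb := H.pos
  calc ‖greenKernel g h r t‖ ^ 2 ≤ (w r * w t * Real.exp (-b * |r - t|)) ^ 2 := by
        gcongr
        exact H.norm_greenKernel_le hr ht
    _ = w r ^ 2 * (w t ^ 2 * (Real.exp (-b * |r - t|) * Real.exp (-b * |r - t|))) := by ring
    _ ≤ w r ^ 2 * (w t ^ 2 * (1 * Real.exp (-b * |r - t|))) := by
        gcongr
        rw [Real.exp_le_one_iff]
        nlinarith [abs_nonneg (r - t)]
    _ = _ := by rw [one_mul, abs_sub_comm]

theorem integrable_greenKernel_mul (H : HasKernelBounds b M w g h) {r : ℝ} (hr : 0 < r)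
    {η : ℝ → ℂ} (hη : MemLp η 2 halfLine) :
    Integrable (fun t => greenKernel g h r t * η t) halfLine :=
  (H.memLp_greenKernel hr).integrable_mul hη

/-- `∫_0^r g η`. -/
noncomputable def _root_.AnyonDelta.lowerPart (g η : ℝ → ℂ) (r : ℝ) : ℂ := ∫ t in (0 : ℝ)..r, g t * η t

/-- `∫_r^∞ h η`. -/
noncomputable def _root_.AnyonDelta.upperPart (h η : ℝ → ℂ) (r : ℝ) : ℂ :=
  (∫ t, h t * η t ∂halfLine) - ∫ t in (0 : ℝ)..r, h t * η t

theorem intervalIntegrable_left (H : HasKernelBounds b M w g h) {η : ℝ → ℂ}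
    (hη : MemLp η 2 halfLine) {R : ℝ} (hR : 0 ≤ R) :
    IntervalIntegrable (fun t => g t * η t) volume 0 R := by
  rw [intervalIntegrable_iff_integrableOn_Ioc_of_le hR]
  exact (H.memLp_left R).integrable_mul
    (hη.mono_measure (Measure.restrict_mono (fun x hx => hx.1) le_rfl))

theorem integrable_right (H : HasKernelBounds b M w g h) {η : ℝ → ℂ}
    (hη : MemLp η 2 halfLine) : Integrable (fun t => h t * η t) halfLine :=
  H.memLp_right.integrable_mul hη

theorem intervalIntegrable_right (H : HasKernelBounds b M w g h) {η : ℝ → ℂ}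
    (hη : MemLp η 2 halfLine) {R : ℝ} (hR : 0 ≤ R) :
    IntervalIntegrable (fun t => h t * η t) volume 0 R := by
  rw [intervalIntegrable_iff_integrableOn_Ioc_of_le hR]
  exact IntegrableOn.mono_set (t := Ioi 0) (H.integrable_right hη) fun x hx => hx.1

theorem _root_.AnyonDelta.integral_halfLine_eq_add {f : ℝ → ℂ} (hf : Integrable f halfLine) {r : ℝ}
    (hr : 0 ≤ r) : ∫ t, f t ∂halfLine = (∫ t in Ioc 0 r, f t) + ∫ t in Ioi r, f t := by
  have h : ∫ t in Ioi 0, f t = ∫ t in Ioc 0 r ∪ Ioi r, f t := by rw [Ioc_union_Ioi_eq_Ioi hr]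
  refine h.trans (setIntegral_union (Ioc_disjoint_Ioi le_rfl) measurableSet_Ioi ?_ ?_)
  · exact IntegrableOn.mono_set (t := Ioi 0) hf fun x hx => hx.1
  · exact IntegrableOn.mono_set (t := Ioi 0) hf fun x hx => lt_of_le_of_lt hr hx

theorem integral_greenKernel (H : HasKernelBounds b M w g h) {η : ℝ → ℂ}
    (hη : MemLp η 2 halfLine) {r : ℝ} (hr : 0 < r) :
    ∫ t, greenKernel g h r t * η t ∂halfLine =
      h r * lowerPart g η r + g r * upperPart h η r := by
  have hi := H.integrable_greenKernel_mul hr hη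
  rw [integral_halfLine_eq_add hi hr.le, lowerPart, upperPart,
    integral_halfLine_eq_add (H.integrable_right hη) hr.le, intervalIntegral.integral_of_le hr.le,
    intervalIntegral.integral_of_le hr.le, add_sub_cancel_left, ← integral_const_mul,
    ← integral_const_mul]
  congr 1
  · refine setIntegral_congr_fun measurableSet_Ioc fun t ht => ?_
    simp only [greenKernel, min_eq_right ht.2, max_eq_left ht.2]
    ring
  · refine setIntegral_congr_fun measurableSet_Ioi fun t ht => ?_
    have ht : r ≤ t := le_of_lt ht
    simp only [greenKernel, min_eq_left ht, max_eq_right ht]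
    ring

theorem locallyAC_lowerPart (H : HasKernelBounds b M w g h) {η : ℝ → ℂ}
    (hη : MemLp η 2 halfLine) : LocallyAC (lowerPart g η) := fun a c ha hac =>
  (absolutelyContinuousOnInterval_primitive
    (H.intervalIntegrable_left hη (ha.le.trans hac))).mono (by
      rw [uIcc_of_le hac, uIcc_of_le (ha.le.trans hac)]
      exact Icc_subset_Icc_left ha.le)

theorem locallyAC_const (c : ℂ) : LocallyAC fun _ => c := fun _ _ _ _ =>
  (LipschitzWith.const c).lipschitzOnWith.absolutelyContinuousOnInterval

theorem locallyAC_upperPart (H : HasKernelBounds b M w g h) {η : ℝ → ℂ}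
    (hη : MemLp η 2 halfLine) : LocallyAC (upperPart h η) :=
  (locallyAC_const _).sub fun a c ha hac =>
    (absolutelyContinuousOnInterval_primitive
      (H.intervalIntegrable_right hη (ha.le.trans hac))).mono (by
        rw [uIcc_of_le hac, uIcc_of_le (ha.le.trans hac)]
        exact Icc_subset_Icc_left ha.le)

theorem _root_.AnyonDelta.ae_hasDerivAt_primitive {f : ℝ → ℂ}
    (hf : ∀ R : ℝ, 0 ≤ R → IntervalIntegrable f volume 0 R) :
    ∀ᵐ r ∂halfLine, HasDerivAt (fun x => ∫ t in (0 : ℝ)..x, f t) (f r) r := by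
  rw [ae_restrict_iff' measurableSet_Ioi]
  have h : ∀ n : ℕ, ∀ᵐ r : ℝ, r ∈ uIcc (0 : ℝ) n →
      HasDerivAt (fun x => ∫ t in (0 : ℝ)..x, f t) (f r) r := by
    intro n
    filter_upwards [(hf n n.cast_nonneg).ae_hasDerivAt_integral] with r hr hr'
    exact hr hr' 0 left_mem_uIcc
  filter_upwards [ae_all_iff.2 h] with r hr h0
  obtain ⟨n, hn⟩ := exists_nat_gt r
  exact hr n (Icc_subset_uIcc ⟨le_of_lt h0, hn.le⟩)

theorem _root_.AnyonDelta.LocallyAC.hasDerivAt_of_ae {u v : ℝ → ℂ} (hu : LocallyAC u)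
    (hd : ∀ᵐ r ∂halfLine, HasDerivAt u (v r) r) (hv : ContinuousOn v (Ioi 0)) {r : ℝ}
    (hr : 0 < r) : HasDerivAt u (v r) r := by
  have h2 : 0 < r / 2 := by positivity
  have h1 : ∀ x, r / 2 ≤ x → u x = u (r / 2) + ∫ t in (r / 2)..x, v t := by
    intro x hx
    rw [((hu (r / 2) x h2 hx).integral_complex_eq_sub (ae_halfLine_of_Icc hd h2 hx)).2]
    ring
  have h3 : HasDerivAt (fun x => u (r / 2) + ∫ t in (r / 2)..x, v t) (v r) r := by
    refine HasDerivAt.const_add _ ?_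
    refine intervalIntegral.integral_hasDerivAt_right ?_ ?_ (hv.continuousAt (Ioi_mem_nhds hr))
    · refine (hv.mono ?_).intervalIntegrable
      rw [uIcc_of_le (by linarith)]
      exact fun x hx => lt_of_lt_of_le h2 hx.1
    · exact hv.stronglyMeasurableAtFilter isOpen_Ioi r hr
  refine h3.congr_of_eventuallyEq ?_
  filter_upwards [Ioi_mem_nhds (show r / 2 < r by linarith)] with x hx
  exact h1 x (le_of_lt hx)

/-- The integral operator solves the inhomogeneous equation. -/
theorem isStrongSol (H : HasKernelBounds b M w g h) {α : ℝ} {z : ℂ} {g' h' : ℝ → ℂ}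
    (F : IsFundamentalPair α z (-1) g g' h h') {η : ℝ → ℂ} (hη : MemLp η 2 halfLine) :
    IsStrongSol α z η (fun r => h r * lowerPart g η r + g r * upperPart h η r)
      (fun r => h' r * lowerPart g η r + g' r * upperPart h η r) := by
  have hP := H.locallyAC_lowerPart hη
  have hQ := H.locallyAC_upperPart hη
  have dP := ae_hasDerivAt_primitive fun R hR => H.intervalIntegrable_left hη hR
  have dQ := ae_hasDerivAt_primitive fun R hR => H.intervalIntegrable_right hη hR
  have ag := LocallyAC.of_hasDerivAt F.deriv₁ F.cont₁'
  have ah := LocallyAC.of_hasDerivAt F.deriv₂ F.cont₂'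
  have cV : ContinuousOn (fun r => radialPot α r - z) (Ioi 0) :=
    (continuousOn_radialPot α).sub continuousOn_const
  have ag' := LocallyAC.of_hasDerivAt F.deriv₁' (cV.mul F.cont₁)
  have ah' := LocallyAC.of_hasDerivAt F.deriv₂' (cV.mul F.cont₂)
  have av := (ah'.mul hP).add (ag'.mul hQ)
  refine ⟨fun r hr => ?_, av, ?_⟩
  · refine LocallyAC.hasDerivAt_of_ae ((ah.mul hP).add (ag.mul hQ)) ?_ av.continuousOn hr
    filter_upwards [dP, dQ, ae_restrict_mem measurableSet_Ioi] with r hp hq hr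
    convert! ((F.deriv₂ r hr).mul hp).add ((F.deriv₁ r hr).mul (hq.const_sub _)) using 1
    simp only [lowerPart, upperPart]
    ring
  · filter_upwards [dP, dQ, ae_restrict_mem measurableSet_Ioi] with r hp hq hr
    convert! ((F.deriv₂' r hr).mul hp).add ((F.deriv₁' r hr).mul (hq.const_sub _)) using 1
    simp only [lowerPart, upperPart]
    linear_combination -η r * F.wronskian_eq r hr

theorem lintegral_integral_le (H : HasKernelBounds b M w g h) {η : ℝ → ℂ}
    (hη : MemLp η 2 halfLine) :
    ∫⁻ r, ‖∫ t, greenKernel g h r t * η t ∂halfLine‖ₑ ^ 2 ∂halfLine ≤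
      ENNReal.ofReal M ^ 2 * ∫⁻ t, ‖η t‖ₑ ^ 2 ∂halfLine := by
  refine le_trans ?_ (H.schur hη.aestronglyMeasurable.aemeasurable)
  refine setLIntegral_mono_ae' measurableSet_Ioi (Eventually.of_forall fun r hr => ?_)
  gcongr
  refine (enorm_integral_le_lintegral_enorm _).trans ?_
  refine setLIntegral_mono_ae' measurableSet_Ioi (Eventually.of_forall fun t ht => ?_)
  rw [enorm_mul]
  gcongr
  rw [← ofReal_norm]
  exact ENNReal.ofReal_le_ofReal (H.norm_greenKernel_le hr ht)

theorem memLp_integral (H : HasKernelBounds b M w g h) {η : ℝ → ℂ} (hη : MemLp η 2 halfLine) :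
    MemLp (fun r => ∫ t, greenKernel g h r t * η t ∂halfLine) 2 halfLine := by
  refine memLp_two_of_lintegral ?_ (lt_of_le_of_lt (H.lintegral_integral_le hη) ?_)
  · refine ContinuousOn.aestronglyMeasurable ?_ measurableSet_Ioi
    exact ((H.cont_right.mul (H.locallyAC_lowerPart hη).continuousOn).add
      (H.cont_left.mul (H.locallyAC_upperPart hη).continuousOn)).congr
        fun r hr => H.integral_greenKernel hη hr
  · rw [lintegral_sq_eq]
    exact ENNReal.mul_lt_top (by simp) (by simp [hη.2])

/-- The bounded operator with kernel `greenKernel g h`. -/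
noncomputable def toCLM (H : HasKernelBounds b M w g h) : L2HalfLine →L[ℂ] L2HalfLine :=
  LinearMap.mkContinuous
    { toFun := fun η => (H.memLp_integral (Lp.memLp η)).toLp _
      map_add' := fun η ζ => by
        rw [← MemLp.toLp_add]
        refine MemLp.toLp_congr _ _ ?_
        filter_upwards [ae_restrict_mem measurableSet_Ioi] with r hr
        rw [Pi.add_apply, ← integral_add (H.integrable_greenKernel_mul hr (Lp.memLp η))
          (H.integrable_greenKernel_mul hr (Lp.memLp ζ))]
        refine integral_congr_ae ?_
        filter_upwards [Lp.coeFn_add η ζ] with t ht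
        rw [ht, Pi.add_apply, mul_add]
      map_smul' := fun c η => by
        rw [RingHom.id_apply, ← MemLp.toLp_const_smul]
        refine MemLp.toLp_congr _ _ (Eventually.of_forall fun r => ?_)
        rw [Pi.smul_apply, ← integral_smul]
        refine integral_congr_ae ?_
        filter_upwards [Lp.coeFn_smul c η] with t ht
        rw [ht, Pi.smul_apply, smul_eq_mul, smul_eq_mul]
        ring }
    (max M 0) (fun η => by
      change ‖(H.memLp_integral (Lp.memLp η)).toLp _‖ ≤ _
      have h1 := H.lintegral_integral_le (Lp.memLp η)
      rw [lintegral_sq_eq, lintegral_sq_eq, ← mul_pow] at h1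
      have h2 := (ENNReal.pow_le_pow_left_iff two_ne_zero).1 h1
      rw [Lp.norm_toLp, Lp.norm_def]
      have h3 := ENNReal.toReal_mono (ENNReal.mul_ne_top ENNReal.ofReal_ne_top
        (Lp.memLp η).2.ne) h2
      rw [ENNReal.toReal_mul, ENNReal.toReal_ofReal'] at h3
      exact h3)

theorem toCLM_apply (H : HasKernelBounds b M w g h) (η : L2HalfLine) :
    H.toCLM η = (H.memLp_integral (Lp.memLp η)).toLp _ := rfl

end HasKernelBounds

/-! ### The resolvent from a fundamental pair -/

theorem IsStrongSol.contDiffOn {α : ℝ} {z : ℂ} {η u v : ℝ → ℂ} (h : IsStrongSol α z η u v) :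
    ContDiffOn ℝ 1 u (Ioi 0) := by
  have h' : ContDiffOn ℝ (0 + 1) u (Ioi 0) := by
    rw [contDiffOn_succ_iff_deriv_of_isOpen isOpen_Ioi]
    refine ⟨fun r hr => (h.hasDerivAt r hr).differentiableAt.differentiableWithinAt, by simp, ?_⟩
    rw [contDiffOn_zero]
    exact h.locallyAC.continuousOn.congr fun r hr => (h.hasDerivAt r hr).deriv
  simpa using h'

theorem IsStrongSol.deltaHamiltonian_apply {α s : ℝ} {z : ℂ} {η u v : ℝ → ℂ}
    (h : IsStrongSol α z η u v) (hu : MemLp u 2 halfLine) (hη : MemLp η 2 halfLine)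
    (hb : Tendsto (fun r => boundaryFun α s r * v r - deriv (boundaryFun α s) r * u r)
      (𝓝[>] 0) (𝓝 0)) :
    ∃ hd : hu.toLp u ∈ (deltaHamiltonian α s).domain,
      deltaHamiltonian α s ⟨hu.toLp u, hd⟩ = z • hu.toLp u + hη.toLp η := by
  have h1 := h.mem_adjoint_domain hu hη
  have h2 : hu.toLp u ∈ boundaryCondition α s := by
    refine ⟨u, hu.coeFn_toLp, h.contDiffOn, hb.congr' ?_⟩
    filter_upwards [self_mem_nhdsWithin] with r hr
    rw [wronskian, (h.hasDerivAt r hr).deriv]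
  refine ⟨⟨h2, h1⟩, ?_⟩
  rw [← h.adjoint_apply hu hη h1]
  exact LinearPMap.domRestrict_apply rfl

theorem locallyIntegrableOn_of_memLp {f : ℝ → ℂ} (hf : MemLp f 2 halfLine) :
    LocallyIntegrableOn f (Ioi 0) volume :=
  locallyIntegrableOn_of_locallyIntegrable_restrict (hf.locallyIntegrable (by norm_num))

/-- An eigenfunction of the adjoint is a classical solution. -/
theorem IsFundamentalPair.eq_of_adjoint {α : ℝ} {z c : ℂ} {g g' h h' : ℝ → ℂ}
    (F : IsFundamentalPair α z c g g' h h') {ζ : L2HalfLine}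
    (hζ : ζ ∈ (minimalHamiltonian α).adjoint.domain)
    (he : (minimalHamiltonian α).adjoint ⟨ζ, hζ⟩ = z • ζ) :
    ∃ c₁ c₂ : ℂ, ζ =ᵐ[halfLine] fun r => c₁ * g r + c₂ * h r := by
  have hm := Lp.memLp ζ
  obtain ⟨c₁, c₂, hc⟩ := F.conj.eq_of_weak (locallyIntegrableOn_of_memLp (memLp_conj hm))
    (by
      intro φ hφ
      have hx : minimalEmbedding α ⟨φ, hφ⟩ ∈ (minimalHamiltonian α).domain := ⟨⟨φ, hφ⟩, rfl⟩
      have h1 := LinearPMap.adjoint_isFormalAdjoint (minimalHamiltonian_dense α) ⟨ζ, hζ⟩ ⟨_, hx⟩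
      rw [he, minimalHamiltonian_apply, inner_smul_left] at h1
      have e1 : inner ℂ ζ (minimalEmbedding α ⟨φ, hφ⟩) =
          ∫ r, (starRingEnd ℂ) (ζ r) * φ r ∂halfLine := by
        rw [← inner_toLp hm hφ.continuous_memLp, Lp.toLp_coeFn]
        rfl
      have e2 : inner ℂ ζ (minimalAction α ⟨φ, hφ⟩) =
          ∫ r, (starRingEnd ℂ) (ζ r) * radialExpr α φ r ∂halfLine := by
        rw [← inner_toLp hm hφ.memLp, Lp.toLp_coeFn]
        rfl
      have h2 : (starRingEnd ℂ) z * inner ℂ ζ (minimalEmbedding α ⟨φ, hφ⟩) =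
        inner ℂ ζ (minimalAction α ⟨φ, hφ⟩) := h1
      rw [e1, e2] at h2
      have i1 : Integrable (fun r => (starRingEnd ℂ) (ζ r) * φ r) halfLine :=
        (memLp_conj hm).integrable_mul hφ.continuous_memLp
      have i3 : Integrable (fun r => (starRingEnd ℂ) (ζ r) * radialExpr α φ r) halfLine :=
        (memLp_conj hm).integrable_mul hφ.memLp
      rw [← sub_eq_zero, ← integral_const_mul, ← integral_sub (i1.const_mul _) i3] at h2
      rw [← neg_eq_zero, ← integral_neg, ← h2]
      congr 1
      funext r
      ring)
  refine ⟨(starRingEnd ℂ) c₁, (starRingEnd ℂ) c₂, ?_⟩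
  filter_upwards [hc] with r hr
  have := congrArg (starRingEnd ℂ) hr
  simpa using this

/-- An eigenfunction of the extension vanishes when the decaying solution violates the boundary
condition. -/
theorem IsFundamentalPair.eq_zero_of_eigen {α s : ℝ} {z c ω : ℂ} {g g' h h' : ℝ → ℂ}
    (F : IsFundamentalPair α z c g g' h h')
    (hL : ∀ c₁ c₂ : ℂ, MemLp (fun r => c₁ * g r + c₂ * h r) 2 halfLine → c₁ = 0)
    (hb : Tendsto (fun r => boundaryFun α s r * h' r - deriv (boundaryFun α s) r * h r)
      (𝓝[>] 0) (𝓝 ω)) (hω : ω ≠ 0) (ζ : (deltaHamiltonian α s).domain)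
    (he : deltaHamiltonian α s ζ = z • (ζ : L2HalfLine)) : (ζ : L2HalfLine) = 0 := by
  obtain ⟨ζ, ⟨⟨u, hu, huC, huW⟩, had⟩⟩ := ζ
  have he' : (minimalHamiltonian α).adjoint ⟨ζ, had⟩ = z • ζ := by
    rw [← he]
    exact (LinearPMap.domRestrict_apply rfl).symm
  obtain ⟨c₁, c₂, hc⟩ := F.eq_of_adjoint had he'
  obtain rfl : c₁ = 0 := hL c₁ c₂ ((memLp_congr_ae hc).1 (Lp.memLp ζ))
  have hEq : EqOn u (fun r => c₂ * h r) (Ioi 0) := by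
    refine Measure.eqOn_open_of_ae_eq (μ := volume) ?_ isOpen_Ioi huC.continuousOn
      (continuousOn_const.mul F.cont₂)
    filter_upwards [hu, hc] with r h1 h2
    rw [← h1, h2, zero_mul, zero_add]
  have hW : Tendsto (wronskian (boundaryFun α s) u) (𝓝[>] 0) (𝓝 (c₂ * ω)) := by
    refine (hb.const_mul c₂).congr' ?_
    filter_upwards [self_mem_nhdsWithin] with r hr
    have hr : r ∈ Ioi (0 : ℝ) := hr
    have hd : HasDerivAt u (c₂ * h' r) r :=
      ((F.deriv₂ r hr).const_mul c₂).congr_of_eventuallyEq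
        (hEq.eventuallyEq_of_mem (isOpen_Ioi.mem_nhds hr))
    rw [wronskian, hd.deriv, hEq hr]
    ring
  have h0 : c₂ = 0 := by
    have := tendsto_nhds_unique hW huW
    exact (mul_eq_zero.1 this).resolve_right hω
  rw [Lp.eq_zero_iff_ae_eq_zero]
  filter_upwards [hc] with r hr
  rw [hr, h0]
  simp

theorem HasKernelBounds.tendsto_boundary {b M : ℝ} {w : ℝ → ℝ} {g h : ℝ → ℂ}
    (H : HasKernelBounds b M w g h) {α s : ℝ} {ω : ℂ} {g' h' : ℝ → ℂ} {η : ℝ → ℂ}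
    (hη : MemLp η 2 halfLine)
    (hg : Tendsto (fun r => boundaryFun α s r * g' r - deriv (boundaryFun α s) r * g r)
      (𝓝[>] 0) (𝓝 0))
    (hb : Tendsto (fun r => boundaryFun α s r * h' r - deriv (boundaryFun α s) r * h r)
      (𝓝[>] 0) (𝓝 ω)) :
    Tendsto (fun r => boundaryFun α s r * (h' r * lowerPart g η r + g' r * upperPart h η r) -
      deriv (boundaryFun α s) r * (h r * lowerPart g η r + g r * upperPart h η r))
      (𝓝[>] 0) (𝓝 0) := by
  have prim : ∀ f : ℝ → ℂ, IntervalIntegrable f volume 0 1 →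
      Tendsto (fun x => ∫ t in (0 : ℝ)..x, f t) (𝓝[>] 0) (𝓝 0) := by
    intro f hf
    have h1 := (absolutelyContinuousOnInterval_primitive hf).continuousOn 0 left_mem_uIcc
    rw [uIcc_of_le zero_le_one, ContinuousWithinAt, intervalIntegral.integral_same,
      nhdsWithin_Icc_eq_nhdsGE zero_lt_one] at h1
    exact h1.mono_left (nhdsWithin_mono _ Ioi_subset_Ici_self)
  have hP := prim _ (H.intervalIntegrable_left hη zero_le_one)
  have hQ := (prim _ (H.intervalIntegrable_right hη zero_le_one)).const_sub
    (∫ t, h t * η t ∂halfLine)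
  have h1 := (hb.mul hP).add (hg.mul hQ)
  rw [mul_zero, zero_mul, add_zero] at h1
  refine h1.congr fun r => ?_
  simp only [lowerPart, upperPart]
  ring

/-- The resolvent of the extension as an integral operator. -/
theorem IsFundamentalPair.isResolventAt {α s b M : ℝ} {w : ℝ → ℝ} {z ω : ℂ}
    {g g' h h' : ℝ → ℂ} (F : IsFundamentalPair α z (-1) g g' h h')
    (H : HasKernelBounds b M w g h)
    (hL : ∀ c₁ c₂ : ℂ, MemLp (fun r => c₁ * g r + c₂ * h r) 2 halfLine → c₁ = 0)
    (hg : Tendsto (fun r => boundaryFun α s r * g' r - deriv (boundaryFun α s) r * g r)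
      (𝓝[>] 0) (𝓝 0))
    (hb : Tendsto (fun r => boundaryFun α s r * h' r - deriv (boundaryFun α s) r * h r)
      (𝓝[>] 0) (𝓝 ω)) (hω : ω ≠ 0) :
    IsResolventAt (deltaHamiltonian α s) z H.toCLM := by
  have key : ∀ η : L2HalfLine, ∃ hd : H.toCLM η ∈ (deltaHamiltonian α s).domain,
      deltaHamiltonian α s ⟨H.toCLM η, hd⟩ - z • H.toCLM η = η := by
    intro η
    have hη := Lp.memLp η
    have hS := H.isStrongSol F hη
    have hae : (fun r => ∫ t, greenKernel g h r t * η t ∂halfLine) =ᵐ[halfLine]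
        fun r => h r * lowerPart g η r + g r * upperPart h η r := by
      filter_upwards [ae_restrict_mem measurableSet_Ioi] with r hr
      exact H.integral_greenKernel hη hr
    have hu := (memLp_congr_ae hae).1 (H.memLp_integral hη)
    have e : H.toCLM η = hu.toLp _ := (H.toCLM_apply η).trans (MemLp.toLp_congr _ _ hae)
    obtain ⟨hd, hd'⟩ := hS.deltaHamiltonian_apply hu hη (H.tendsto_boundary hη hg hb)
    rw [e]
    refine ⟨hd, ?_⟩
    rw [hd', Lp.toLp_coeFn, add_sub_cancel_left]
  refine ⟨key, fun ψ => ?_⟩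
  obtain ⟨hd, hd'⟩ := key (deltaHamiltonian α s ψ - z • (ψ : L2HalfLine))
  set R := H.toCLM (deltaHamiltonian α s ψ - z • (ψ : L2HalfLine)) with hR
  have h0 := F.eq_zero_of_eigen hL hb hω (⟨R, hd⟩ - ψ) (by
    rw [LinearPMap.map_sub, Submodule.coe_sub, smul_sub]
    exact sub_eq_sub_iff_sub_eq_sub.1 hd')
  rw [Submodule.coe_sub] at h0
  exact sub_eq_zero.1 h0

theorem HasKernelBounds.hasIntegralKernel {b M : ℝ} {w : ℝ → ℝ} {g h : ℝ → ℂ}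
    (H : HasKernelBounds b M w g h) {K : ℝ → ℝ → ℂ}
    (hK : ∀ r t, 0 < r → 0 < t → K r t = greenKernel g h r t) :
    HasIntegralKernel H.toCLM K := by
  intro η
  have e : ∀ r, 0 < r → (fun t => greenKernel g h r t * η t) =ᵐ[halfLine]
      fun t => K r t * η t := by
    intro r hr
    filter_upwards [ae_restrict_mem measurableSet_Ioi] with t ht
    rw [hK r t hr ht]
  refine ⟨fun r hr => (H.integrable_greenKernel_mul hr (Lp.memLp η)).congr (e r hr), ?_⟩
  rw [H.toCLM_apply]
  refine (MemLp.coeFn_toLp _).trans ?_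
  filter_upwards [ae_restrict_mem measurableSet_Ioi] with r hr
  exact integral_congr_ae (e r hr)

theorem IsResolventAt.unique {E : Type*} [NormedAddCommGroup E] [NormedSpace ℂ E]
    {T : E →ₗ.[ℂ] E} {z : ℂ} {R R' : E →L[ℂ] E} (h : IsResolventAt T z R)
    (h' : IsResolventAt T z R') : R = R' := by
  ext η
  obtain ⟨hd, hd'⟩ := h.1 η
  have := h'.2 ⟨R η, hd⟩
  rw [hd'] at this
  exact this.symm

/-- A nonzero eigenfunction excludes a resolvent. -/
theorem not_mem_resolventSet_of_strongSol {α s : ℝ} {z : ℂ} {u v : ℝ → ℂ}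
    (h : IsStrongSol α z 0 u v) (hu : MemLp u 2 halfLine)
    (hb : Tendsto (fun r => boundaryFun α s r * v r - deriv (boundaryFun α s) r * u r)
      (𝓝[>] 0) (𝓝 0)) (hne : ∃ r, 0 < r ∧ u r ≠ 0) :
    z ∉ pmapResolventSet (deltaHamiltonian α s) := by
  rintro ⟨R, hR⟩
  obtain ⟨hd, hd'⟩ := h.deltaHamiltonian_apply hu MemLp.zero hb
  have h1 := hR.2 ⟨_, hd⟩
  rw [hd', MemLp.toLp_zero, add_zero, sub_self, map_zero] at h1
  have h2 : u =ᵐ[halfLine] 0 :=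
    hu.coeFn_toLp.symm.trans ((Lp.eq_zero_iff_ae_eq_zero).1 h1.symm)
  obtain ⟨r, hr, hr'⟩ := hne
  exact hr' (Measure.eqOn_open_of_ae_eq h2 isOpen_Ioi h.contDiffOn.continuousOn
    continuousOn_const hr)

/-! ### The power series of the Bessel functions -/

/-- The coefficients of `(z / 2) ^ (-ν) J_ν(z)` as a power series in `(z / 2)²`. -/
noncomputable def besselCoeff (ν : ℂ) (m : ℕ) : ℂ :=
  (-1) ^ m / ((m.factorial : ℂ) * Complex.Gamma (ν + m + 1))

/-- `(z / 2) ^ (-ν) J_ν(z)` as a function of `w = (z / 2)²`. -/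
noncomputable def besselSeries (ν w : ℂ) : ℂ := ∑' m : ℕ, besselCoeff ν m * w ^ m

theorem besselJ_eq (ν z : ℂ) : besselJ ν z = (z / 2) ^ ν * besselSeries ν ((z / 2) ^ 2) := by
  simp only [besselJ, besselSeries, besselCoeff, pow_mul]

theorem norm_inv_Gamma_add_le {ν : ℂ} {δ : ℝ} (hδ : 0 < δ) (hν : δ - 1 ≤ ν.re) (m : ℕ) :
    ‖(Complex.Gamma (ν + m + 1))⁻¹‖ ≤ ‖(Complex.Gamma (ν + 1))⁻¹‖ * (1 / δ) ^ m := by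
  induction m with
  | zero => simp
  | succ m ih =>
    have hre : δ ≤ (ν + m + 1).re := by
      have : (0 : ℝ) ≤ m := m.cast_nonneg
      simp
      linarith
    have hne : ν + m + 1 ≠ 0 := by
      intro h
      rw [h] at hre
      simp at hre
      linarith
    have hle : δ ≤ ‖ν + m + 1‖ := hre.trans (Complex.re_le_norm _)
    rw [Nat.cast_succ, ← add_assoc, Complex.Gamma_add_one _ hne, mul_inv, norm_mul, pow_succ,
      norm_inv]
    calc ‖ν + m + 1‖⁻¹ * ‖(Complex.Gamma (ν + m + 1))⁻¹‖
        ≤ δ⁻¹ * (‖(Complex.Gamma (ν + 1))⁻¹‖ * (1 / δ) ^ m) := by gcongr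
      _ = _ := by ring

theorem norm_besselCoeff_mul_le {ν w : ℂ} {δ ρ A : ℝ} (hδ : 0 < δ) (hν : δ - 1 ≤ ν.re)
    (hA : ‖(Complex.Gamma (ν + 1))⁻¹‖ ≤ A) (hw : ‖w‖ ≤ ρ) (m : ℕ) :
    ‖besselCoeff ν m * w ^ m‖ ≤ A * ((ρ / δ) ^ m / m.factorial) := by
  have h1 := norm_inv_Gamma_add_le hδ hν m
  have hA0 : 0 ≤ A := (norm_nonneg _).trans hA
  have e : besselCoeff ν m = (-1) ^ m * ((m.factorial : ℂ)⁻¹ * (Complex.Gamma (ν + m + 1))⁻¹) := by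
    rw [besselCoeff, div_eq_mul_inv, mul_inv]
  rw [e, norm_mul, norm_mul, norm_pow, norm_neg, norm_one, one_pow, one_mul, norm_mul, norm_pow,
    norm_inv, Complex.norm_natCast]
  calc (m.factorial : ℝ)⁻¹ * ‖(Complex.Gamma (ν + m + 1))⁻¹‖ * ‖w‖ ^ m
      ≤ (m.factorial : ℝ)⁻¹ * (A * (1 / δ) ^ m) * ρ ^ m := by
        gcongr
        exact h1.trans (by gcongr)
    _ = _ := by
        rw [div_pow, div_pow, one_pow]
        ring

theorem summable_besselBound (A x : ℝ) :
    Summable fun m : ℕ => A * (x ^ m / m.factorial) :=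
  (Real.summable_pow_div_factorial x).mul_left A

section Series

variable {ν : ℂ}

theorem besselSeries_zero : besselSeries ν 0 = (Complex.Gamma (ν + 1))⁻¹ := by
  rw [besselSeries, tsum_eq_single 0]
  · simp [besselCoeff]
  · intro m hm
    simp [hm]

theorem summable_besselSeries (hν : -1 < ν.re) (w : ℂ) :
    Summable fun m : ℕ => besselCoeff ν m * w ^ m :=
  Summable.of_norm_bounded (summable_besselBound _ _) fun m =>
    norm_besselCoeff_mul_le (δ := ν.re + 1) (by linarith) (by linarith) le_rfl le_rfl m

theorem besselCoeff_succ_mul (ν : ℂ) (m : ℕ) :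
    besselCoeff ν (m + 1) * (m + 1) = -besselCoeff (ν + 1) m := by
  have h1 : (m.factorial : ℂ) ≠ 0 := by exact_mod_cast m.factorial_ne_zero
  have h2 : (m : ℂ) + 1 ≠ 0 := by exact_mod_cast m.succ_ne_zero
  rw [besselCoeff, besselCoeff, Nat.factorial_succ]
  push_cast
  rw [show ν + (m + 1 : ℂ) + 1 = ν + 1 + m + 1 by ring, pow_succ]
  rcases eq_or_ne (Complex.Gamma (ν + 1 + m + 1)) 0 with h | h
  · simp [h]
  · field_simp

theorem hasSum_deriv_besselSeries (hν : -1 < ν.re) (w : ℂ) :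
    HasDerivAt (besselSeries ν) (-besselSeries (ν + 1) w) w ∧
      HasSum (fun m : ℕ => besselCoeff ν m * (m * w ^ m)) (-w * besselSeries (ν + 1) w) := by
  set ρ := ‖w‖ + 1 with hρ
  have hU : IsOpen (Metric.ball (0 : ℂ) ρ) := Metric.isOpen_ball
  have hwU : w ∈ Metric.ball (0 : ℂ) ρ := by simp [hρ]
  have hb : ∀ (m : ℕ) (x : ℂ), x ∈ Metric.ball (0 : ℂ) ρ → ‖besselCoeff ν m * x ^ m‖ ≤
      ‖(Complex.Gamma (ν + 1))⁻¹‖ * ((ρ / (ν.re + 1)) ^ m / m.factorial) := fun m x hx =>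
    norm_besselCoeff_mul_le (by linarith) (by linarith) le_rfl
      (by simpa using (mem_ball_zero_iff.1 hx).le) m
  have hd : ∀ m : ℕ, DifferentiableOn ℂ (fun x => besselCoeff ν m * x ^ m)
      (Metric.ball (0 : ℂ) ρ) := fun m => by fun_prop
  have hs := Complex.hasSum_deriv_of_summable_norm (summable_besselBound _ _) hd hU hb hwU
  have hdiff := (Complex.differentiableOn_tsum_of_summable_norm (summable_besselBound _ _)
    hd hU hb).differentiableAt (hU.mem_nhds hwU)
  have hd' : ∀ m : ℕ, deriv (fun x => besselCoeff ν m * x ^ m) w =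
      besselCoeff ν m * (m * w ^ (m - 1)) := fun m => by
    rw [deriv_const_mul _ (by fun_prop), deriv_pow_field]
  simp only [hd'] at hs
  have hs1 : HasSum (fun m : ℕ => -(besselCoeff (ν + 1) m * w ^ m))
      (deriv (fun w => ∑' m : ℕ, besselCoeff ν m * w ^ m) w) := by
    have h := (hasSum_nat_add_iff' 1).2 hs
    simp only [Finset.range_one, Finset.sum_singleton, Nat.cast_zero, zero_mul, mul_zero,
      sub_zero, Nat.cast_add, Nat.cast_one, Nat.add_sub_cancel] at h
    have e : (fun m : ℕ => -(besselCoeff (ν + 1) m * w ^ m)) =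
        fun m : ℕ => besselCoeff ν (m + 1) * ((m + 1) * w ^ m) := by
      funext m
      rw [← mul_assoc, besselCoeff_succ_mul]
      ring
    rw [e]
    exact h
  have hd1 : deriv (fun w => ∑' m : ℕ, besselCoeff ν m * w ^ m) w = -besselSeries (ν + 1) w := by
    rw [← hs1.tsum_eq, tsum_neg]
    rfl
  rw [hd1] at hs
  constructor
  · rw [← hd1]
    exact hdiff.hasDerivAt
  · have h := hs.mul_left w
    rw [show -w * besselSeries (ν + 1) w = w * -besselSeries (ν + 1) w by ring]
    have e : (fun m : ℕ => besselCoeff ν m * (m * w ^ m)) =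
        fun m : ℕ => w * (besselCoeff ν m * (m * w ^ (m - 1))) := by
      funext m
      rcases m with _ | m
      · simp
      · rw [Nat.add_sub_cancel, pow_succ]
        ring
    rw [e]
    exact h

theorem hasDerivAt_besselSeries (hν : -1 < ν.re) (w : ℂ) :
    HasDerivAt (besselSeries ν) (-besselSeries (ν + 1) w) w :=
  (hasSum_deriv_besselSeries hν w).1

theorem besselSeries_recurrence (hν : -1 < ν.re) (w : ℂ) :
    w * besselSeries (ν + 2) w = (ν + 1) * besselSeries (ν + 1) w - besselSeries ν w := by
  have hν' : -1 < (ν + 1).re := by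
    simp
    linarith
  have h1 := (hasSum_deriv_besselSeries hν' w).2
  have h2 := ((summable_besselSeries hν' w).hasSum.mul_left (ν + 1)).add h1
  have h3 : (fun m : ℕ => (ν + 1) * (besselCoeff (ν + 1) m * w ^ m) +
      besselCoeff (ν + 1) m * (m * w ^ m)) = fun m : ℕ => besselCoeff ν m * w ^ m := by
    funext m
    have hne : ν + m + 1 ≠ 0 := by
      intro h
      have : (ν + m + 1).re = 0 := by rw [h]; simp
      have h0 : (0 : ℝ) ≤ m := m.cast_nonneg
      simp at this
      linarith
    have : besselCoeff ν m = (ν + m + 1) * besselCoeff (ν + 1) m := by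
      rw [besselCoeff, besselCoeff, show ν + 1 + m + 1 = (ν + m + 1) + 1 by ring,
        Complex.Gamma_add_one _ hne]
      field_simp
    rw [this]
    ring
  rw [h3] at h2
  have h4 := h2.tsum_eq
  change besselSeries ν w = (ν + 1) * besselSeries (ν + 1) w + _ at h4
  rw [show ν + 1 + 1 = ν + 2 by ring] at h4
  rw [h4]
  ring

end Series

/-- `J_ν` depends holomorphically on the order near `0`. -/
theorem differentiableAt_besselJ_order {z : ℂ} (hz : z ≠ 0) :
    DifferentiableAt ℂ (fun ν => besselJ ν z) 0 := by
  simp only [besselJ_eq]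
  refine DifferentiableAt.mul ?_ ?_
  · exact DifferentiableAt.const_cpow differentiableAt_id
      (Or.inl (div_ne_zero hz two_ne_zero))
  · have hU : IsOpen (Metric.ball (0 : ℂ) (1 / 2)) := Metric.isOpen_ball
    have hG : Continuous fun ν : ℂ => (Complex.Gamma (ν + 1))⁻¹ :=
      Complex.differentiable_one_div_Gamma.continuous.comp (by fun_prop)
    obtain ⟨A, hA⟩ := (isCompact_closedBall (0 : ℂ) (1 / 2)).exists_bound_of_continuousOn
      hG.continuousOn
    refine DifferentiableOn.differentiableAt (s := Metric.ball 0 (1 / 2)) ?_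
      (hU.mem_nhds (by simp))
    refine Complex.differentiableOn_tsum_of_summable_norm
      (summable_besselBound A (‖(z / 2) ^ 2‖ / (1 / 2))) (fun m => ?_) hU (fun m ν hν => ?_)
    · refine DifferentiableOn.mul_const ?_ _
      have h1 : Differentiable ℂ fun ν : ℂ => (Complex.Gamma (ν + m + 1))⁻¹ :=
        Complex.differentiable_one_div_Gamma.comp (by fun_prop)
      have h2 : (fun ν => besselCoeff ν m) =
          fun ν : ℂ => ((-1) ^ m * (m.factorial : ℂ)⁻¹) * (Complex.Gamma (ν + m + 1))⁻¹ := by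
        funext ν
        rw [besselCoeff, div_eq_mul_inv, mul_inv, mul_assoc]
      rw [h2]
      exact (h1.const_mul _).differentiableOn
    · refine norm_besselCoeff_mul_le (by norm_num) ?_
        (hA ν (Metric.ball_subset_closedBall hν)) le_rfl m
      have := (abs_le.1 (Complex.abs_re_le_norm ν)).1
      have h' := mem_ball_zero_iff.1 hν
      linarith

/-- At order `0` the limit in the definition of `Y_0` exists. -/
theorem tendsto_besselYQuot_zero {z : ℂ} (hz : z ≠ 0) :
    ∃ L, Tendsto (fun μ => besselYQuot μ z) (𝓝[≠] 0) (𝓝 L) := by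
  have hJ := (differentiableAt_besselJ_order hz).hasDerivAt
  set J' := deriv (fun ν => besselJ ν z) 0
  have hcos : HasDerivAt (fun μ : ℂ => Complex.cos (Real.pi * μ)) 0 0 := by
    have := ((hasDerivAt_id (0 : ℂ)).const_mul (Real.pi : ℂ)).ccos
    simpa using this
  have hneg : HasDerivAt (fun μ => besselJ (-μ) z) (-J') 0 := by
    have h : HasDerivAt (fun ν => besselJ ν z) J' (-(0 : ℂ)) := by rwa [neg_zero]
    simpa [Function.comp_def] using h.comp (0 : ℂ) (hasDerivAt_neg (0 : ℂ))
  have hN : HasDerivAt (fun μ => besselJ μ z * Complex.cos (Real.pi * μ) - besselJ (-μ) z)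
      (2 * J') 0 := by
    convert! (hJ.mul hcos).sub hneg using 1
    simp
    ring
  have hS : HasDerivAt (fun μ : ℂ => Complex.sin (Real.pi * μ)) Real.pi 0 := by
    have := ((hasDerivAt_id (0 : ℂ)).const_mul (Real.pi : ℂ)).csin
    simpa using this
  refine ⟨2 * J' / Real.pi, ?_⟩
  have hq := (hasDerivAt_iff_tendsto_slope.1 hN).div (hasDerivAt_iff_tendsto_slope.1 hS)
    (by exact_mod_cast Real.pi_ne_zero)
  refine hq.congr' ?_
  filter_upwards [self_mem_nhdsWithin] with μ hμ
  have hμ : μ ≠ 0 := hμ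
  simp only [Pi.div_apply, slope_def_field, besselYQuot]
  simp only [mul_zero, Complex.cos_zero, neg_zero, mul_one, sub_self, sub_zero, Complex.sin_zero]
  rw [div_div_div_cancel_right₀ hμ]

/-! ### Euler's integral on the line -/

theorem image_exp_univ : Real.exp '' univ = Ioi 0 := by
  rw [image_univ, Real.range_exp]

theorem integrable_exp_sub_exp {μ c : ℝ} (hμ : 0 < μ) (hc : 0 < c) :
    Integrable fun y : ℝ => Real.exp (μ * y - c * Real.exp y) := by
  have h1 : Integrable fun y : ℝ => Real.exp (μ * y - Real.exp y) := by
    have h := Real.GammaIntegral_convergent hμ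
    rw [← image_exp_univ, integrableOn_image_iff_integrableOn_abs_deriv_smul MeasurableSet.univ
      (fun x _ => (Real.hasDerivAt_exp x).hasDerivWithinAt) Real.exp_injective.injOn,
      integrableOn_univ] at h
    refine h.congr (Eventually.of_forall fun y => ?_)
    simp only [smul_eq_mul]
    rw [abs_of_pos (Real.exp_pos y), ← Real.exp_mul, ← Real.exp_add, ← Real.exp_add]
    congr 1
    ring
  have h2 := (h1.comp_add_right (Real.log c)).const_mul (Real.exp (-(μ * Real.log c)))
  refine h2.congr (Eventually.of_forall fun y => ?_)
  simp only []
  rw [← Real.exp_add, Real.exp_add y, Real.exp_log hc]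
  congr 1
  ring

theorem norm_cexp_sub_exp (μ : ℝ) (q : ℂ) (y : ℝ) :
    ‖Complex.exp (μ * y - q * Real.exp y)‖ = Real.exp (μ * y - q.re * Real.exp y) := by
  rw [Complex.norm_exp]
  congr 1
  simp [-Complex.ofReal_exp]

/-- `∫ e^{μ y - q e^y} dy`. -/
noncomputable def eulerIntegral (μ : ℝ) (q : ℂ) : ℂ :=
  ∫ y : ℝ, Complex.exp (μ * y - q * Real.exp y)

theorem integrable_cexp_sub_exp {μ : ℝ} {q : ℂ} (hμ : 0 < μ) (hq : 0 < q.re) :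
    Integrable fun y : ℝ => Complex.exp (μ * y - q * Real.exp y) := by
  refine (integrable_exp_sub_exp hμ hq).mono' (by fun_prop) (Eventually.of_forall fun y => ?_)
  rw [norm_cexp_sub_exp]

theorem eulerIntegral_one {μ : ℝ} (hμ : 0 < μ) : eulerIntegral μ 1 = Complex.Gamma μ := by
  rw [Complex.Gamma_eq_integral (by simpa using hμ), Complex.GammaIntegral, ← image_exp_univ,
    integral_image_eq_integral_abs_deriv_smul MeasurableSet.univ
      (fun x _ => (Real.hasDerivAt_exp x).hasDerivWithinAt) Real.exp_injective.injOn,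
    setIntegral_univ, eulerIntegral]
  congr 1
  funext y
  rw [abs_of_pos (Real.exp_pos y), Complex.real_smul, Complex.ofReal_exp, Complex.ofReal_exp,
    ← Complex.ofReal_exp, Complex.cpow_def_of_ne_zero (by exact_mod_cast (Real.exp_pos y).ne'),
    ← Complex.ofReal_log (Real.exp_pos y).le, Real.log_exp, ← Complex.exp_add, Complex.ofReal_exp,
    ← Complex.exp_add]
  congr 1
  push_cast
  ring

theorem hasDerivAt_eulerIntegral {μ : ℝ} {q : ℂ} (hμ : 0 < μ) (hq : 0 < q.re) :
    HasDerivAt (eulerIntegral μ) (-eulerIntegral (μ + 1) q) q := by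
  have h := hasDerivAt_integral_of_dominated_loc_of_deriv_le (μ := volume)
    (F := fun (q : ℂ) (y : ℝ) => Complex.exp (μ * y - q * Real.exp y))
    (F' := fun (q : ℂ) (y : ℝ) => -Complex.exp ((μ + 1 : ℝ) * y - q * Real.exp y))
    (x₀ := q) (s := {q' | q.re / 2 < q'.re})
    (bound := fun y => Real.exp ((μ + 1) * y - q.re / 2 * Real.exp y))
    ((isOpen_lt continuous_const Complex.continuous_re).mem_nhds (by
      change q.re / 2 < q.re
      linarith))
    (Eventually.of_forall fun _ => by fun_prop) (integrable_cexp_sub_exp hμ hq) (by fun_prop)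
    (Eventually.of_forall fun y q' hq' => by
      rw [norm_neg, norm_cexp_sub_exp, Real.exp_le_exp]
      have h1 : q.re / 2 < q'.re := hq'
      have := Real.exp_pos y
      nlinarith)
    (integrable_exp_sub_exp (by linarith) (by linarith))
    (Eventually.of_forall fun y q' hq' => by
      have h1 : HasDerivAt (fun q : ℂ => (μ * y : ℂ) - q * Real.exp y)
          (-(1 * (Real.exp y : ℂ))) q' :=
        ((hasDerivAt_id q').mul_const (Real.exp y : ℂ)).const_sub _
      convert! h1.cexp using 1
      have e : ((μ + 1 : ℝ) : ℂ) * y - q' * Real.exp y = (μ * y - q' * Real.exp y) + y := by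
        push_cast
        ring
      rw [e, Complex.exp_add, Complex.ofReal_exp]
      ring)
  have h2 := h.2
  rw [integral_neg] at h2
  exact h2

theorem eulerIntegral_succ {μ : ℝ} {q : ℂ} (hμ : 0 < μ) (hq : 0 < q.re) :
    q * eulerIntegral (μ + 1) q = μ * eulerIntegral μ q := by
  have i1 := integrable_cexp_sub_exp hμ hq
  have i2 := integrable_cexp_sub_exp (μ := μ + 1) (by linarith) hq
  have h := integral_eq_zero_of_hasDerivAt_of_integrable
    (f := fun y : ℝ => Complex.exp (μ * y - q * Real.exp y))
    (f' := fun y : ℝ => μ * Complex.exp (μ * y - q * Real.exp y) -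
      q * Complex.exp ((μ + 1 : ℝ) * y - q * Real.exp y)) (fun y => by
      have h1 : HasDerivAt (fun y : ℝ => (μ * y : ℂ) - q * Real.exp y)
          (μ * 1 - q * Real.exp y) y :=
        ((Complex.ofRealCLM.hasDerivAt (x := y)).const_mul _).sub
          ((Real.hasDerivAt_exp y).ofReal_comp.const_mul q)
      convert! h1.cexp using 1
      have e : ((μ + 1 : ℝ) : ℂ) * y - q * Real.exp y = (μ * y - q * Real.exp y) + y := by
        push_cast
        ring
      rw [e, Complex.exp_add _ (y : ℂ), Complex.ofReal_exp]
      ring) ((i1.const_mul _).sub (i2.const_mul _)) i1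
  rw [integral_sub (i1.const_mul _) (i2.const_mul _), integral_const_mul, integral_const_mul,
    sub_eq_zero] at h
  exact h.symm

theorem eulerIntegral_eq {μ : ℝ} {q : ℂ} (hμ : 0 < μ) (hq : 0 < q.re) :
    eulerIntegral μ q = q ^ (-μ : ℂ) * Complex.Gamma μ := by
  have hopen : IsOpen {q : ℂ | 0 < q.re} := isOpen_lt continuous_const Complex.continuous_re
  have hne : ∀ q : ℂ, 0 < q.re → q ≠ 0 := fun q h h' => by simp [h'] at h
  have hd : ∀ q : ℂ, 0 < q.re →
      HasDerivAt (fun q => q ^ (μ : ℂ) * eulerIntegral μ q) 0 q := by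
    intro q hq
    have h1 := ((hasDerivAt_id q).cpow_const (c := (μ : ℂ)) (Or.inl hq)).mul
      (hasDerivAt_eulerIntegral hμ hq)
    convert! h1 using 1
    have h2 := eulerIntegral_succ hμ hq
    simp only [id]
    rw [Complex.cpow_sub _ _ (hne q hq), Complex.cpow_one, mul_one]
    have h3 := hne q hq
    field_simp
    rw [h2]
    ring
  have h := hopen.is_const_of_fderiv_eq_zero (𝕜 := ℂ)
    (convex_halfSpace_re_gt 0).isPreconnected
    (fun q hq => (hd q hq).differentiableAt.differentiableWithinAt)
    (fun q hq => by
      ext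
      simp [(hd q hq).deriv]) (x := q) (y := 1) hq (by simp)
  simp only [Complex.one_cpow, one_mul, eulerIntegral_one hμ] at h
  rw [← h, ← mul_assoc, ← Complex.cpow_add _ _ (hne q hq), neg_add_cancel, Complex.cpow_zero,
    one_mul]

theorem abs_le_exp_add (y : ℝ) : |y| ≤ 4 * (Real.exp (y / 4) + Real.exp (-y / 4)) := by
  have h1 := Real.add_one_le_exp (y / 4)
  have h2 := Real.add_one_le_exp (-y / 4)
  have h3 := Real.exp_pos (y / 4)
  have h4 := Real.exp_pos (-y / 4)
  rw [abs_le]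
  constructor <;> linarith

theorem integrable_abs_mul_exp_sub_exp {μ c : ℝ} (hμ : 1 / 4 < μ) (hc : 0 < c) :
    Integrable fun y : ℝ => |y| * Real.exp (μ * y - c * Real.exp y) := by
  have h1 := ((integrable_exp_sub_exp (μ := μ + 1 / 4) (by linarith) hc).add
    (integrable_exp_sub_exp (μ := μ - 1 / 4) (by linarith) hc)).const_mul 4
  refine h1.mono' (by fun_prop) (Eventually.of_forall fun y => ?_)
  rw [Real.norm_of_nonneg (by positivity)]
  calc |y| * Real.exp (μ * y - c * Real.exp y)
      ≤ 4 * (Real.exp (y / 4) + Real.exp (-y / 4)) * Real.exp (μ * y - c * Real.exp y) := by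
        gcongr
        exact abs_le_exp_add y
    _ = _ := by
        simp only [Pi.add_apply]
        rw [mul_assoc, add_mul, ← Real.exp_add, ← Real.exp_add]
        congr 3 <;> ring_nf

theorem integral_mul_cexp_sub_exp {q : ℂ} (hq : 0 < q.re) :
    ∫ y : ℝ, y * Complex.exp (y - q * Real.exp y) =
      -(Complex.log q + Real.eulerMascheroniConstant) / q := by
  have hne : q ≠ 0 := fun h' => by simp [h'] at hq
  have h := hasDerivAt_integral_of_dominated_loc_of_deriv_le (μ := volume) (𝕜 := ℝ)
    (F := fun (μ : ℝ) (y : ℝ) => Complex.exp (μ * y - q * Real.exp y))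
    (F' := fun (μ : ℝ) (y : ℝ) => y * Complex.exp (μ * y - q * Real.exp y))
    (x₀ := 1) (s := Ioo (1 / 2) 2)
    (bound := fun y => |y| * Real.exp ((1 / 2) * y - q.re * Real.exp y) +
      |y| * Real.exp (2 * y - q.re * Real.exp y))
    (Ioo_mem_nhds (by norm_num) (by norm_num))
    (Eventually.of_forall fun _ => by fun_prop) (integrable_cexp_sub_exp one_pos hq)
    (by fun_prop)
    (Eventually.of_forall fun y μ hμ => by
      rw [norm_mul, norm_cexp_sub_exp, Complex.norm_real, Real.norm_eq_abs, ← mul_add]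
      gcongr
      rcases le_total 0 y with hy | hy
      · have : Real.exp (μ * y - q.re * Real.exp y) ≤ Real.exp (2 * y - q.re * Real.exp y) := by
          rw [Real.exp_le_exp]
          nlinarith [hμ.2]
        linarith [Real.exp_pos ((1 / 2) * y - q.re * Real.exp y)]
      · have : Real.exp (μ * y - q.re * Real.exp y) ≤
            Real.exp ((1 / 2) * y - q.re * Real.exp y) := by
          rw [Real.exp_le_exp]
          nlinarith [hμ.1]
        linarith [Real.exp_pos (2 * y - q.re * Real.exp y)])
    ((integrable_abs_mul_exp_sub_exp (by norm_num) hq).add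
      (integrable_abs_mul_exp_sub_exp (by norm_num) hq))
    (Eventually.of_forall fun y μ hμ => by
      have h1 : HasDerivAt (fun μ : ℝ => (μ * y : ℂ) - q * Real.exp y) (1 * y) μ :=
        ((Complex.ofRealCLM.hasDerivAt (x := μ)).mul_const (y : ℂ)).sub_const _
      convert! h1.cexp using 1
      ring)
  have h1 := h.2
  have h2 : HasDerivAt (fun μ : ℝ => q ^ (-μ : ℂ) * Complex.Gamma μ)
      (-(Complex.log q + Real.eulerMascheroniConstant) / q) 1 := by
    have e1 : HasDerivAt (fun μ : ℂ => q ^ (-μ) * Complex.Gamma μ)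
        (-(Complex.log q + Real.eulerMascheroniConstant) / q) ((1 : ℝ) : ℂ) := by
      rw [Complex.ofReal_one]
      convert! ((hasDerivAt_neg (1 : ℂ)).const_cpow (Or.inl hne)).mul
        Complex.hasDerivAt_Gamma_one using 1
      rw [Complex.cpow_neg_one, Complex.Gamma_one]
      field_simp
      ring
    exact e1.comp_ofReal
  have h3 : (fun μ : ℝ => ∫ y : ℝ, Complex.exp (μ * y - q * Real.exp y)) =ᶠ[𝓝 1]
      fun μ : ℝ => q ^ (-μ : ℂ) * Complex.Gamma μ := by
    filter_upwards [Ioi_mem_nhds (zero_lt_one)] with μ hμ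
    exact eulerIntegral_eq hμ hq
  have h4 := h1.unique (h2.congr_of_eventuallyEq h3)
  rw [← h4]
  simp

/-! ### The Macdonald function by its integral representation -/

theorem exp_div_two_le_cosh (y : ℝ) : Real.exp y / 2 ≤ Real.cosh y := by
  rw [Real.cosh_eq]
  have := Real.exp_pos (-y)
  linarith

theorem exp_neg_div_two_le_cosh (y : ℝ) : Real.exp (-y) / 2 ≤ Real.cosh y := by
  rw [Real.cosh_eq]
  have := Real.exp_pos y
  linarith

theorem one_add_sq_div_two_le_cosh (y : ℝ) : 1 + y ^ 2 / 2 ≤ Real.cosh y := by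
  have h1 : Real.cosh y = 1 + 2 * Real.sinh (y / 2) ^ 2 := by
    have h2 := Real.cosh_two_mul (y / 2)
    have h3 := Real.cosh_sq (y / 2)
    rw [show 2 * (y / 2) = y by ring] at h2
    linarith
  have h4 : (y / 2) ^ 2 ≤ Real.sinh (y / 2) ^ 2 := by
    rw [sq_le_sq]
    rcases le_total 0 (y / 2) with h | h
    · rw [abs_of_nonneg h, abs_of_nonneg (Real.sinh_nonneg_iff.2 h)]
      exact Real.self_le_sinh_iff.2 h
    · rw [abs_of_nonpos h, abs_of_nonpos (Real.sinh_nonpos_iff.2 h)]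
      exact neg_le_neg (Real.sinh_le_self_iff.2 h)
  rw [h1]
  linarith

theorem integrable_exp_sub_cosh (μ : ℝ) {x : ℝ} (hx : 0 < x) :
    Integrable fun y : ℝ => Real.exp (μ * y - x * Real.cosh y) := by
  have h1 := integrable_exp_sub_exp (μ := |μ| + 1) (by positivity) (half_pos hx)
  have h2 := h1.comp_neg
  refine (h1.add h2).mono' (by fun_prop) (Eventually.of_forall fun y => ?_)
  rw [Real.norm_of_nonneg (Real.exp_nonneg _), Pi.add_apply]
  rcases le_total 0 y with hy | hy
  · have : Real.exp (μ * y - x * Real.cosh y) ≤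
        Real.exp ((|μ| + 1) * y - x / 2 * Real.exp y) := by
      rw [Real.exp_le_exp]
      nlinarith [exp_div_two_le_cosh y, le_abs_self μ]
    linarith [Real.exp_pos ((|μ| + 1) * -y - x / 2 * Real.exp (-y))]
  · have : Real.exp (μ * y - x * Real.cosh y) ≤
        Real.exp ((|μ| + 1) * -y - x / 2 * Real.exp (-y)) := by
      rw [Real.exp_le_exp]
      nlinarith [exp_neg_div_two_le_cosh y, neg_abs_le μ]
    linarith [Real.exp_pos ((|μ| + 1) * y - x / 2 * Real.exp y)]

theorem norm_cexp_sub_cosh (μ : ℝ) (ζ : ℂ) (y : ℝ) :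
    ‖Complex.exp (μ * y - ζ * Real.cosh y)‖ = Real.exp (μ * y - ζ.re * Real.cosh y) := by
  rw [Complex.norm_exp]
  congr 1
  simp [-Complex.ofReal_cosh]

/-- `2 K_μ(ζ) = ∫ e^{μ y - ζ cosh y} dy`. -/
noncomputable def macdonald (μ : ℝ) (ζ : ℂ) : ℂ :=
  ∫ y : ℝ, Complex.exp (μ * y - ζ * Real.cosh y)

theorem integrable_cexp_sub_cosh (μ : ℝ) {ζ : ℂ} (hζ : 0 < ζ.re) :
    Integrable fun y : ℝ => Complex.exp (μ * y - ζ * Real.cosh y) := by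
  refine (integrable_exp_sub_cosh μ hζ).mono' (by fun_prop) (Eventually.of_forall fun y => ?_)
  rw [norm_cexp_sub_cosh]

theorem macdonald_neg (μ : ℝ) (ζ : ℂ) : macdonald (-μ) ζ = macdonald μ ζ := by
  rw [macdonald, macdonald, ← integral_neg_eq_self]
  congr 1
  funext y
  rw [Real.cosh_neg]
  push_cast
  congr 2
  ring

theorem two_mul_cosh_mul_cexp (μ : ℝ) (ζ : ℂ) (y : ℝ) :
    2 * (Real.cosh y : ℂ) * Complex.exp (μ * y - ζ * Real.cosh y) =
      Complex.exp ((μ + 1 : ℝ) * y - ζ * Real.cosh y) +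
        Complex.exp ((μ - 1 : ℝ) * y - ζ * Real.cosh y) := by
  have e1 : ((μ + 1 : ℝ) : ℂ) * y - ζ * Real.cosh y = (μ * y - ζ * Real.cosh y) + y := by
    push_cast
    ring
  have e2 : ((μ - 1 : ℝ) : ℂ) * y - ζ * Real.cosh y = (μ * y - ζ * Real.cosh y) + -y := by
    push_cast
    ring
  rw [e1, e2, Complex.exp_add _ (y : ℂ), Complex.exp_add _ (-y : ℂ), Complex.ofReal_cosh,
    Complex.two_cosh]
  ring

theorem two_mul_sinh_mul_cexp (μ : ℝ) (ζ : ℂ) (y : ℝ) :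
    2 * (Real.sinh y : ℂ) * Complex.exp (μ * y - ζ * Real.cosh y) =
      Complex.exp ((μ + 1 : ℝ) * y - ζ * Real.cosh y) -
        Complex.exp ((μ - 1 : ℝ) * y - ζ * Real.cosh y) := by
  have e1 : ((μ + 1 : ℝ) : ℂ) * y - ζ * Real.cosh y = (μ * y - ζ * Real.cosh y) + y := by
    push_cast
    ring
  have e2 : ((μ - 1 : ℝ) : ℂ) * y - ζ * Real.cosh y = (μ * y - ζ * Real.cosh y) + -y := by
    push_cast
    ring
  rw [e1, e2, Complex.exp_add _ (y : ℂ), Complex.exp_add _ (-y : ℂ), Complex.ofReal_sinh,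
    Complex.two_sinh]
  ring

theorem hasDerivAt_cexp_sub_cosh (μ : ℝ) (ζ : ℂ) (y : ℝ) :
    HasDerivAt (fun y : ℝ => Complex.exp (μ * y - ζ * Real.cosh y))
      ((μ - ζ * Real.sinh y) * Complex.exp (μ * y - ζ * Real.cosh y)) y := by
  have h1 : HasDerivAt (fun y : ℝ => (μ * y : ℂ) - ζ * Real.cosh y)
      (μ * 1 - ζ * Real.sinh y) y :=
    ((Complex.ofRealCLM.hasDerivAt (x := y)).const_mul _).sub
      ((Real.hasDerivAt_cosh y).ofReal_comp.const_mul ζ)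
  convert! h1.cexp using 1
  ring

theorem hasDerivAt_macdonald (μ : ℝ) {ζ : ℂ} (hζ : 0 < ζ.re) :
    HasDerivAt (macdonald μ) (-(macdonald (μ + 1) ζ + macdonald (μ - 1) ζ) / 2) ζ := by
  have h := hasDerivAt_integral_of_dominated_loc_of_deriv_le (μ := volume)
    (F := fun (ζ : ℂ) (y : ℝ) => Complex.exp (μ * y - ζ * Real.cosh y))
    (F' := fun (ζ : ℂ) (y : ℝ) => -(1 / 2 : ℂ) *
      (Complex.exp ((μ + 1 : ℝ) * y - ζ * Real.cosh y) +
        Complex.exp ((μ - 1 : ℝ) * y - ζ * Real.cosh y)))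
    (x₀ := ζ) (s := {ζ' | ζ.re / 2 < ζ'.re})
    (bound := fun y => Real.exp ((μ + 1) * y - ζ.re / 2 * Real.cosh y) +
      Real.exp ((μ - 1) * y - ζ.re / 2 * Real.cosh y))
    ((isOpen_lt continuous_const Complex.continuous_re).mem_nhds (by
      change ζ.re / 2 < ζ.re
      linarith))
    (Eventually.of_forall fun _ => by fun_prop) (integrable_cexp_sub_cosh μ hζ) (by fun_prop)
    (Eventually.of_forall fun y ζ' hζ' => by
      have h1 : ζ.re / 2 < ζ'.re := hζ'
      have h2 := Real.cosh_pos y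
      have h3 : ∀ m : ℝ, Real.exp (m * y - ζ'.re * Real.cosh y) ≤
          Real.exp (m * y - ζ.re / 2 * Real.cosh y) := fun m => by
        rw [Real.exp_le_exp]
        nlinarith
      rw [norm_mul, norm_neg]
      calc _ ≤ 1 * (‖Complex.exp ((μ + 1 : ℝ) * y - ζ' * Real.cosh y)‖ +
            ‖Complex.exp ((μ - 1 : ℝ) * y - ζ' * Real.cosh y)‖) := by
            gcongr
            · norm_num
            · exact norm_add_le _ _
        _ ≤ _ := by
            rw [norm_cexp_sub_cosh, norm_cexp_sub_cosh, one_mul]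
            exact add_le_add (h3 _) (h3 _))
    ((integrable_exp_sub_cosh _ (by linarith)).add (integrable_exp_sub_cosh _ (by linarith)))
    (Eventually.of_forall fun y ζ' hζ' => by
      have h1 : HasDerivAt (fun ζ : ℂ => (μ * y : ℂ) - ζ * Real.cosh y)
          (-(1 * (Real.cosh y : ℂ))) ζ' :=
        ((hasDerivAt_id ζ').mul_const (Real.cosh y : ℂ)).const_sub _
      convert! h1.cexp using 1
      rw [← two_mul_cosh_mul_cexp]
      ring)
  have h2 := h.2
  rw [integral_const_mul, integral_add (integrable_cexp_sub_cosh _ hζ)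
    (integrable_cexp_sub_cosh _ hζ)] at h2
  convert! h2 using 1
  simp only [macdonald]
  ring

theorem macdonald_recurrence (μ : ℝ) {ζ : ℂ} (hζ : 0 < ζ.re) :
    ζ * (macdonald (μ + 1) ζ - macdonald (μ - 1) ζ) = 2 * μ * macdonald μ ζ := by
  have i1 := integrable_cexp_sub_cosh μ hζ
  have i2 := integrable_cexp_sub_cosh (μ + 1) hζ
  have i3 := integrable_cexp_sub_cosh (μ - 1) hζ
  have e : ∀ y : ℝ, (μ - ζ * Real.sinh y) * Complex.exp (μ * y - ζ * Real.cosh y) =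
      μ * Complex.exp (μ * y - ζ * Real.cosh y) - ζ / 2 *
        (Complex.exp ((μ + 1 : ℝ) * y - ζ * Real.cosh y) -
          Complex.exp ((μ - 1 : ℝ) * y - ζ * Real.cosh y)) := fun y => by
    rw [← two_mul_sinh_mul_cexp]
    ring
  have i4 : Integrable fun y : ℝ => ζ / 2 *
      (Complex.exp ((μ + 1 : ℝ) * y - ζ * Real.cosh y) -
        Complex.exp ((μ - 1 : ℝ) * y - ζ * Real.cosh y)) := (i2.sub i3).const_mul _
  have h := integral_eq_zero_of_hasDerivAt_of_integrable (hasDerivAt_cexp_sub_cosh μ ζ) (by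
    simp only [e]
    exact (i1.const_mul _).sub i4) i1
  simp only [e] at h
  rw [integral_sub (i1.const_mul _) i4, integral_const_mul,
    integral_const_mul, integral_sub i2 i3] at h
  change μ * macdonald μ ζ - ζ / 2 * (macdonald (μ + 1) ζ - macdonald (μ - 1) ζ) = 0 at h
  linear_combination -2 * h

theorem norm_macdonald_le (μ : ℝ) (ζ : ℂ) :
    ‖macdonald μ ζ‖ ≤ ∫ y : ℝ, Real.exp (μ * y - ζ.re * Real.cosh y) := by
  refine (norm_integral_le_integral_norm _).trans (le_of_eq ?_)
  simp only [norm_cexp_sub_cosh]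

/-- Decay at infinity. -/
theorem norm_macdonald_le_exp (μ : ℝ) {ζ : ℂ} (hζ : 0 < ζ.re) :
    ‖macdonald μ ζ‖ ≤
      Real.exp (-ζ.re) * (Real.exp (μ ^ 2 / (2 * ζ.re)) * √(Real.pi / (ζ.re / 2))) := by
  set x := ζ.re
  refine (norm_macdonald_le μ ζ).trans ?_
  have e : ∀ y : ℝ, Real.exp (-x) * (Real.exp (μ ^ 2 / (2 * x)) *
      Real.exp (-(x / 2) * (y - μ / x) ^ 2)) = Real.exp (μ * y - x * (1 + y ^ 2 / 2)) := fun y => by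
    rw [← Real.exp_add, ← Real.exp_add]
    congr 1
    field_simp
    ring
  have hint : Integrable fun y : ℝ => Real.exp (-(x / 2) * (y - μ / x) ^ 2) :=
    (integrable_exp_neg_mul_sq (half_pos hζ)).comp_sub_right (μ / x)
  calc ∫ y : ℝ, Real.exp (μ * y - x * Real.cosh y)
      ≤ ∫ y : ℝ, Real.exp (-x) * (Real.exp (μ ^ 2 / (2 * x)) *
          Real.exp (-(x / 2) * (y - μ / x) ^ 2)) := by
        refine integral_mono (integrable_exp_sub_cosh μ hζ) ((hint.const_mul _).const_mul _) ?_
        intro y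
        simp only [e]
        rw [Real.exp_le_exp]
        nlinarith [one_add_sq_div_two_le_cosh y]
    _ = _ := by
        rw [integral_const_mul, integral_const_mul,
          integral_sub_right_eq_self (fun y : ℝ => Real.exp (-(x / 2) * y ^ 2)),
          integral_gaussian]

/-- Translation by `log r`. -/
theorem cosh_sub_log {r : ℝ} (hr : 0 < r) (y : ℝ) :
    r * Real.cosh (y - Real.log r) = (Real.exp y + r ^ 2 * Real.exp (-y)) / 2 := by
  rw [Real.cosh_eq, neg_sub, Real.exp_sub, Real.exp_sub, Real.exp_log hr, Real.exp_neg]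
  have := (Real.exp_pos y).ne'
  field_simp

theorem cpow_ofReal_mul_exp_neg_log {r : ℝ} (hr : 0 < r) (μ : ℝ) :
    ((r ^ μ : ℝ) : ℂ) * Complex.exp (-(μ * Real.log r)) = 1 := by
  rw [Real.rpow_def_of_pos hr]
  push_cast
  rw [← Complex.exp_add, mul_comm (μ : ℂ), add_neg_cancel, Complex.exp_zero]

theorem cexp_translate {r : ℝ} (hr : 0 < r) (p : ℂ) (μ y : ℝ) :
    Complex.exp (μ * (y - Real.log r : ℝ) - p * r * Real.cosh (y - Real.log r)) =
      Complex.exp (-(μ * Real.log r)) *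
        Complex.exp (μ * y - p / 2 * (Real.exp y + r ^ 2 * Real.exp (-y) : ℝ)) := by
  have h := cosh_sub_log hr y
  have h' : (r : ℂ) * (Real.cosh (y - Real.log r) : ℂ) =
      ((Real.exp y + r ^ 2 * Real.exp (-y) : ℝ) : ℂ) / 2 := by
    rw [← Complex.ofReal_mul, h]
    push_cast
    ring
  rw [← Complex.exp_add, mul_assoc, h']
  congr 1
  push_cast
  ring

theorem rpow_mul_macdonald {r : ℝ} (hr : 0 < r) (p : ℂ) (μ : ℝ) :
    ((r ^ μ : ℝ) : ℂ) * macdonald μ (p * r) =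
      ∫ y : ℝ, Complex.exp (μ * y - p / 2 * (Real.exp y + r ^ 2 * Real.exp (-y) : ℝ)) := by
  rw [macdonald, ← integral_sub_right_eq_self _ (Real.log r)]
  simp only [cexp_translate hr]
  rw [integral_const_mul, ← mul_assoc, cpow_ofReal_mul_exp_neg_log hr, one_mul]

theorem norm_cexp_translated (p : ℂ) (μ ρ y : ℝ) :
    ‖Complex.exp (μ * y - p / 2 * (Real.exp y + ρ * Real.exp (-y) : ℝ))‖ =
      Real.exp (μ * y - p.re / 2 * (Real.exp y + ρ * Real.exp (-y))) := by
  rw [Complex.norm_exp]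
  congr 1
  rw [Complex.sub_re, ← Complex.ofReal_mul, Complex.ofReal_re, Complex.re_mul_ofReal]
  simp

theorem norm_cexp_translated_le {p : ℂ} (hp : 0 < p.re) (μ y : ℝ) {ρ : ℝ} (hρ : 0 ≤ ρ) :
    ‖Complex.exp (μ * y - p / 2 * (Real.exp y + ρ * Real.exp (-y) : ℝ))‖ ≤
      Real.exp (μ * y - p.re / 2 * Real.exp y) := by
  rw [norm_cexp_translated, Real.exp_le_exp]
  have : 0 ≤ p.re / 2 * (ρ * Real.exp (-y)) := by positivity
  linarith

theorem tendsto_cexp_translated (p : ℂ) (μ y : ℝ) :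
    Tendsto (fun r : ℝ => Complex.exp (μ * y - p / 2 *
      (Real.exp y + r ^ 2 * Real.exp (-y) : ℝ))) (𝓝[>] 0)
      (𝓝 (Complex.exp (μ * y - p / 2 * Real.exp y))) := by
  have h : Continuous fun r : ℝ => Complex.exp (μ * y - p / 2 *
      (Real.exp y + r ^ 2 * Real.exp (-y) : ℝ)) := by fun_prop
  have := (h.tendsto 0).mono_left (nhdsWithin_le_nhds (s := Ioi 0))
  simpa using this

/-- Behaviour at the origin. -/
theorem tendsto_rpow_mul_macdonald {p : ℂ} (hp : 0 < p.re) {μ : ℝ} (hμ : 0 < μ) :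
    Tendsto (fun r : ℝ => ((r ^ μ : ℝ) : ℂ) * macdonald μ (p * r)) (𝓝[>] 0)
      (𝓝 ((p / 2) ^ (-μ : ℂ) * Complex.Gamma μ)) := by
  have hp2 : 0 < (p / 2).re := by simpa using hp
  rw [← eulerIntegral_eq hμ hp2, eulerIntegral]
  have h := tendsto_integral_filter_of_dominated_convergence (μ := volume) (l := 𝓝[>] (0 : ℝ))
    (F := fun r y => Complex.exp (μ * y - p / 2 * (Real.exp y + r ^ 2 * Real.exp (-y) : ℝ)))
    (fun y => Real.exp (μ * y - p.re / 2 * Real.exp y))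
    (Eventually.of_forall fun r => by fun_prop)
    (Eventually.of_forall fun r => Eventually.of_forall fun y =>
      norm_cexp_translated_le hp μ y (sq_nonneg r))
    (integrable_exp_sub_exp hμ (half_pos hp))
    (Eventually.of_forall fun y => tendsto_cexp_translated p μ y)
  refine h.congr' ?_
  filter_upwards [self_mem_nhdsWithin] with r hr
  exact (rpow_mul_macdonald hr p μ).symm

theorem norm_rpow_mul_macdonald_le {p : ℂ} (hp : 0 < p.re) {μ : ℝ} (hμ : 0 < μ) {r : ℝ}
    (hr : 0 < r) : r ^ μ * ∫ y : ℝ, Real.exp (μ * y - p.re * r * Real.cosh y) ≤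
      ∫ y : ℝ, Real.exp (μ * y - p.re / 2 * Real.exp y) := by
  have e : ∀ y : ℝ, r ^ μ * Real.exp (μ * (y - Real.log r) -
      p.re * r * Real.cosh (y - Real.log r)) =
      Real.exp (μ * y - p.re / 2 * (Real.exp y + r ^ 2 * Real.exp (-y))) := fun y => by
    rw [mul_assoc, cosh_sub_log hr, Real.rpow_def_of_pos hr, ← Real.exp_add]
    congr 1
    ring
  rw [← integral_sub_right_eq_self _ (Real.log r), ← integral_const_mul]
  simp only [e]
  refine integral_mono_of_nonneg (Eventually.of_forall fun y => Real.exp_nonneg _)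
    (integrable_exp_sub_exp hμ (half_pos hp)) (Eventually.of_forall fun y => ?_)
  simp only []
  rw [Real.exp_le_exp]
  have : 0 ≤ p.re / 2 * (r ^ 2 * Real.exp (-y)) := by positivity
  linarith

theorem norm_macdonald_le_of_abs_le {ζ : ℂ} (hζ : 0 < ζ.re) {α m : ℝ} (h : |α| ≤ m) :
    ‖macdonald α ζ‖ ≤ 2 * ∫ y : ℝ, Real.exp (m * y - ζ.re * Real.cosh y) := by
  have i1 := integrable_exp_sub_cosh m hζ
  have i2 := integrable_exp_sub_cosh (-m) hζ
  have e : ∫ y : ℝ, Real.exp (-m * y - ζ.re * Real.cosh y) =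
      ∫ y : ℝ, Real.exp (m * y - ζ.re * Real.cosh y) := by
    rw [← integral_neg_eq_self]
    congr 1
    funext y
    rw [Real.cosh_neg]
    congr 2
    ring
  rw [two_mul]
  nth_rewrite 1 [← e]
  rw [← integral_add i2 i1]
  refine (norm_macdonald_le α ζ).trans (integral_mono (integrable_exp_sub_cosh α hζ)
    (i2.add i1) fun y => ?_)
  obtain ⟨h1, h2⟩ := abs_le.1 h
  simp only []
  rcases le_total 0 y with hy | hy
  · have : Real.exp (α * y - ζ.re * Real.cosh y) ≤ Real.exp (m * y - ζ.re * Real.cosh y) := by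
      rw [Real.exp_le_exp]
      nlinarith
    linarith [Real.exp_pos (-m * y - ζ.re * Real.cosh y)]
  · have : Real.exp (α * y - ζ.re * Real.cosh y) ≤ Real.exp (-m * y - ζ.re * Real.cosh y) := by
      rw [Real.exp_le_exp]
      nlinarith
    linarith [Real.exp_pos (m * y - ζ.re * Real.cosh y)]

/-- A bound near the origin, with an exponent `m ≥ |α|`. -/
theorem exists_rpow_mul_norm_macdonald_le {p : ℂ} (hp : 0 < p.re) {α m : ℝ} (hm : 0 < m)
    (h : |α| ≤ m) : ∃ C, ∀ r : ℝ, 0 < r → r ^ m * ‖macdonald α (p * r)‖ ≤ C := by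
  refine ⟨2 * ∫ y : ℝ, Real.exp (m * y - p.re / 2 * Real.exp y), fun r hr => ?_⟩
  have hre : (p * r).re = p.re * r := by simp
  have h1 := norm_macdonald_le_of_abs_le (ζ := p * r) (by rw [hre]; positivity) h
  rw [hre] at h1
  have h2 := norm_rpow_mul_macdonald_le hp hm hr
  calc r ^ m * ‖macdonald α (p * r)‖
      ≤ r ^ m * (2 * ∫ y : ℝ, Real.exp (m * y - p.re * r * Real.cosh y)) := by gcongr
    _ = 2 * (r ^ m * ∫ y : ℝ, Real.exp (m * y - p.re * r * Real.cosh y)) := by ring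
    _ ≤ _ := by gcongr

/-- Continuity in the order. -/
theorem tendsto_macdonald_order_zero {ζ : ℂ} (hζ : 0 < ζ.re) :
    Tendsto (fun α => macdonald α ζ) (𝓝[>] 0) (𝓝 (macdonald 0 ζ)) := by
  refine tendsto_integral_filter_of_dominated_convergence
    (fun y => Real.exp (1 * y - ζ.re * Real.cosh y) + Real.exp (-1 * y - ζ.re * Real.cosh y))
    (Eventually.of_forall fun α => by fun_prop) ?_
    ((integrable_exp_sub_cosh 1 hζ).add (integrable_exp_sub_cosh (-1) hζ))
    (Eventually.of_forall fun y => ?_)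
  · filter_upwards [Ioo_mem_nhdsGT (zero_lt_one (α := ℝ))] with α hα
    refine Eventually.of_forall fun y => ?_
    rw [norm_cexp_sub_cosh]
    rcases le_total 0 y with hy | hy
    · have : Real.exp (α * y - ζ.re * Real.cosh y) ≤ Real.exp (1 * y - ζ.re * Real.cosh y) := by
        rw [Real.exp_le_exp]
        nlinarith [hα.2]
      linarith [Real.exp_pos (-1 * y - ζ.re * Real.cosh y)]
    · have : Real.exp (α * y - ζ.re * Real.cosh y) ≤ Real.exp (-1 * y - ζ.re * Real.cosh y) := by
        rw [Real.exp_le_exp]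
        nlinarith [hα.1]
      linarith [Real.exp_pos (1 * y - ζ.re * Real.cosh y)]
  · have h : Continuous fun α : ℝ => Complex.exp (α * y - ζ * Real.cosh y) := by fun_prop
    exact (h.tendsto 0).mono_left nhdsWithin_le_nhds

theorem macdonald_zero_eq {ζ : ℂ} (hζ : 0 < ζ.re) :
    macdonald 0 ζ = ζ * ∫ y : ℝ, y * Complex.exp ((1 : ℝ) * y - ζ * Real.cosh y) := by
  have iy : ∀ μ : ℝ, Integrable fun y : ℝ => (y : ℂ) * Complex.exp (μ * y - ζ * Real.cosh y) := by
    intro μ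
    refine (((integrable_exp_sub_cosh (μ + 1 / 4) hζ).add
      (integrable_exp_sub_cosh (μ - 1 / 4) hζ)).const_mul 4).mono' (by fun_prop)
      (Eventually.of_forall fun y => ?_)
    rw [norm_mul, norm_cexp_sub_cosh, Complex.norm_real, Real.norm_eq_abs]
    calc |y| * Real.exp (μ * y - ζ.re * Real.cosh y)
        ≤ 4 * (Real.exp (y / 4) + Real.exp (-y / 4)) *
            Real.exp (μ * y - ζ.re * Real.cosh y) := by
          gcongr
          exact abs_le_exp_add y
      _ = _ := by
          simp only [Pi.add_apply]
          rw [mul_assoc, add_mul, ← Real.exp_add, ← Real.exp_add]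
          congr 3 <;> ring_nf
  have i0 := integrable_cexp_sub_cosh 0 hζ
  have i4 : Integrable fun y : ℝ => ζ / 2 *
      (y * Complex.exp ((1 : ℝ) * y - ζ * Real.cosh y) -
        y * Complex.exp ((-1 : ℝ) * y - ζ * Real.cosh y)) := ((iy 1).sub (iy (-1))).const_mul _
  have h := integral_eq_zero_of_hasDerivAt_of_integrable
    (f := fun y : ℝ => (y : ℂ) * Complex.exp ((0 : ℝ) * y - ζ * Real.cosh y))
    (f' := fun y : ℝ => Complex.exp ((0 : ℝ) * y - ζ * Real.cosh y) - ζ / 2 *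
      (y * Complex.exp ((1 : ℝ) * y - ζ * Real.cosh y) -
        y * Complex.exp ((-1 : ℝ) * y - ζ * Real.cosh y))) (fun y => by
      have h1 := (Complex.ofRealCLM.hasDerivAt (x := y)).mul (hasDerivAt_cexp_sub_cosh 0 ζ y)
      convert! h1 using 1
      have h2 := two_mul_sinh_mul_cexp 0 ζ y
      simp only [zero_add, zero_sub] at h2
      simp only [Complex.ofRealCLM_apply]
      rw [Complex.ofReal_zero] at h2 ⊢
      rw [Complex.ofReal_one] at h2 ⊢
      linear_combination (-(ζ / 2) * y) * (-h2))
    (i0.sub i4) (iy 0)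
  rw [integral_sub i0 i4, integral_const_mul,
    integral_sub (iy 1) (iy (-1))] at h
  have e : ∫ y : ℝ, (y : ℂ) * Complex.exp ((-1 : ℝ) * y - ζ * Real.cosh y) =
      -∫ y : ℝ, (y : ℂ) * Complex.exp ((1 : ℝ) * y - ζ * Real.cosh y) := by
    rw [← integral_neg_eq_self, ← integral_neg]
    congr 1
    funext y
    rw [Real.cosh_neg]
    push_cast
    rw [neg_mul]
    congr 4
    ring
  rw [e] at h
  change macdonald 0 ζ - _ = 0 at h
  linear_combination h

/-- The constant term of `K_0` at the origin. -/
theorem tendsto_macdonald_zero {p : ℂ} (hp : 0 < p.re) :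
    Tendsto (fun r : ℝ => macdonald 0 (p * r) + p * r * macdonald 1 (p * r) * Real.log r)
      (𝓝[>] 0) (𝓝 (-2 * (Complex.log (p / 2) + Real.eulerMascheroniConstant))) := by
  have hp2 : 0 < (p / 2).re := by simpa using hp
  have hne : p ≠ 0 := fun h' => by simp [h'] at hp
  have h := tendsto_integral_filter_of_dominated_convergence (μ := volume) (l := 𝓝[>] (0 : ℝ))
    (F := fun (r y : ℝ) => (y : ℂ) * Complex.exp ((1 : ℝ) * y - p / 2 *
      (Real.exp y + r ^ 2 * Real.exp (-y) : ℝ)))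
    (fun y => |y| * Real.exp (1 * y - p.re / 2 * Real.exp y))
    (Eventually.of_forall fun r => by fun_prop)
    (Eventually.of_forall fun r => Eventually.of_forall fun y => by
      rw [norm_mul, Complex.norm_real, Real.norm_eq_abs]
      gcongr
      exact norm_cexp_translated_le hp 1 y (sq_nonneg r))
    (integrable_abs_mul_exp_sub_exp (by norm_num) (half_pos hp))
    (Eventually.of_forall fun y => (tendsto_cexp_translated p 1 y).const_mul _)
  have e : ∫ y : ℝ, (y : ℂ) * Complex.exp ((1 : ℝ) * y - p / 2 * Real.exp y) =
      -(Complex.log (p / 2) + Real.eulerMascheroniConstant) / (p / 2) := by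
    rw [← integral_mul_cexp_sub_exp hp2]
    simp
  rw [e] at h
  have h2 := h.const_mul p
  have e2 : p * (-(Complex.log (p / 2) + Real.eulerMascheroniConstant) / (p / 2)) =
      -2 * (Complex.log (p / 2) + Real.eulerMascheroniConstant) := by
    field_simp
  rw [e2] at h2
  refine h2.congr' ?_
  filter_upwards [self_mem_nhdsWithin] with r hr
  have hr : 0 < r := hr
  have hre : 0 < (p * r).re := by
    simpa using mul_pos hp hr
  have hrc : (r : ℂ) ≠ 0 := by exact_mod_cast hr.ne'
  have h1 := rpow_mul_macdonald hr p 1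
  rw [Real.rpow_one] at h1
  have e5 := macdonald_zero_eq hre
  rw [← integral_sub_right_eq_self _ (Real.log r)] at e5
  simp only [cexp_translate hr] at e5
  have hexp : Complex.exp (-((1 : ℝ) * Real.log r)) = (r : ℂ)⁻¹ := by
    have := cpow_ofReal_mul_exp_neg_log hr 1
    rw [Real.rpow_one] at this
    exact eq_inv_of_mul_eq_one_right this
  have i1 : Integrable fun y : ℝ => Complex.exp ((1 : ℝ) * y - p / 2 *
      (Real.exp y + r ^ 2 * Real.exp (-y) : ℝ)) :=
    (integrable_exp_sub_exp one_pos (half_pos hp)).mono' (by fun_prop)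
      (Eventually.of_forall fun y => norm_cexp_translated_le hp 1 y (sq_nonneg r))
  have i2 : Integrable fun y : ℝ => (y : ℂ) * Complex.exp ((1 : ℝ) * y - p / 2 *
      (Real.exp y + r ^ 2 * Real.exp (-y) : ℝ)) :=
    (integrable_abs_mul_exp_sub_exp (μ := 1) (by norm_num) (half_pos hp)).mono' (by fun_prop)
      (Eventually.of_forall fun y => by
        rw [norm_mul, Complex.norm_real, Real.norm_eq_abs]
        gcongr
        exact norm_cexp_translated_le hp 1 y (sq_nonneg r))
  have e3 : ∀ y : ℝ, ((y - Real.log r : ℝ) : ℂ) * (Complex.exp (-((1 : ℝ) * Real.log r)) *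
      Complex.exp ((1 : ℝ) * y - p / 2 * (Real.exp y + r ^ 2 * Real.exp (-y) : ℝ))) =
      (r : ℂ)⁻¹ * (y * Complex.exp ((1 : ℝ) * y - p / 2 *
        (Real.exp y + r ^ 2 * Real.exp (-y) : ℝ)) - Real.log r * Complex.exp ((1 : ℝ) * y -
          p / 2 * (Real.exp y + r ^ 2 * Real.exp (-y) : ℝ))) := fun y => by
    rw [hexp]
    push_cast
    ring
  simp only [e3] at e5
  rw [integral_const_mul, integral_sub i2 (i1.const_mul _), integral_const_mul, ← h1] at e5
  generalize (∫ y : ℝ, (y : ℂ) * Complex.exp ((1 : ℝ) * y - p / 2 *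
      (Real.exp y + r ^ 2 * Real.exp (-y) : ℝ))) = X at e5 ⊢
  rw [e5]
  field_simp
  ring

/-! ### Classical solutions of the radial equation -/

/-- `f`, with derivative `f'`, solves `-f'' + V f = z f` on `(0, ∞)`. -/
structure IsRadialSol (α : ℝ) (z : ℂ) (f f' : ℝ → ℂ) : Prop where
  hasDerivAt : ∀ r, 0 < r → HasDerivAt f (f' r) r
  hasDerivAt' : ∀ r, 0 < r → HasDerivAt f' ((radialPot α r - z) * f r) r

namespace IsRadialSol

variable {α : ℝ} {z : ℂ} {f f' g g' : ℝ → ℂ}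

theorem const_mul (c : ℂ) (h : IsRadialSol α z f f') :
    IsRadialSol α z (fun r => c * f r) (fun r => c * f' r) where
  hasDerivAt r hr := (h.hasDerivAt r hr).const_mul c
  hasDerivAt' r hr := by
    convert! (h.hasDerivAt' r hr).const_mul c using 1
    ring

theorem sub (hf : IsRadialSol α z f f') (hg : IsRadialSol α z g g') :
    IsRadialSol α z (fun r => f r - g r) (fun r => f' r - g' r) where
  hasDerivAt r hr := (hf.hasDerivAt r hr).sub (hg.hasDerivAt r hr)
  hasDerivAt' r hr := by
    convert! (hf.hasDerivAt' r hr).sub (hg.hasDerivAt' r hr) using 1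
    ring

/-- The Wronskian of two solutions is constant, hence equal to its limit at `0`. -/
theorem wronskian_eq_of_tendsto (hf : IsRadialSol α z f f') (hg : IsRadialSol α z g g') {c : ℂ}
    (h : Tendsto (fun r => f r * g' r - f' r * g r) (𝓝[>] 0) (𝓝 c)) {r : ℝ} (hr : 0 < r) :
    f r * g' r - f' r * g r = c := by
  have hd : ∀ x ∈ Ioi (0 : ℝ), HasDerivAt (fun r => f r * g' r - f' r * g r) 0 x := fun x hx => by
    convert! ((hf.hasDerivAt x hx).mul (hg.hasDerivAt' x hx)).sub ((hf.hasDerivAt' x hx).mul (hg.hasDerivAt x hx))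
      using 1
    ring
  have hc : ∀ x ∈ Ioi (0 : ℝ), f x * g' x - f' x * g x = f r * g' r - f' r * g r := fun x hx =>
    isOpen_Ioi.is_const_of_deriv_eq_zero isPreconnected_Ioi
      (fun y hy => (hd y hy).differentiableAt.differentiableWithinAt)
      (fun y hy => (hd y hy).deriv) hx hr
  refine tendsto_nhds_unique (tendsto_const_nhds.congr' ?_) h
  filter_upwards [self_mem_nhdsWithin] with x hx
  exact (hc x hx).symm

end IsRadialSol

theorem hasDerivAt_rpow_mul {A : ℝ → ℂ} {A' : ℂ} (c : ℝ) {r : ℝ} (hr : 0 < r)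
    (hA : HasDerivAt A A' r) :
    HasDerivAt (fun r => ((r ^ c : ℝ) : ℂ) * A r)
      (((r ^ (c - 1) : ℝ) : ℂ) * (c * A r + r * A')) r := by
  have h := ((Real.hasDerivAt_rpow_const (p := c) (Or.inl hr.ne')).ofReal_comp).mul hA
  convert! h using 1
  have : (r : ℝ) ^ c = r ^ (c - 1) * r := by
    rw [← Real.rpow_add_one hr.ne', sub_add_cancel]
  rw [this]
  push_cast
  ring

/-! ### The Frobenius solutions -/

/-- The solution `r^{1/2 + ν} (1 / Γ(ν + 1) + …)` of the radial equation with `z = 4 q`. -/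
noncomputable def frobenius (ν : ℝ) (q : ℂ) (r : ℝ) : ℂ :=
  ((r ^ (1 / 2 + ν) : ℝ) : ℂ) * besselSeries ν (q * r ^ 2)

/-- The derivative of `frobenius ν q`. -/
noncomputable def frobeniusDeriv (ν : ℝ) (q : ℂ) (r : ℝ) : ℂ :=
  ((r ^ (ν - 1 / 2) : ℝ) : ℂ) * ((1 / 2 + ν) * besselSeries ν (q * r ^ 2) -
    2 * q * r ^ 2 * besselSeries (ν + 1) (q * r ^ 2))

theorem hasDerivAt_besselSeries_comp {ν : ℂ} (hν : -1 < ν.re) (q : ℂ) (r : ℝ) :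
    HasDerivAt (fun r : ℝ => besselSeries ν (q * r ^ 2))
      (-(2 * q * r * besselSeries (ν + 1) (q * r ^ 2))) r := by
  have h1 : HasDerivAt (fun r : ℝ => q * (r : ℂ) ^ 2) (q * (2 * r)) r := by
    have := ((hasDerivAt_id r).ofReal_comp.pow 2).const_mul q
    convert! this using 1
    simp
  convert! (hasDerivAt_besselSeries hν (q * r ^ 2)).comp_of_eq r h1 rfl using 1
  ring

theorem isRadialSol_frobenius {ν α : ℝ} (hν : -1 < ν) (h : ν ^ 2 = α ^ 2) (q : ℂ) :
    IsRadialSol α (4 * q) (frobenius ν q) (frobeniusDeriv ν q) where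
  hasDerivAt r hr := by
    have hν' : -1 < (ν : ℂ).re := by simpa using hν
    convert! hasDerivAt_rpow_mul (1 / 2 + ν) hr (hasDerivAt_besselSeries_comp hν' q r) using 1
    rw [frobeniusDeriv, show 1 / 2 + ν - 1 = ν - 1 / 2 by ring]
    push_cast
    ring
  hasDerivAt' r hr := by
    have hν' : -1 < (ν : ℂ).re := by simpa using hν
    have hν'' : -1 < ((ν : ℂ) + 1).re := by
      simp
      linarith
    have hrc : (r : ℂ) ≠ 0 := by exact_mod_cast hr.ne'
    have h2 : HasDerivAt (fun r : ℝ => 2 * q * (r : ℂ) ^ 2) (2 * q * (2 * r)) r := by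
      have := ((hasDerivAt_id r).ofReal_comp.pow 2).const_mul (2 * q)
      convert! this using 1
      simp
    have h3 := ((hasDerivAt_besselSeries_comp hν' q r).const_mul (1 / 2 + (ν : ℂ))).sub
      (h2.mul (hasDerivAt_besselSeries_comp hν'' q r))
    convert! hasDerivAt_rpow_mul (ν - 1 / 2) hr h3 using 1
    have h4 := besselSeries_recurrence hν' (q * r ^ 2)
    simp only [Pi.sub_apply, Pi.mul_apply]
    rw [show (ν : ℂ) + 1 + 1 = ν + 2 by ring]
    have h5 : r ^ (1 / 2 + ν) = r ^ (ν - 1 / 2 - 1) * r ^ 2 := by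
      rw [← Real.rpow_natCast r 2, ← Real.rpow_add hr]
      congr 1
      push_cast
      ring
    have h6 : (α : ℂ) ^ 2 = (ν : ℂ) ^ 2 := by exact_mod_cast h.symm
    rw [frobenius, radialPot, h5]
    push_cast
    rw [h6]
    have h7 : ((ν : ℂ) ^ 2 - 1 / 4) / r ^ 2 - 4 * q =
        (((ν : ℂ) ^ 2 - 1 / 4) - 4 * q * r ^ 2) / r ^ 2 := by
      field_simp
    rw [h7]
    generalize ((r ^ (ν - 1 / 2 - 1) : ℝ) : ℂ) = y
    generalize besselSeries ν (q * r ^ 2) = a at *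
    generalize besselSeries (ν + 1) (q * r ^ 2) = b at *
    generalize besselSeries (ν + 2) (q * r ^ 2) = c at *
    rw [show (((ν : ℂ) ^ 2 - 1 / 4) - 4 * q * r ^ 2) / r ^ 2 * (y * r ^ 2 * a) =
      (((ν : ℂ) ^ 2 - 1 / 4) - 4 * q * r ^ 2) * (y * a) by field_simp]
    linear_combination (-4 * q * r ^ 2 * y) * h4

/-! ### The decaying solution -/

/-- The solution `2 √r K_α(p r)` of the radial equation with `z = -p²`. -/
noncomputable def macdonaldSol (α : ℝ) (p : ℂ) (r : ℝ) : ℂ :=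
  ((r ^ (1 / 2 : ℝ) : ℝ) : ℂ) * macdonald α (p * r)

/-- The derivative of `macdonaldSol α p`. -/
noncomputable def macdonaldSolDeriv (α : ℝ) (p : ℂ) (r : ℝ) : ℂ :=
  ((r ^ (1 / 2 - 1 : ℝ) : ℝ) : ℂ) *
    ((1 / 2 - α) * macdonald α (p * r) - p * r * macdonald (1 - α) (p * r))

theorem hasDerivAt_macdonald_comp (α : ℝ) {p : ℂ} (hp : 0 < p.re) {r : ℝ} (hr : 0 < r) :
    HasDerivAt (fun r : ℝ => macdonald α (p * r))
      ((-(α * macdonald α (p * r)) - p * r * macdonald (1 - α) (p * r)) / r) r := by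
  have hrc : (r : ℂ) ≠ 0 := by exact_mod_cast hr.ne'
  have hre : 0 < (p * r).re := by simpa using mul_pos hp hr
  have h1 : HasDerivAt (fun r : ℝ => p * (r : ℂ)) p r := by
    have := (hasDerivAt_id r).ofReal_comp.const_mul p
    convert! this using 1
    simp
  convert! (hasDerivAt_macdonald α hre).comp_of_eq r h1 rfl using 1
  have h2 := macdonald_recurrence α hre
  rw [← macdonald_neg (1 - α), show -(1 - α) = α - 1 by ring]
  field_simp
  linear_combination h2

theorem isRadialSol_macdonald (α : ℝ) {p : ℂ} (hp : 0 < p.re) :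
    IsRadialSol α (-p ^ 2) (macdonaldSol α p) (macdonaldSolDeriv α p) where
  hasDerivAt r hr := by
    have hrc : (r : ℂ) ≠ 0 := by exact_mod_cast hr.ne'
    convert! hasDerivAt_rpow_mul (1 / 2) hr (hasDerivAt_macdonald_comp α hp hr) using 1
    rw [macdonaldSolDeriv]
    push_cast
    field_simp
    ring
  hasDerivAt' r hr := by
    have hrc : (r : ℂ) ≠ 0 := by exact_mod_cast hr.ne'
    have h1 : HasDerivAt (fun r : ℝ => p * (r : ℂ)) p r := by
      have := (hasDerivAt_id r).ofReal_comp.const_mul p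
      convert! this using 1
      simp
    have h3 := ((hasDerivAt_macdonald_comp α hp hr).const_mul (1 / 2 - (α : ℂ))).sub
      (h1.mul (hasDerivAt_macdonald_comp (1 - α) hp hr))
    convert! hasDerivAt_rpow_mul (1 / 2 - 1) hr h3 using 1
    have h5 : r ^ (1 / 2 : ℝ) = r ^ (1 / 2 - 1 - 1 : ℝ) * r ^ 2 := by
      rw [← Real.rpow_natCast r 2, ← Real.rpow_add hr]
      congr 1
      push_cast
      ring
    simp only [Pi.sub_apply, Pi.mul_apply]
    rw [macdonaldSol, radialPot, h5, sub_sub_cancel]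
    push_cast
    generalize ((r ^ (1 / 2 - 1 - 1 : ℝ) : ℝ) : ℂ) = y
    generalize macdonald α (p * r) = a
    generalize macdonald (1 - α) (p * r) = b
    field_simp
    ring

/-! ### Behaviour of the solutions at the origin -/

theorem tendsto_besselSeries_zero {ν : ℝ} (hν : -1 < ν) (q : ℂ) :
    Tendsto (fun r : ℝ => besselSeries ν (q * r ^ 2)) (𝓝[>] 0)
      (𝓝 (Complex.Gamma (ν + 1))⁻¹) := by
  have h := (hasDerivAt_besselSeries_comp (ν := ν) (by simpa using hν) q 0).continuousAt.tendsto
  simp only [Complex.ofReal_zero, ne_eq, OfNat.ofNat_ne_zero, not_false_eq_true, zero_pow,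
    mul_zero, besselSeries_zero] at h
  exact h.mono_left nhdsWithin_le_nhds

theorem tendsto_ofReal_rpow_zero {c : ℝ} (hc : 0 < c) :
    Tendsto (fun r : ℝ => ((r ^ c : ℝ) : ℂ)) (𝓝[>] 0) (𝓝 0) := by
  have h := (Real.continuousAt_rpow_const 0 c (Or.inr hc.le)).tendsto
  rw [Real.zero_rpow hc.ne'] at h
  have h2 := (Complex.continuous_ofReal.tendsto 0).comp h
  rw [Complex.ofReal_zero] at h2
  exact h2.mono_left nhdsWithin_le_nhds

theorem tendsto_sq_mul_macdonald_zero {p : ℂ} (hp : 0 < p.re) :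
    Tendsto (fun r : ℝ => (r : ℂ) ^ 2 * macdonald 0 (p * r)) (𝓝[>] 0) (𝓝 0) := by
  obtain ⟨C, hC⟩ := exists_rpow_mul_norm_macdonald_le hp (α := 0) (m := 1) one_pos (by simp)
  have h := (tendsto_ofReal_rpow_zero one_pos).norm.mul_const C
  rw [norm_zero, zero_mul] at h
  refine squeeze_zero_norm' ?_ h
  filter_upwards [self_mem_nhdsWithin] with r hr
  have hr : 0 < r := hr
  have h1 := hC r hr
  rw [Real.rpow_one] at h1 ⊢
  rw [norm_mul, norm_pow, pow_two, mul_assoc, Complex.norm_real, Real.norm_of_nonneg hr.le]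
  gcongr

theorem frobenius_wronskian_macdonald (ν α : ℝ) (q p : ℂ) {r : ℝ} (hr : 0 < r) :
    frobenius ν q r * macdonaldSolDeriv α p r - frobeniusDeriv ν q r * macdonaldSol α p r =
      ((r ^ ν : ℝ) : ℂ) * (-((α + ν) * besselSeries ν (q * r ^ 2) * macdonald α (p * r)) -
        p * r * besselSeries ν (q * r ^ 2) * macdonald (1 - α) (p * r) +
        2 * q * r ^ 2 * besselSeries (ν + 1) (q * r ^ 2) * macdonald α (p * r)) := by
  have h1 : ((r ^ (1 / 2 + ν) : ℝ) : ℂ) * ((r ^ (1 / 2 - 1 : ℝ) : ℝ) : ℂ) = ((r ^ ν : ℝ) : ℂ) := by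
    rw [← Complex.ofReal_mul, ← Real.rpow_add hr]
    congr 2
    ring
  have h2 : ((r ^ (ν - 1 / 2) : ℝ) : ℂ) * ((r ^ (1 / 2 : ℝ) : ℝ) : ℂ) = ((r ^ ν : ℝ) : ℂ) := by
    rw [← Complex.ofReal_mul, ← Real.rpow_add hr]
    congr 2
    ring
  rw [frobenius, frobeniusDeriv, macdonaldSol, macdonaldSolDeriv]
  linear_combination besselSeries ν (q * r ^ 2) *
    ((1 / 2 - α) * macdonald α (p * r) - p * r * macdonald (1 - α) (p * r)) * h1 -
    ((1 / 2 + ν) * besselSeries ν (q * r ^ 2) - 2 * q * r ^ 2 * besselSeries (ν + 1) (q * r ^ 2)) *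
      macdonald α (p * r) * h2

theorem ofReal_rpow_add {r : ℝ} (hr : 0 < r) (a b : ℝ) :
    ((r ^ (a + b) : ℝ) : ℂ) = ((r ^ a : ℝ) : ℂ) * ((r ^ b : ℝ) : ℂ) := by
  rw [Real.rpow_add hr, Complex.ofReal_mul]

theorem tendsto_rpow_mul_macdonald_one_sub {p : ℂ} (hp : 0 < p.re) {α : ℝ} (h : α < 1) :
    Tendsto (fun r : ℝ => ((r ^ (1 - α) : ℝ) : ℂ) * macdonald (1 - α) (p * r)) (𝓝[>] 0)
      (𝓝 ((p / 2) ^ ((α : ℂ) - 1) * Complex.Gamma (1 - α))) := by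
  have := tendsto_rpow_mul_macdonald hp (sub_pos.2 h)
  simpa using this

theorem tendsto_wronskian_regular {p q : ℂ} (hp : 0 < p.re) {α : ℝ} (h0 : 0 ≤ α) (h1 : α < 1) :
    Tendsto (fun r => frobenius α q r * macdonaldSolDeriv α p r -
      frobeniusDeriv α q r * macdonaldSol α p r) (𝓝[>] 0) (𝓝 (-2 * (p / 2) ^ (-α : ℂ))) := by
  have hp0 : p ≠ 0 := fun h => by simp [h] at hp
  have hA := tendsto_besselSeries_zero (ν := α) (by linarith) q
  have hB := tendsto_besselSeries_zero (ν := α + 1) (by linarith) q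
  have hY := tendsto_rpow_mul_macdonald_one_sub hp h1
  rcases h0.eq_or_lt with rfl | h0
  · have hX := tendsto_sq_mul_macdonald_zero hp
    have h := ((hA.mul hY).const_mul (-p)).add ((hB.mul hX).const_mul (2 * q))
    have e : -p * ((Complex.Gamma (((0 : ℝ) : ℂ) + 1))⁻¹ *
        ((p / 2) ^ (((0 : ℝ) : ℂ) - 1) * Complex.Gamma (1 - ((0 : ℝ) : ℂ)))) +
        2 * q * ((Complex.Gamma (((0 + 1 : ℝ) : ℂ) + 1))⁻¹ * 0) =
        -2 * (p / 2) ^ (-((0 : ℝ) : ℂ)) := by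
      simp [Complex.cpow_neg_one]
      field_simp
    rw [e] at h
    refine h.congr' ?_
    filter_upwards [self_mem_nhdsWithin] with r hr
    have hr : 0 < r := hr
    rw [frobenius_wronskian_macdonald _ _ _ _ hr]
    simp
    ring
  · have hX := tendsto_rpow_mul_macdonald hp h0
    have h2a := tendsto_ofReal_rpow_zero (mul_pos two_pos h0)
    have h2 := tendsto_ofReal_rpow_zero (two_pos (α := ℝ))
    have h := (((hA.mul hX).const_mul (-(2 * α : ℂ))).sub
      ((hA.mul (h2a.mul hY)).const_mul p)).add ((hB.mul (h2.mul hX)).const_mul (2 * q))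
    have e : -(2 * α : ℂ) * ((Complex.Gamma (α + 1))⁻¹ *
        ((p / 2) ^ (-α : ℂ) * Complex.Gamma α)) -
        p * ((Complex.Gamma (α + 1))⁻¹ *
          (0 * ((p / 2) ^ ((α : ℂ) - 1) * Complex.Gamma (1 - α)))) +
        2 * q * ((Complex.Gamma (((α + 1 : ℝ) : ℂ) + 1))⁻¹ *
          (0 * ((p / 2) ^ (-α : ℂ) * Complex.Gamma α))) = -2 * (p / 2) ^ (-α : ℂ) := by
      have ha : (α : ℂ) ≠ 0 := by exact_mod_cast h0.ne'
      have hG : Complex.Gamma α ≠ 0 := Complex.Gamma_ne_zero_of_re_pos (by simpa using h0)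
      rw [Complex.Gamma_add_one _ ha]
      field_simp
      ring
    rw [e] at h
    refine h.congr' ?_
    filter_upwards [self_mem_nhdsWithin] with r hr
    have hr : 0 < r := hr
    rw [frobenius_wronskian_macdonald _ _ _ _ hr]
    have e1 : ((r ^ (2 * α) : ℝ) : ℂ) * ((r ^ (1 - α) : ℝ) : ℂ) = ((r ^ α : ℝ) : ℂ) * r := by
      rw [← ofReal_rpow_add hr, show 2 * α + (1 - α) = α + 1 by ring, ofReal_rpow_add hr,
        Real.rpow_one]
    have e2 : ((r ^ (2 : ℝ) : ℝ) : ℂ) = (r : ℂ) ^ 2 := by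
      rw [Real.rpow_two, Complex.ofReal_pow]
    rw [e2]
    push_cast
    linear_combination (-p * besselSeries α (q * r ^ 2) * macdonald (1 - α) (p * r)) * e1

theorem tendsto_wronskian_irregular {p q : ℂ} (hp : 0 < p.re) {α : ℝ} (h0 : 0 < α) (h1 : α < 1) :
    Tendsto (fun r => frobenius (-α) q r * macdonaldSolDeriv α p r -
      frobeniusDeriv (-α) q r * macdonaldSol α p r) (𝓝[>] 0) (𝓝 (-2 * (p / 2) ^ (α : ℂ))) := by
  have hp0 : p ≠ 0 := fun h => by simp [h] at hp
  have hA := tendsto_besselSeries_zero (ν := -α) (by linarith) q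
  have hB := tendsto_besselSeries_zero (ν := -α + 1) (by linarith) q
  have hY := tendsto_rpow_mul_macdonald_one_sub hp h1
  have hX := tendsto_rpow_mul_macdonald hp h0
  have h2 := tendsto_ofReal_rpow_zero (c := 2 - 2 * α) (by linarith)
  have h := ((hA.mul hY).const_mul (-p)).add ((hB.mul (h2.mul hX)).const_mul (2 * q))
  have e : -p * ((Complex.Gamma (((-α : ℝ) : ℂ) + 1))⁻¹ *
      ((p / 2) ^ ((α : ℂ) - 1) * Complex.Gamma (1 - α))) +
      2 * q * ((Complex.Gamma (((-α + 1 : ℝ) : ℂ) + 1))⁻¹ *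
        (0 * ((p / 2) ^ (-α : ℂ) * Complex.Gamma α))) = -2 * (p / 2) ^ (α : ℂ) := by
    have hG : Complex.Gamma (1 - α) ≠ 0 := Complex.Gamma_ne_zero_of_re_pos (by simpa using h1)
    rw [Complex.cpow_sub _ _ (div_ne_zero hp0 two_ne_zero), Complex.cpow_one, Complex.ofReal_neg,
      show -(α : ℂ) + 1 = 1 - α by ring]
    field_simp
    ring
  rw [e] at h
  refine h.congr' ?_
  filter_upwards [self_mem_nhdsWithin] with r hr
  have hr : 0 < r := hr
  rw [frobenius_wronskian_macdonald _ _ _ _ hr]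
  have e1 : ((r ^ (1 - α) : ℝ) : ℂ) = ((r ^ (-α) : ℝ) : ℂ) * r := by
    rw [show 1 - α = -α + 1 by ring, ofReal_rpow_add hr, Real.rpow_one]
  have e2 : ((r ^ (2 - 2 * α) : ℝ) : ℂ) * ((r ^ α : ℝ) : ℂ) =
      ((r ^ (-α) : ℝ) : ℂ) * (r : ℂ) ^ 2 := by
    rw [← ofReal_rpow_add hr, show 2 - 2 * α + α = -α + 2 by ring, ofReal_rpow_add hr,
      Real.rpow_two, Complex.ofReal_pow]
  rw [e1]
  push_cast
  linear_combination
    (2 * q * besselSeries (-α + 1) (q * r ^ 2) * macdonald α (p * r)) * e2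

theorem tendsto_wronskian_frobenius (q : ℂ) {α : ℝ} (h0 : 0 < α) (h1 : α < 1) :
    Tendsto (fun r => frobenius α q r * frobeniusDeriv (-α) q r -
      frobeniusDeriv α q r * frobenius (-α) q r) (𝓝[>] 0)
      (𝓝 (-2 * Complex.sin (Real.pi * α) / Real.pi)) := by
  have hA := tendsto_besselSeries_zero (ν := α) (by linarith) q
  have hA' := tendsto_besselSeries_zero (ν := α + 1) (by linarith) q
  have hB := tendsto_besselSeries_zero (ν := -α) (by linarith) q
  have hB' := tendsto_besselSeries_zero (ν := -α + 1) (by linarith) q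
  have h2 := tendsto_ofReal_rpow_zero (two_pos (α := ℝ))
  have h := ((hA.mul hB).const_mul (-(2 * α : ℂ))).add
    (h2.mul (((hA'.mul hB).sub (hA.mul hB')).const_mul (2 * q)))
  rw [zero_mul, add_zero] at h
  have e : -(2 * α : ℂ) * ((Complex.Gamma (α + 1))⁻¹ * (Complex.Gamma (((-α : ℝ) : ℂ) + 1))⁻¹) =
      -2 * Complex.sin (Real.pi * α) / Real.pi := by
    have ha : (α : ℂ) ≠ 0 := by exact_mod_cast h0.ne'
    have hG := Complex.Gamma_mul_Gamma_one_sub α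
    have hs : Complex.sin (Real.pi * α) ≠ 0 := by
      have := Real.sin_pos_of_pos_of_lt_pi (mul_pos Real.pi_pos h0) (by nlinarith [Real.pi_pos])
      exact_mod_cast this.ne'
    have hpi : (Real.pi : ℂ) ≠ 0 := by exact_mod_cast Real.pi_ne_zero
    have hGa : Complex.Gamma α ≠ 0 := Complex.Gamma_ne_zero_of_re_pos (by simpa using h0)
    have hGb : Complex.Gamma (1 - α) ≠ 0 := Complex.Gamma_ne_zero_of_re_pos (by simpa using h1)
    rw [Complex.Gamma_add_one _ ha, Complex.ofReal_neg, show -(α : ℂ) + 1 = 1 - α by ring]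
    rw [eq_div_iff hs] at hG
    rw [mul_comm (Real.pi : ℂ)] at hG ⊢
    field_simp
    linear_combination hG
  rw [e] at h
  refine h.congr' ?_
  filter_upwards [self_mem_nhdsWithin] with r hr
  have hr : 0 < r := hr
  have e1 : ((r ^ (1 / 2 + α) : ℝ) : ℂ) * ((r ^ (-α - 1 / 2) : ℝ) : ℂ) = 1 := by
    rw [← ofReal_rpow_add hr]
    rw [show 1 / 2 + α + (-α - 1 / 2) = 0 by ring, Real.rpow_zero, Complex.ofReal_one]
  have e2 : ((r ^ (α - 1 / 2) : ℝ) : ℂ) * ((r ^ (1 / 2 + -α) : ℝ) : ℂ) = 1 := by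
    rw [← ofReal_rpow_add hr]
    rw [show α - 1 / 2 + (1 / 2 + -α) = 0 by ring, Real.rpow_zero, Complex.ofReal_one]
  rw [frobenius, frobenius, frobeniusDeriv, frobeniusDeriv, Real.rpow_two]
  push_cast
  generalize besselSeries α (q * r ^ 2) = a
  generalize besselSeries (-α) (q * r ^ 2) = b
  generalize besselSeries (α + 1) (q * r ^ 2) = a'
  generalize besselSeries (-α + 1) (q * r ^ 2) = b'
  linear_combination (-a * ((1 / 2 - α) * b - 2 * q * r ^ 2 * b')) * e1 +
    ((1 / 2 + α) * a - 2 * q * r ^ 2 * a') * b * e2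

/-! ### The Hankel function -/

section Hankel

variable {k : ℂ}

theorem re_neg_I_mul (hk : 0 < k.im) : 0 < (-Complex.I * k).re := by simpa using hk

theorem log_neg_I_mul_div_two (hk : 0 < k.im) :
    Complex.log (-Complex.I * k / 2) = Complex.log (k / 2) - Real.pi / 2 * Complex.I := by
  have hk0 : k / 2 ≠ 0 := fun h => by
    have : k = 0 := by simpa using h
    simp [this] at hk
  have him : 0 < (k / 2).im := by simpa using hk
  have h1 := Complex.arg_nonneg_iff.2 him.le
  have h2 := Complex.arg_le_pi (k / 2)
  have := Real.pi_pos
  rw [show -Complex.I * k / 2 = k / 2 * -Complex.I by ring, Complex.log_mul hk0 (by simp),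
    Complex.log_neg_I]
  · ring
  · rw [Complex.arg_neg_I]
    constructor <;> linarith

theorem cpow_neg_I_mul_div_two (hk : 0 < k.im) (c : ℂ) :
    (-Complex.I * k / 2) ^ c = (k / 2) ^ c * Complex.exp (-(Real.pi / 2 * Complex.I * c)) := by
  have hk0 : k ≠ 0 := fun h => by simp [h] at hk
  rw [Complex.cpow_def_of_ne_zero (by simp [hk0]), Complex.cpow_def_of_ne_zero (by simp [hk0]),
    ← Complex.exp_add, log_neg_I_mul_div_two hk]
  congr 1
  ring

end Hankel

theorem mul_ofReal_cpow {a : ℂ} (ha : a ≠ 0) {r : ℝ} (hr : 0 < r) (ν : ℝ) :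
    (a * r) ^ (ν : ℂ) = a ^ (ν : ℂ) * ((r ^ ν : ℝ) : ℂ) := by
  have hrc : (r : ℂ) ≠ 0 := by exact_mod_cast hr.ne'
  rw [Complex.cpow_def_of_ne_zero (mul_ne_zero ha hrc), Complex.log_mul_ofReal r hr a ha,
    Complex.ofReal_cpow hr.le, Complex.cpow_def_of_ne_zero ha, Complex.cpow_def_of_ne_zero hrc,
    ← Complex.exp_add, ← Complex.ofReal_log hr.le]
  congr 1
  ring

theorem sqrt_mul_besselJ (ν : ℝ) {k : ℂ} (hk : k ≠ 0) {r : ℝ} (hr : 0 < r) :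
    ((r ^ (1 / 2 : ℝ) : ℝ) : ℂ) * besselJ ν (k * r) =
      (k / 2) ^ (ν : ℂ) * frobenius ν ((k / 2) ^ 2) r := by
  rw [besselJ_eq, frobenius, ofReal_rpow_add hr, show k * r / 2 = k / 2 * r by ring,
    mul_ofReal_cpow (div_ne_zero hk two_ne_zero) hr, mul_pow]
  ring

/-- `macdonald α (-i z)` is a multiple of `H_α^{(1)}(z)`; here for noninteger `α`. -/
theorem macdonald_eq_of_pos {k : ℂ} (hk : 0 < k.im) {α : ℝ} (h0 : 0 < α) (h1 : α < 1) {r : ℝ}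
    (hr : 0 < r) :
    macdonald α (-Complex.I * k * r) = Real.pi * Complex.I *
      Complex.exp (Real.pi / 2 * Complex.I * α) *
        (besselJ α (k * r) + Complex.I * besselYQuot α (k * r)) := by
  have hk0 : k ≠ 0 := fun h => by simp [h] at hk
  have hp := re_neg_I_mul hk
  set q := (k / 2) ^ 2
  have z1 : -(-Complex.I * k) ^ 2 = 4 * q := by
    rw [mul_pow, neg_sq, Complex.I_sq]
    simp only [q]
    ring
  have s1 := isRadialSol_frobenius (ν := α) (α := α) (by linarith) rfl q
  have s2 := isRadialSol_frobenius (ν := -α) (α := α) (by linarith) (neg_sq α) q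
  have s3 := isRadialSol_macdonald α hp
  rw [z1] at s3
  have w13 := s1.wronskian_eq_of_tendsto s3 (tendsto_wronskian_regular hp h0.le h1) hr
  have w23 := s2.wronskian_eq_of_tendsto s3 (tendsto_wronskian_irregular hp h0 h1) hr
  have w12 := s1.wronskian_eq_of_tendsto s2 (tendsto_wronskian_frobenius q h0 h1) hr
  have hs : Complex.sin (Real.pi * α) ≠ 0 := by
    have := Real.sin_pos_of_pos_of_lt_pi (mul_pos Real.pi_pos h0) (by nlinarith [Real.pi_pos])
    exact_mod_cast this.ne'
  have hpi : (Real.pi : ℂ) ≠ 0 := by exact_mod_cast Real.pi_ne_zero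
  have hr2 : ((r ^ (1 / 2 : ℝ) : ℝ) : ℂ) ≠ 0 := by
    exact_mod_cast (Real.rpow_pos_of_pos hr _).ne'
  have j1 := sqrt_mul_besselJ α hk0 hr
  have j2 := sqrt_mul_besselJ (-α) hk0 hr
  have key : -2 * Complex.sin (Real.pi * α) / Real.pi * macdonaldSol α (-Complex.I * k) r =
      2 * (-Complex.I * k / 2) ^ (α : ℂ) * frobenius α q r -
        2 * (-Complex.I * k / 2) ^ (-α : ℂ) * frobenius (-α) q r := by
    linear_combination -macdonaldSol α (-Complex.I * k) r * w12 + frobenius (-α) q r * w13 -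
      frobenius α q r * w23
  rw [cpow_neg_I_mul_div_two hk, cpow_neg_I_mul_div_two hk, macdonaldSol] at key
  rw [Complex.ofReal_neg] at j2
  have e1 : Complex.exp (-(Real.pi / 2 * Complex.I * -α)) =
      Complex.exp (Real.pi / 2 * Complex.I * α) := by
    congr 1
    ring
  have e2 : Complex.exp (-(Real.pi / 2 * Complex.I * α)) =
      Complex.exp (Real.pi / 2 * Complex.I * α) *
        (Complex.cos (Real.pi * α) - Complex.I * Complex.sin (Real.pi * α)) := by
    have := Complex.exp_mul_I (-(Real.pi * α : ℂ))
    rw [Complex.cos_neg, Complex.sin_neg] at this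
    rw [show Complex.cos (Real.pi * α) - Complex.I * Complex.sin (Real.pi * α) =
      Complex.cos (Real.pi * α) + -Complex.sin (Real.pi * α) * Complex.I by ring, ← this,
      ← Complex.exp_add]
    congr 1
    ring
  rw [e1, e2] at key
  apply mul_left_cancel₀ hr2
  rw [besselYQuot]
  generalize Complex.exp (Real.pi / 2 * Complex.I * α) = E at *
  generalize Complex.sin (Real.pi * α) = S at *
  generalize Complex.cos (Real.pi * α) = C at *
  have key2 : ((r ^ (1 / 2 : ℝ) : ℝ) : ℂ) * macdonald α (-Complex.I * k * r) =
      Real.pi / S * (E * (((r ^ (1 / 2 : ℝ) : ℝ) : ℂ) * besselJ (-α) (k * r)) -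
        E * (C - Complex.I * S) * (((r ^ (1 / 2 : ℝ) : ℝ) : ℂ) * besselJ α (k * r))) := by
    rw [j1, j2]
    change _ = Real.pi / S * (E * (_ * frobenius (-α) q r) - E * _ * (_ * frobenius α q r))
    field_simp at key ⊢
    linear_combination -key
  rw [key2]
  field_simp
  linear_combination E * (besselJ (-α) (k * r) - C * besselJ α (k * r)) * Complex.I_sq

theorem macdonald_eq_hankelH1 {k : ℂ} (hk : 0 < k.im) {α : ℝ} (h0 : 0 ≤ α) (h1 : α < 1) {r : ℝ}
    (hr : 0 < r) :
    macdonald α (-Complex.I * k * r) = Real.pi * Complex.I *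
      Complex.exp (Real.pi / 2 * Complex.I * α) * hankelH1 α (k * r) := by
  rcases h0.eq_or_lt with rfl | h0
  · have hk0 : k ≠ 0 := fun h => by simp [h] at hk
    have hz : k * r ≠ 0 := mul_ne_zero hk0 (by exact_mod_cast hr.ne')
    have hre : 0 < (-Complex.I * k * r).re := by
      rw [Complex.re_mul_ofReal]
      exact mul_pos (re_neg_I_mul hk) hr
    obtain ⟨L, hL⟩ := tendsto_besselYQuot_zero hz
    have hc : Tendsto (fun a : ℝ => (a : ℂ)) (𝓝[>] 0) (𝓝[≠] 0) := by
      refine tendsto_nhdsWithin_iff.2 ⟨?_, ?_⟩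
      · exact (Complex.continuous_ofReal.tendsto 0).mono_left nhdsWithin_le_nhds
      · filter_upwards [self_mem_nhdsWithin] with a ha
        have ha : 0 < a := ha
        simpa using ha.ne'
    have hJ := (differentiableAt_besselJ_order hz).continuousAt.tendsto.comp
      (hc.mono_right nhdsWithin_le_nhds)
    have hE : Tendsto (fun a : ℝ => Complex.exp (Real.pi / 2 * Complex.I * a)) (𝓝[>] 0)
        (𝓝 (Complex.exp (Real.pi / 2 * Complex.I * (0 : ℝ)))) := by
      have : Continuous fun a : ℝ => Complex.exp (Real.pi / 2 * Complex.I * a) := by fun_prop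
      exact (this.tendsto 0).mono_left nhdsWithin_le_nhds
    have hR := (hE.const_mul (Real.pi * Complex.I : ℂ)).mul
      (hJ.add ((hL.comp hc).const_mul Complex.I))
    have hY : besselY ((0 : ℝ) : ℂ) (k * r) = L := by
      simp only [besselY, Complex.ofReal_zero, mul_zero, Complex.sin_zero, if_true]
      exact hL.limUnder_eq
    rw [hankelH1, hY]
    refine tendsto_nhds_unique (tendsto_macdonald_order_zero hre) ?_
    rw [Complex.ofReal_zero] at hR ⊢
    refine hR.congr' ?_
    filter_upwards [Ioo_mem_nhdsGT one_pos] with a ha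
    exact (macdonald_eq_of_pos hk ha.1 ha.2 hr).symm
  · rw [macdonald_eq_of_pos hk h0 h1 hr, hankelH1, besselY, if_neg]
    have := Real.sin_pos_of_pos_of_lt_pi (mul_pos Real.pi_pos h0) (by nlinarith [Real.pi_pos])
    exact_mod_cast this.ne'

/-! ### Growth of the solutions at infinity -/

section Growth

variable {α : ℝ} {k : ℂ} {f f' : ℝ → ℂ}

theorem hasDerivAt_cexp_I_mul (k : ℂ) (r : ℝ) :
    HasDerivAt (fun r : ℝ => Complex.exp (Complex.I * k * r))
      (Complex.I * k * Complex.exp (Complex.I * k * r)) r := by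
  have h1 : HasDerivAt (fun r : ℝ => Complex.I * k * (r : ℂ)) (Complex.I * k) r := by
    have := (hasDerivAt_id r).ofReal_comp.const_mul (Complex.I * k)
    convert! this using 1
    simp
  convert! h1.cexp using 1
  ring

theorem norm_cexp_I_mul (k : ℂ) (r : ℝ) :
    ‖Complex.exp (Complex.I * k * r)‖ = Real.exp (-(k.im * r)) := by
  rw [Complex.norm_exp]
  simp

/-- The derivative of the squared size of a solution, weighted by `e^{ikr}`. -/
theorem IsRadialSol.exists_hasDerivAt_energy (hf : IsRadialSol α (k ^ 2) f f') (hk : 0 < k.im)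
    {r : ℝ} (hr : 0 < r) :
    ∃ Z', HasDerivAt (fun r : ℝ =>
      ‖Complex.exp (Complex.I * k * r) * (f' r - Complex.I * k * f r)‖ ^ 2 +
        ‖Complex.exp (Complex.I * k * r) * (f' r + Complex.I * k * f r)‖ ^ 2) Z' r ∧
      Z' ≤ (2 * |α ^ 2 - 1 / 4| / ‖k‖) / r ^ 2 *
        (‖Complex.exp (Complex.I * k * r) * (f' r - Complex.I * k * f r)‖ ^ 2 +
          ‖Complex.exp (Complex.I * k * r) * (f' r + Complex.I * k * f r)‖ ^ 2) := by
  have hk0 : k ≠ 0 := fun h => by simp [h] at hk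
  have hE := hasDerivAt_cexp_I_mul k r
  set E : ℝ → ℂ := fun r => Complex.exp (Complex.I * k * r)
  have hP : HasDerivAt (fun r => E r * (f' r - Complex.I * k * f r))
      (E r * radialPot α r * f r) r := by
    convert! hE.mul ((hf.hasDerivAt' r hr).sub ((hf.hasDerivAt r hr).const_mul (Complex.I * k))) using 1
    simp only [Pi.sub_apply]
    linear_combination (E r * f r * k ^ 2) * Complex.I_sq
  have hQ : HasDerivAt (fun r => E r * (f' r + Complex.I * k * f r))
      (2 * Complex.I * k * (E r * (f' r + Complex.I * k * f r)) + E r * radialPot α r * f r) r := by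
    convert! hE.mul ((hf.hasDerivAt' r hr).add ((hf.hasDerivAt r hr).const_mul (Complex.I * k))) using 1
    simp only [Pi.add_apply]
    linear_combination (E r * f r * k ^ 2) * Complex.I_sq
  refine ⟨_, hP.norm_sq.add hQ.norm_sq, ?_⟩
  change _ ≤ _ * (‖E r * (f' r - Complex.I * k * f r)‖ ^ 2 +
    ‖E r * (f' r + Complex.I * k * f r)‖ ^ 2)
  set P := E r * (f' r - Complex.I * k * f r) with hPdef
  set Q := E r * (f' r + Complex.I * k * f r) with hQdef
  set Y := E r * radialPot α r * f r with hY
  have hYn : ‖Y‖ ≤ |α ^ 2 - 1 / 4| / r ^ 2 * ((‖P‖ + ‖Q‖) / (2 * ‖k‖)) := by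
    have e : Y = radialPot α r * ((Q - P) / (2 * (Complex.I * k))) := by
      rw [hY, hPdef, hQdef]
      field_simp
      ring
    rw [e, norm_mul, norm_div, radialPot, Complex.norm_real, Real.norm_eq_abs, abs_div,
      abs_of_pos (pow_pos hr 2)]
    have : ‖2 * (Complex.I * k)‖ = 2 * ‖k‖ := by simp
    rw [this]
    gcongr
    rw [add_comm]
    exact norm_sub_le Q P
  have h1 : inner ℝ P Y ≤ ‖P‖ * ‖Y‖ := real_inner_le_norm P Y
  have h2 : inner ℝ Q Y ≤ ‖Q‖ * ‖Y‖ := real_inner_le_norm Q Y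
  have h3 : inner ℝ Q (2 * Complex.I * k * Q) ≤ 0 := by
    have : inner ℝ Q (2 * Complex.I * k * Q) = -(2 * k.im) * (Q.re ^ 2 + Q.im ^ 2) := by
      rw [Complex.inner]
      simp
      ring
    rw [this]
    nlinarith [sq_nonneg Q.re, sq_nonneg Q.im]
  rw [inner_add_right]
  have hkn : 0 < ‖k‖ := norm_pos_iff.2 hk0
  have h4 : 2 * inner ℝ P Y + 2 * (inner ℝ Q (2 * Complex.I * k * Q) + inner ℝ Q Y) ≤
      2 * (‖P‖ + ‖Q‖) * ‖Y‖ := by nlinarith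
  refine h4.trans ((mul_le_mul_of_nonneg_left hYn (by positivity)).trans ?_)
  have h5 : 2 * (‖P‖ + ‖Q‖) * (|α ^ 2 - 1 / 4| / r ^ 2 * ((‖P‖ + ‖Q‖) / (2 * ‖k‖))) =
      (|α ^ 2 - 1 / 4| / ‖k‖ / r ^ 2) * (‖P‖ + ‖Q‖) ^ 2 := by
    field_simp
  have h6 : 2 * |α ^ 2 - 1 / 4| / ‖k‖ / r ^ 2 * (‖P‖ ^ 2 + ‖Q‖ ^ 2) =
      (|α ^ 2 - 1 / 4| / ‖k‖ / r ^ 2) * (2 * (‖P‖ ^ 2 + ‖Q‖ ^ 2)) := by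
    ring
  rw [h5, h6]
  gcongr
  nlinarith [sq_nonneg (‖P‖ - ‖Q‖)]

/-- Solutions grow at most like `e^{r Im k}`. -/
theorem IsRadialSol.exists_norm_le_exp (hf : IsRadialSol α (k ^ 2) f f') (hk : 0 < k.im) :
    ∃ C, ∀ r, 1 ≤ r → ‖f r‖ ≤ C * Real.exp (k.im * r) := by
  have hk0 : k ≠ 0 := fun h => by simp [h] at hk
  have hkn : 0 < ‖k‖ := norm_pos_iff.2 hk0
  set P : ℝ → ℂ := fun r => Complex.exp (Complex.I * k * r) * (f' r - Complex.I * k * f r)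
  set Q : ℝ → ℂ := fun r => Complex.exp (Complex.I * k * r) * (f' r + Complex.I * k * f r)
  set c := 2 * |α ^ 2 - 1 / 4| / ‖k‖
  have hd : ∀ r, 0 < r → ∃ Z', HasDerivAt (fun r => ‖P r‖ ^ 2 + ‖Q r‖ ^ 2) Z' r ∧
      Z' ≤ c / r ^ 2 * (‖P r‖ ^ 2 + ‖Q r‖ ^ 2) := fun r hr =>
    hf.exists_hasDerivAt_energy hk hr
  have hexp : ∀ r : ℝ, 0 < r → HasDerivAt (fun r : ℝ => Real.exp (c / r))
      (Real.exp (c / r) * -(c / r ^ 2)) r := fun r hr => by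
    have : HasDerivAt (fun r : ℝ => c / r) (-(c / r ^ 2)) r := by
      convert! (hasDerivAt_inv hr.ne').const_mul c using 1
      ring
    exact this.exp
  have hanti : AntitoneOn (fun r => (‖P r‖ ^ 2 + ‖Q r‖ ^ 2) * Real.exp (c / r)) (Ici 1) := by
    refine antitoneOn_of_deriv_nonpos (convex_Ici 1) ?_ ?_ ?_
    · intro r hr
      have hr : 0 < r := zero_lt_one.trans_le hr
      obtain ⟨Z', hZ, -⟩ := hd r hr
      exact (hZ.mul (hexp r hr)).continuousAt.continuousWithinAt
    · intro r hr
      rw [interior_Ici] at hr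
      have hr : 0 < r := zero_lt_one.trans hr
      obtain ⟨Z', hZ, -⟩ := hd r hr
      exact (hZ.mul (hexp r hr)).differentiableAt.differentiableWithinAt
    · intro r hr
      rw [interior_Ici] at hr
      have hr : 0 < r := zero_lt_one.trans hr
      obtain ⟨Z', hZ, hle⟩ := hd r hr
      have := (hZ.mul (hexp r hr)).deriv
      change deriv (fun r => (‖P r‖ ^ 2 + ‖Q r‖ ^ 2) * Real.exp (c / r)) r = _ at this
      rw [this]
      have := Real.exp_pos (c / r)
      nlinarith
  set B := (‖P 1‖ ^ 2 + ‖Q 1‖ ^ 2) * Real.exp (c / 1)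
  have hB : ∀ r, 1 ≤ r → ‖P r‖ ^ 2 + ‖Q r‖ ^ 2 ≤ B := fun r hr => by
    have h1 := hanti (mem_Ici.2 le_rfl) (show r ∈ Ici (1 : ℝ) from hr) hr
    refine le_trans ?_ h1
    refine le_mul_of_one_le_right (by positivity) (Real.one_le_exp ?_)
    positivity
  refine ⟨(√B + √B) / (2 * ‖k‖), fun r hr => ?_⟩
  have hP : ‖P r‖ ≤ √B := Real.le_sqrt_of_sq_le (by nlinarith [hB r hr, sq_nonneg ‖Q r‖])
  have hQ : ‖Q r‖ ≤ √B := Real.le_sqrt_of_sq_le (by nlinarith [hB r hr, sq_nonneg ‖P r‖])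
  have e : Complex.exp (Complex.I * k * r) * f r = (Q r - P r) / (2 * (Complex.I * k)) := by
    simp only [P, Q]
    field_simp
    ring
  have h2 : Real.exp (-(k.im * r)) * ‖f r‖ ≤ (√B + √B) / (2 * ‖k‖) := by
    rw [← norm_cexp_I_mul, ← norm_mul, e, norm_div,
      show ‖2 * (Complex.I * k)‖ = 2 * ‖k‖ by simp]
    gcongr
    exact (norm_sub_le _ _).trans (add_le_add hQ hP)
  calc ‖f r‖ = Real.exp (-(k.im * r)) * ‖f r‖ * Real.exp (k.im * r) := by
        rw [mul_right_comm, ← Real.exp_add, neg_add_cancel, Real.exp_zero, one_mul]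
    _ ≤ _ := by gcongr

end Growth

/-! ### Decay of the Macdonald solution -/

theorem exists_sqrt_mul_norm_macdonald_le (μ : ℝ) {p : ℂ} (hp : 0 < p.re) :
    ∃ C, 0 ≤ C ∧ ∀ r : ℝ, 1 ≤ r →
      r ^ (1 / 2 : ℝ) * ‖macdonald μ (p * r)‖ ≤ C * Real.exp (-p.re * r) := by
  refine ⟨Real.exp (μ ^ 2 / (2 * p.re)) * √(Real.pi / (p.re / 2)), by positivity, fun r hr => ?_⟩
  have hr0 : 0 < r := zero_lt_one.trans_le hr
  have hre : (p * r).re = p.re * r := Complex.re_mul_ofReal p r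
  have h := norm_macdonald_le_exp μ (ζ := p * r) (by rw [hre]; positivity)
  rw [hre] at h
  have h1 : Real.exp (μ ^ 2 / (2 * (p.re * r))) ≤ Real.exp (μ ^ 2 / (2 * p.re)) := by
    gcongr
    exact le_mul_of_one_le_right hp.le hr
  have h2 : √(Real.pi / (p.re * r / 2)) = √(Real.pi / (p.re / 2)) / √r := by
    rw [← Real.sqrt_div' _ hr0.le]
    congr 1
    field_simp
  have hs : 0 < √r := Real.sqrt_pos.2 hr0
  rw [h2] at h
  rw [← Real.sqrt_eq_rpow]
  calc √r * ‖macdonald μ (p * r)‖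
      ≤ √r * (Real.exp (-(p.re * r)) * (Real.exp (μ ^ 2 / (2 * p.re)) *
        (√(Real.pi / (p.re / 2)) / √r))) := by
        gcongr
        exact h.trans (by gcongr)
    _ = _ := by
        rw [neg_mul]
        field_simp

theorem norm_macdonaldSol {α : ℝ} {p : ℂ} {r : ℝ} (hr : 0 < r) :
    ‖macdonaldSol α p r‖ = r ^ (1 / 2 : ℝ) * ‖macdonald α (p * r)‖ := by
  rw [macdonaldSol, norm_mul, Complex.norm_real, Real.norm_of_nonneg (by positivity)]

theorem exists_norm_macdonaldSolDeriv_le (α : ℝ) {p : ℂ} (hp : 0 < p.re) :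
    ∃ C, ∀ r : ℝ, 1 ≤ r → ‖macdonaldSolDeriv α p r‖ ≤ C * Real.exp (-p.re * r) := by
  obtain ⟨C₁, h₁, H₁⟩ := exists_sqrt_mul_norm_macdonald_le α hp
  obtain ⟨C₂, h₂, H₂⟩ := exists_sqrt_mul_norm_macdonald_le (1 - α) hp
  refine ⟨‖(1 / 2 - α : ℂ)‖ * C₁ + ‖p‖ * C₂, fun r hr => ?_⟩
  have hr0 : 0 < r := zero_lt_one.trans_le hr
  have e : macdonaldSolDeriv α p r = (r : ℂ)⁻¹ * ((1 / 2 - α) *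
      (((r ^ (1 / 2 : ℝ) : ℝ) : ℂ) * macdonald α (p * r))) -
      p * (((r ^ (1 / 2 : ℝ) : ℝ) : ℂ) * macdonald (1 - α) (p * r)) := by
    have hrc : (r : ℂ) ≠ 0 := by exact_mod_cast hr0.ne'
    rw [macdonaldSolDeriv, Real.rpow_sub_one hr0.ne']
    push_cast
    field_simp
  rw [e]
  have hn : ∀ μ, ‖((r ^ (1 / 2 : ℝ) : ℝ) : ℂ) * macdonald μ (p * r)‖ =
      r ^ (1 / 2 : ℝ) * ‖macdonald μ (p * r)‖ := fun μ => norm_macdonaldSol hr0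
  have hri : ‖(r : ℂ)⁻¹‖ ≤ 1 := by
    rw [norm_inv, Complex.norm_real, Real.norm_of_nonneg hr0.le]
    exact inv_le_one_of_one_le₀ hr
  refine (norm_sub_le _ _).trans ?_
  rw [add_mul, mul_assoc, mul_assoc]
  refine add_le_add ?_ ?_
  · rw [norm_mul, norm_mul, hn]
    exact (mul_le_of_le_one_left (by positivity) hri).trans
      (mul_le_mul_of_nonneg_left (H₁ r hr) (norm_nonneg _))
  · rw [norm_mul, hn]
    exact mul_le_mul_of_nonneg_left (H₂ r hr) (norm_nonneg _)

/-! ### Admissible weights -/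

theorem integrable_exp_neg_mul_abs {b : ℝ} (hb : 0 < b) :
    Integrable fun x : ℝ => Real.exp (-b * |x|) := by
  have h : IntegrableOn (fun x : ℝ => Real.exp (-b * x)) (Ioi 0) := exp_neg_integrableOn_Ioi 0 hb
  have h1 : IntegrableOn (fun x : ℝ => Real.exp (-b * |x|)) (Ioi 0) :=
    h.congr_fun (fun x hx => by simp only [abs_of_pos (show 0 < x from hx)]) measurableSet_Ioi
  have h2 := IntegrableOn.comp_neg_Iio (c := 0) (f := fun x : ℝ => Real.exp (-b * |x|))
    (by rwa [neg_zero])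
  simp only [abs_neg] at h2
  rw [← integrableOn_univ, ← Iic_union_Ioi (a := (0 : ℝ))]
  exact ((integrableOn_Iic_iff_integrableOn_Iio).2 h2).union h1

/-- The weights `C (1 + r^{-β})` with `β < 1/2` are admissible. -/
theorem exists_isAdmissibleWeight {b C β : ℝ} (hb : 0 < b) (hC : 0 ≤ C) (hβ0 : 0 ≤ β)
    (hβ : β < 1 / 2) :
    ∃ M, IsAdmissibleWeight b M fun r => C * (1 + |r| ^ (-β)) := by
  set e : ℝ → ℝ := fun x => Real.exp (-b * |x|)
  have he : Integrable e := integrable_exp_neg_mul_abs hb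
  set u : ℝ → ℝ := (Ioc 0 1).indicator fun r => r ^ (-(2 * β))
  have hu : Integrable u := by
    refine (integrable_indicator_iff measurableSet_Ioc).2 ?_
    exact (intervalIntegrable_iff_integrableOn_Ioc_of_le zero_le_one).1
      (intervalIntegral.intervalIntegrable_rpow' (by linarith))
  have hu0 : ∀ r, 0 ≤ u r := fun r => indicator_nonneg (fun x hx => by
    have := hx.1
    positivity) r
  have hue : ∀ r t, 0 < r → (C * (1 + |r| ^ (-β))) ^ 2 * Real.exp (-b * |r - t|) ≤
      2 * C ^ 2 * (2 * e (r - t) + u r) := by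
    intro r t hr
    have h1 : (1 + |r| ^ (-β)) ^ 2 ≤ 2 * (1 + r ^ (-(2 * β))) := by
      have : r ^ (-(2 * β)) = (r ^ (-β)) ^ 2 := by
        rw [← Real.rpow_natCast, ← Real.rpow_mul hr.le]
        congr 1
        push_cast
        ring
      rw [this, abs_of_pos hr]
      nlinarith [sq_nonneg (1 - r ^ (-β))]
    have h2 : r ^ (-(2 * β)) * e (r - t) ≤ u r + e (r - t) := by
      have he0 : 0 ≤ e (r - t) := (Real.exp_pos _).le
      have he1 : e (r - t) ≤ 1 := Real.exp_le_one_iff.2 (by nlinarith [abs_nonneg (r - t)])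
      by_cases h1 : r ≤ 1
      · have : u r = r ^ (-(2 * β)) := indicator_of_mem (show r ∈ Ioc (0 : ℝ) 1 from ⟨hr, h1⟩) _
        rw [this]
        have h3 : 0 ≤ r ^ (-(2 * β)) := by positivity
        nlinarith
      · have h3 : r ^ (-(2 * β)) ≤ 1 :=
          Real.rpow_le_one_of_one_le_of_nonpos (not_le.1 h1).le (by linarith)
        nlinarith [hu0 r]
    have he0 : 0 ≤ e (r - t) := (Real.exp_pos _).le
    calc (C * (1 + |r| ^ (-β))) ^ 2 * e (r - t)
        = C ^ 2 * ((1 + |r| ^ (-β)) ^ 2 * e (r - t)) := by ring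
      _ ≤ C ^ 2 * ((2 * (1 + r ^ (-(2 * β)))) * e (r - t)) := by gcongr
      _ = 2 * C ^ 2 * (e (r - t) + r ^ (-(2 * β)) * e (r - t)) := by ring
      _ ≤ 2 * C ^ 2 * (e (r - t) + (u r + e (r - t))) := by gcongr
      _ = _ := by ring
  refine ⟨2 * C ^ 2 * (2 * (∫ x, e x) + ∫ x, u x), hb, fun r => by positivity, by fun_prop,
    fun t => ?_⟩
  have hi : Integrable fun r => 2 * C ^ 2 * (2 * e (r - t) + u r) :=
    (((he.comp_sub_right t).const_mul 2).add hu).const_mul _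
  have hI : ∫ r, 2 * C ^ 2 * (2 * e (r - t) + u r) = 2 * C ^ 2 * (2 * (∫ x, e x) + ∫ x, u x) := by
    rw [integral_const_mul, integral_add ((he.comp_sub_right t).const_mul 2) hu,
      integral_const_mul, integral_sub_right_eq_self e t]
  rw [← hI, ofReal_integral_eq_lintegral_ofReal hi (Eventually.of_forall fun r => by
    have := hu0 r
    have : 0 ≤ e (r - t) := (Real.exp_pos _).le
    positivity)]
  refine le_trans ?_ (setLIntegral_le_lintegral (Ioi 0) _)
  exact setLIntegral_mono' measurableSet_Ioi fun r hr => ENNReal.ofReal_le_ofReal (hue r t hr)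

/-! ### Bounds of the solutions on the half line -/

theorem exists_norm_frobenius_le {α : ℝ} (h0 : 0 ≤ α) {k : ℂ} (hk : 0 < k.im) :
    ∃ C, ∀ r, 0 < r → ‖frobenius α ((k / 2) ^ 2) r‖ ≤ C * Real.exp (k.im * r) := by
  set q := (k / 2) ^ 2
  have s1 := isRadialSol_frobenius (ν := α) (α := α) (by linarith) rfl q
  have z1 : 4 * q = k ^ 2 := by
    simp only [q]
    ring
  rw [z1] at s1
  obtain ⟨C₁, h₁⟩ := s1.exists_norm_le_exp hk
  have hc : ContinuousOn (fun r : ℝ => besselSeries α (q * r ^ 2)) (Icc 0 1) := fun r _ =>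
    (hasDerivAt_besselSeries_comp (by simp; linarith) q r).continuousAt.continuousWithinAt
  obtain ⟨C₂, h₂⟩ := isCompact_Icc.exists_bound_of_continuousOn hc
  refine ⟨max C₁ C₂, fun r hr => ?_⟩
  rcases le_total 1 r with h | h
  · exact (h₁ r h).trans (by gcongr; exact le_max_left _ _)
  · have h3 := h₂ r ⟨hr.le, h⟩
    have h4 : ‖frobenius α q r‖ ≤ C₂ := by
      rw [frobenius, norm_mul, Complex.norm_real, Real.norm_of_nonneg (by positivity)]
      exact (mul_le_of_le_one_left (norm_nonneg _)
        (Real.rpow_le_one hr.le h (by linarith))).trans h3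
    refine h4.trans ((le_max_right C₁ C₂).trans (le_mul_of_one_le_right ?_ ?_))
    · exact ((norm_nonneg _).trans h4).trans (le_max_right _ _)
    · exact Real.one_le_exp (by positivity)

theorem exists_norm_macdonaldSol_le (α : ℝ) {p : ℂ} (hp : 0 < p.re) :
    ∃ C, ∀ r, 0 < r → ‖macdonaldSol α p r‖ ≤
      C * (1 + |r| ^ (-(max |α| (1 / 2) - 1 / 2))) * Real.exp (-p.re * r) := by
  set m := max |α| (1 / 2)
  obtain ⟨C₁, h₀, h₁⟩ := exists_sqrt_mul_norm_macdonald_le α hp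
  obtain ⟨C₂, h₂⟩ := exists_rpow_mul_norm_macdonald_le hp (α := α) (m := m)
    (lt_max_of_lt_right one_half_pos) (le_max_left _ _)
  refine ⟨max C₁ (C₂ * Real.exp p.re), fun r hr => ?_⟩
  have hw : 0 ≤ |r| ^ (-(m - 1 / 2)) := by positivity
  have hC : 0 ≤ max C₁ (C₂ * Real.exp p.re) := h₀.trans (le_max_left _ _)
  rw [norm_macdonaldSol hr]
  rcases le_total 1 r with h | h
  · refine (h₁ r h).trans ?_
    gcongr
    exact (le_max_left _ _).trans (le_mul_of_one_le_right hC (by linarith))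
  · have e : r ^ (1 / 2 : ℝ) = |r| ^ (-(m - 1 / 2)) * r ^ m := by
      rw [abs_of_pos hr, ← Real.rpow_add hr]
      congr 1
      ring
    have h3 := h₂ r hr
    have hC₂ : 0 ≤ C₂ := le_trans (by positivity) h3
    calc r ^ (1 / 2 : ℝ) * ‖macdonald α (p * r)‖
        = |r| ^ (-(m - 1 / 2)) * (r ^ m * ‖macdonald α (p * r)‖) := by rw [e, mul_assoc]
      _ ≤ (1 + |r| ^ (-(m - 1 / 2))) * (C₂ * (Real.exp p.re * Real.exp (-p.re * r))) := by
        refine mul_le_mul (by linarith) (h3.trans (le_mul_of_one_le_right hC₂ ?_)) (by positivity)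
          (by positivity)
        rw [← Real.exp_add]
        exact Real.one_le_exp (by nlinarith)
      _ = C₂ * Real.exp p.re * (1 + |r| ^ (-(m - 1 / 2))) * Real.exp (-p.re * r) := by ring
      _ ≤ _ := by
        gcongr
        exact le_max_right _ _

theorem exists_hasKernelBounds {α : ℝ} (h0 : 0 ≤ α) (h1 : α < 1) {k : ℂ} (hk : 0 < k.im)
    (a c d : ℂ) :
    ∃ C β M : ℝ, 0 ≤ β ∧ HasKernelBounds k.im M (fun r => C * (1 + |r| ^ (-β)))
      (fun r => a * frobenius α ((k / 2) ^ 2) r - d * macdonaldSol α (-Complex.I * k) r)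
      (fun r => c * macdonaldSol α (-Complex.I * k) r) := by
  have hp := re_neg_I_mul hk
  have hpk : (-Complex.I * k).re = k.im := by simp
  obtain ⟨C₁, H₁⟩ := exists_norm_frobenius_le h0 hk
  obtain ⟨C₂, H₂⟩ := exists_norm_macdonaldSol_le α hp
  rw [hpk] at H₂
  set β := max |α| (1 / 2) - 1 / 2
  have hβ : 0 ≤ β := sub_nonneg.2 (le_max_right _ _)
  have hβ2 : β < 1 / 2 := by
    have : max |α| (1 / 2) < 1 := max_lt (by rwa [abs_of_nonneg h0]) one_half_lt_one
    simp only [β]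
    linarith
  have s1 := isRadialSol_frobenius (ν := α) (α := α) (by linarith) rfl ((k / 2) ^ 2)
  have s2 := isRadialSol_macdonald α hp
  have hC₁ : 0 ≤ C₁ := nonneg_of_mul_nonneg_left
    ((norm_nonneg _).trans (H₁ 1 one_pos)) (Real.exp_pos _)
  have hC₂ : 0 ≤ C₂ := by
    have := nonneg_of_mul_nonneg_left ((norm_nonneg _).trans (H₂ 1 one_pos)) (Real.exp_pos _)
    exact nonneg_of_mul_nonneg_left this (by positivity)
  obtain ⟨M, hM⟩ := exists_isAdmissibleWeight (b := k.im) (C := ‖a‖ * C₁ + (‖d‖ + ‖c‖) * C₂)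
    hk (by positivity) hβ hβ2
  have c1 : ContinuousOn (frobenius α ((k / 2) ^ 2)) (Ioi 0) := fun r hr =>
    (s1.hasDerivAt r hr).continuousAt.continuousWithinAt
  have c2 : ContinuousOn (macdonaldSol α (-Complex.I * k)) (Ioi 0) := fun r hr =>
    (s2.hasDerivAt r hr).continuousAt.continuousWithinAt
  refine ⟨_, β, M, hβ, hM, (c1.const_smul a).sub (c2.const_smul d), c2.const_smul c, ?_, ?_⟩
  · intro r hr
    have hw : 0 ≤ |r| ^ (-β) := by positivity
    have he : Real.exp (-k.im * r) ≤ Real.exp (k.im * r) := Real.exp_le_exp.2 (by nlinarith)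
    calc ‖a * frobenius α ((k / 2) ^ 2) r - d * macdonaldSol α (-Complex.I * k) r‖
        ≤ ‖a‖ * ‖frobenius α ((k / 2) ^ 2) r‖ + ‖d‖ * ‖macdonaldSol α (-Complex.I * k) r‖ := by
          rw [← norm_mul, ← norm_mul]
          exact norm_sub_le _ _
      _ ≤ ‖a‖ * (C₁ * (1 + |r| ^ (-β)) * Real.exp (k.im * r)) +
          (‖d‖ + ‖c‖) * (C₂ * (1 + |r| ^ (-β)) * Real.exp (k.im * r)) := by
          gcongr
          · refine (H₁ r hr).trans ?_
            gcongr
            exact le_mul_of_one_le_right hC₁ (by linarith)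
          · exact le_add_of_nonneg_right (norm_nonneg _)
          · exact (H₂ r hr).trans (by gcongr)
      _ = _ := by ring
  · intro r hr
    have hw : 0 ≤ |r| ^ (-β) := by positivity
    calc ‖c * macdonaldSol α (-Complex.I * k) r‖
        ≤ ‖c‖ * (C₂ * (1 + |r| ^ (-β)) * Real.exp (-k.im * r)) := by
          rw [norm_mul]
          gcongr
          exact H₂ r hr
      _ = ‖c‖ * C₂ * (1 + |r| ^ (-β)) * Real.exp (-k.im * r) := by ring
      _ ≤ _ := by
          gcongr
          have := norm_nonneg a
          have := norm_nonneg d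
          nlinarith [mul_nonneg (norm_nonneg a) hC₁, mul_nonneg (norm_nonneg d) hC₂]

/-- A solution growing at most like `e^{br}`, whose Wronskian with a solution decaying like
`e^{-br}` does not vanish, is not square integrable, even after adding the decaying solution. -/
theorem IsFundamentalPair.left_eq_zero_of_memLp {α b B : ℝ} {z c : ℂ} {g g' h h' : ℝ → ℂ}
    (F : IsFundamentalPair α z c g g' h h') (hb : 0 < b)
    (hg : ∀ r, 1 ≤ r → ‖g r‖ ≤ B * Real.exp (b * r))
    (hh : ∀ r, 1 ≤ r → ‖h r‖ ≤ B * Real.exp (-b * r))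
    (hh' : ∀ r, 1 ≤ r → ‖h' r‖ ≤ B * Real.exp (-b * r)) (hL : MemLp h 2 halfLine) (c₁ c₂ : ℂ)
    (hm : MemLp (fun r => c₁ * g r + c₂ * h r) 2 halfLine) : c₁ = 0 := by
  by_contra hc
  have hB : 0 ≤ B := nonneg_of_mul_nonneg_left
    ((norm_nonneg _).trans (hg 1 le_rfl)) (Real.exp_pos _)
  have hgL : MemLp g 2 halfLine := by
    have := (hm.sub (hL.const_mul c₂)).const_mul c₁⁻¹
    refine (memLp_congr_ae (Eventually.of_forall fun r => ?_)).1 this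
    simp only [Pi.sub_apply]
    field_simp
    ring
  have hφ : IntegrableOn (fun r => B * (‖g r‖ ^ 2 + Real.exp (-(2 * b) * r))) (Ioi 1) := by
    have h1 : Integrable (fun r => ‖g r‖ ^ 2) halfLine := hgL.integrable_norm_pow two_ne_zero
    have h2 : IntegrableOn (fun r => ‖g r‖ ^ 2) (Ioi 1) :=
      IntegrableOn.mono_set h1 (Ioi_subset_Ioi zero_le_one)
    exact (h2.add (exp_neg_integrableOn_Ioi 1 (by positivity))).const_mul B
  set N := ∫ r in Ioi 1, B * (‖g r‖ ^ 2 + Real.exp (-(2 * b) * r))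
  have hle : ∀ r, 1 ≤ r → ‖g r * h' r‖ ≤ B * (‖g r‖ ^ 2 + Real.exp (-(2 * b) * r)) := by
    intro r hr
    have e : Real.exp (-(2 * b) * r) = Real.exp (-b * r) ^ 2 := by
      rw [← Real.exp_nat_mul]
      congr 1
      push_cast
      ring
    rw [norm_mul, e]
    refine (mul_le_mul_of_nonneg_left (hh' r hr) (norm_nonneg _)).trans ?_
    have : ‖g r‖ * Real.exp (-b * r) ≤ ‖g r‖ ^ 2 + Real.exp (-b * r) ^ 2 := by
      nlinarith [sq_nonneg (‖g r‖ - Real.exp (-b * r)), sq_nonneg ‖g r‖,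
        sq_nonneg (Real.exp (-b * r))]
    nlinarith
  have hbd : ∀ r, 1 ≤ r → ‖g r * h r‖ ≤ B * B := by
    intro r hr
    rw [norm_mul]
    calc ‖g r‖ * ‖h r‖ ≤ B * Real.exp (b * r) * (B * Real.exp (-b * r)) :=
          mul_le_mul (hg r hr) (hh r hr) (norm_nonneg _) (by positivity)
      _ = B * B * (Real.exp (b * r) * Real.exp (-b * r)) := by ring
      _ = B * B := by rw [← Real.exp_add, neg_mul, add_neg_cancel, Real.exp_zero, mul_one]
  have key : ∀ R, 1 ≤ R → ‖c‖ * (R - 1) ≤ 2 * N + 2 * (B * B) := by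
    intro R hR
    have hsub : uIcc 1 R ⊆ Ioi 0 := by
      rw [uIcc_of_le hR]
      exact fun x hx => zero_lt_one.trans_le hx.1
    have hc1 : ContinuousOn (fun r => g r * h' r) (uIcc 1 R) :=
      (F.cont₁.mul F.cont₂').mono hsub
    have hd : ∀ r ∈ uIcc 1 R, HasDerivAt (fun r => g r * h r) (2 * (g r * h' r) - c) r := by
      intro r hr
      have h0 := hsub hr
      convert! (F.deriv₁ r h0).mul (F.deriv₂ r h0) using 1
      rw [← F.wronskian_eq r h0]
      ring
    have hF := intervalIntegral.integral_eq_sub_of_hasDerivAt hd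
      ((hc1.const_smul (2 : ℂ)).sub continuousOn_const).intervalIntegrable
    have hi : IntervalIntegrable (fun r => 2 * (g r * h' r)) volume 1 R :=
      (hc1.const_smul (2 : ℂ)).intervalIntegrable
    rw [intervalIntegral.integral_sub hi intervalIntegrable_const,
      intervalIntegral.integral_const_mul, intervalIntegral.integral_const] at hF
    have hI : ‖∫ r in (1 : ℝ)..R, g r * h' r‖ ≤ N := by
      rw [intervalIntegral.integral_of_le hR]
      refine (norm_integral_le_of_norm_le (hφ.mono_set Ioc_subset_Ioi_self)
        ((ae_restrict_mem measurableSet_Ioc).mono fun r hr => hle r hr.1.le)).trans ?_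
      exact setIntegral_mono_set hφ (Eventually.of_forall fun r => by positivity)
        (Eventually.of_forall Ioc_subset_Ioi_self)
    have e : (R - 1) • c = 2 * (∫ r in (1 : ℝ)..R, g r * h' r) - (g R * h R - g 1 * h 1) := by
      rw [← hF]
      ring
    have e2 := congrArg norm e
    rw [norm_smul, Real.norm_of_nonneg (sub_nonneg.2 hR)] at e2
    rw [mul_comm, e2]
    refine (norm_sub_le _ _).trans (add_le_add ?_ ((norm_sub_le _ _).trans ?_))
    · rw [norm_mul, Complex.norm_ofNat]
      gcongr
    · linarith [hbd R hR, hbd 1 le_rfl]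
  have hcn : 0 < ‖c‖ := norm_pos_iff.2 F.ne_zero
  have hN : 0 ≤ 2 * N + 2 * (B * B) := by simpa using key 1 le_rfl
  have := key (1 + (2 * N + 2 * (B * B) + 1) / ‖c‖) (le_add_of_nonneg_right (by positivity))
  rw [add_sub_cancel_left, mul_div_cancel₀ _ hcn.ne'] at this
  linarith

/-! ### The boundary form of the solutions -/

theorem rpow_wronskian_frobenius (ν α : ℝ) (q : ℂ) {r : ℝ} (hr : 0 < r) :
    ((r ^ (1 / 2 + ν) : ℝ) : ℂ) * frobeniusDeriv α q r -
      (1 / 2 + ν) * ((r ^ (ν - 1 / 2) : ℝ) : ℂ) * frobenius α q r =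
      ((r ^ (ν + α) : ℝ) : ℂ) * ((α - ν) * besselSeries α (q * r ^ 2) -
        2 * q * r ^ 2 * besselSeries (α + 1) (q * r ^ 2)) := by
  have h1 : ((r ^ (1 / 2 + ν) : ℝ) : ℂ) * ((r ^ (α - 1 / 2) : ℝ) : ℂ) =
      ((r ^ (ν + α) : ℝ) : ℂ) := by
    rw [← ofReal_rpow_add hr]
    congr 2
    ring
  have h2 : ((r ^ (ν - 1 / 2) : ℝ) : ℂ) * ((r ^ (1 / 2 + α) : ℝ) : ℂ) =
      ((r ^ (ν + α) : ℝ) : ℂ) := by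
    rw [← ofReal_rpow_add hr]
    congr 2
    ring
  rw [frobenius, frobeniusDeriv]
  linear_combination ((1 / 2 + α) * besselSeries α (q * r ^ 2) -
    2 * q * r ^ 2 * besselSeries (α + 1) (q * r ^ 2)) * h1 -
      (1 / 2 + ν) * besselSeries α (q * r ^ 2) * h2

theorem rpow_wronskian_macdonald (ν α : ℝ) (p : ℂ) {r : ℝ} (hr : 0 < r) :
    ((r ^ (1 / 2 + ν) : ℝ) : ℂ) * macdonaldSolDeriv α p r -
      (1 / 2 + ν) * ((r ^ (ν - 1 / 2) : ℝ) : ℂ) * macdonaldSol α p r =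
      ((r ^ ν : ℝ) : ℂ) * (-((α + ν) * macdonald α (p * r)) -
        p * r * macdonald (1 - α) (p * r)) := by
  have h1 : ((r ^ (1 / 2 + ν) : ℝ) : ℂ) * ((r ^ (1 / 2 - 1 : ℝ) : ℝ) : ℂ) = ((r ^ ν : ℝ) : ℂ) := by
    rw [← ofReal_rpow_add hr]
    congr 2
    ring
  have h2 : ((r ^ (ν - 1 / 2) : ℝ) : ℂ) * ((r ^ (1 / 2 : ℝ) : ℝ) : ℂ) = ((r ^ ν : ℝ) : ℂ) := by
    rw [← ofReal_rpow_add hr]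
    congr 2
    ring
  rw [macdonaldSol, macdonaldSolDeriv]
  linear_combination
    ((1 / 2 - α) * macdonald α (p * r) - p * r * macdonald (1 - α) (p * r)) * h1 -
      (1 / 2 + ν) * macdonald α (p * r) * h2

theorem boundaryFun_of_pos {α : ℝ} (h0 : 0 < α) (s : ℝ) (r : ℝ) :
    boundaryFun α s r = 1 / (2 * α) * (((r ^ (1 / 2 + -α) : ℝ) : ℂ) +
      (2 * s * α - 1) * ((r ^ (1 / 2 + α) : ℝ) : ℂ)) := by
  have ha : (α : ℂ) ≠ 0 := by exact_mod_cast h0.ne'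
  rw [boundaryFun, irregularSol, regularSol, if_neg h0.ne', ← sub_eq_add_neg]
  push_cast
  field_simp
  ring

theorem hasDerivAt_ofReal_rpow (c : ℝ) {r : ℝ} (hr : 0 < r) :
    HasDerivAt (fun r : ℝ => ((r ^ c : ℝ) : ℂ)) (c * ((r ^ (c - 1) : ℝ) : ℂ)) r := by
  convert! (Real.hasDerivAt_rpow_const (p := c) (Or.inl hr.ne')).ofReal_comp using 1
  push_cast
  rfl

theorem deriv_boundaryFun_of_pos {α : ℝ} (h0 : 0 < α) (s : ℝ) {r : ℝ} (hr : 0 < r) :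
    deriv (boundaryFun α s) r = 1 / (2 * α) * ((1 / 2 + -α) * ((r ^ (-α - 1 / 2) : ℝ) : ℂ) +
      (2 * s * α - 1) * ((1 / 2 + α) * ((r ^ (α - 1 / 2) : ℝ) : ℂ))) := by
  have h := (((hasDerivAt_ofReal_rpow (1 / 2 + -α) hr).add
    ((hasDerivAt_ofReal_rpow (1 / 2 + α) hr).const_mul (2 * s * α - 1 : ℂ))).const_mul
      (1 / (2 * α) : ℂ))
  rw [show boundaryFun α s = _ from funext (boundaryFun_of_pos h0 s)]
  refine h.deriv.trans ?_
  rw [show 1 / 2 + -α - 1 = -α - 1 / 2 by ring, show 1 / 2 + α - 1 = α - 1 / 2 by ring]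
  push_cast
  rfl

theorem boundaryFun_zero (s r : ℝ) :
    boundaryFun 0 s r = ((r ^ (1 / 2 : ℝ) : ℝ) : ℂ) * (s - Real.log r) := by
  rw [boundaryFun, irregularSol, regularSol, if_pos rfl, Real.sqrt_eq_rpow, add_zero]
  push_cast
  ring

theorem deriv_boundaryFun_zero (s : ℝ) {r : ℝ} (hr : 0 < r) :
    deriv (boundaryFun 0 s) r =
      ((r ^ (1 / 2 - 1 : ℝ) : ℝ) : ℂ) * (1 / 2 * (s - Real.log r) - 1) := by
  have hl : HasDerivAt (fun r : ℝ => (s : ℂ) - Real.log r) (-(r⁻¹ : ℝ)) r := by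
    convert! ((Real.hasDerivAt_log hr.ne').ofReal_comp).const_sub (s : ℂ) using 1
  have hrc : (r : ℂ) ≠ 0 := by exact_mod_cast hr.ne'
  rw [show boundaryFun 0 s = _ from funext (boundaryFun_zero s),
    (hasDerivAt_rpow_mul (1 / 2) hr hl).deriv]
  push_cast
  field_simp
  ring

theorem tendsto_boundary_frobenius {α : ℝ} (h0 : 0 ≤ α) (s : ℝ) (q : ℂ) :
    Tendsto (fun r => boundaryFun α s r * frobeniusDeriv α q r -
      deriv (boundaryFun α s) r * frobenius α q r) (𝓝[>] 0) (𝓝 (Complex.Gamma (1 + α))⁻¹) := by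
  have hA := tendsto_besselSeries_zero (ν := α) (by linarith) q
  have hB := tendsto_besselSeries_zero (ν := α + 1) (by linarith) q
  rcases h0.eq_or_lt with rfl | h0
  · have hr : Tendsto (fun r : ℝ => ((r ^ (2 : ℝ) : ℝ) : ℂ) * (s - Real.log r)) (𝓝[>] 0)
        (𝓝 0) := by
      have h1 := tendsto_log_mul_rpow_nhdsGT_zero (two_pos (α := ℝ))
      have h2 := (Complex.continuous_ofReal.tendsto 0).comp h1
      have h3 := ((tendsto_ofReal_rpow_zero (two_pos (α := ℝ))).mul_const (s : ℂ)).sub h2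
      rw [Complex.ofReal_zero, zero_mul, sub_zero] at h3
      refine h3.congr fun r => ?_
      simp only [Function.comp]
      push_cast
      ring
    have h := hA.sub ((hr.mul hB).const_mul (2 * q))
    simp only [zero_mul, mul_zero, sub_zero] at h
    rw [add_comm (1 : ℂ)]
    refine h.congr' ?_
    filter_upwards [self_mem_nhdsWithin] with r hr
    have hr : 0 < r := hr
    have e1 : ((r ^ (1 / 2 : ℝ) : ℝ) : ℂ) * ((r ^ (1 / 2 - 1 : ℝ) : ℝ) : ℂ) = 1 := by
      rw [← ofReal_rpow_add hr]
      norm_num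
    rw [boundaryFun_zero, deriv_boundaryFun_zero s hr, frobenius, frobeniusDeriv, Real.rpow_two,
      add_zero, show (0 : ℝ) - 1 / 2 = 1 / 2 - 1 by norm_num]
    push_cast
    linear_combination (-(s - Real.log r) * (1 / 2 * besselSeries 0 (q * r ^ 2) -
      2 * q * r ^ 2 * besselSeries (0 + 1) (q * r ^ 2)) +
      (1 / 2 * (s - Real.log r) - 1) * besselSeries 0 (q * r ^ 2)) * e1
  · have h2 := tendsto_ofReal_rpow_zero (two_pos (α := ℝ))
    have h2a := tendsto_ofReal_rpow_zero (mul_pos two_pos h0)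
    have hL := (hA.const_mul (2 * α : ℂ)).sub ((h2.mul hB).const_mul (2 * q))
    have hR := (h2a.mul ((h2.mul hB).const_mul (-(2 * q)))).const_mul (2 * s * α - 1 : ℂ)
    have h := (hL.add hR).const_mul (1 / (2 * α) : ℂ)
    have ha : (α : ℂ) ≠ 0 := by exact_mod_cast h0.ne'
    have e : 1 / (2 * α : ℂ) * (2 * α * (Complex.Gamma (α + 1))⁻¹ -
        2 * q * (0 * (Complex.Gamma (((α + 1 : ℝ) : ℂ) + 1))⁻¹) + (2 * s * α - 1) *
          (0 * (-(2 * q) * (0 * (Complex.Gamma (((α + 1 : ℝ) : ℂ) + 1))⁻¹)))) =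
        (Complex.Gamma (1 + α))⁻¹ := by
      rw [add_comm (1 : ℂ)]
      simp only [zero_mul, mul_zero, sub_zero, add_zero]
      field_simp
    rw [e] at h
    refine h.congr' ?_
    filter_upwards [self_mem_nhdsWithin] with r hr
    have hr : 0 < r := hr
    have e1 := rpow_wronskian_frobenius (-α) α q hr
    have e2 := rpow_wronskian_frobenius α α q hr
    rw [neg_add_cancel, Real.rpow_zero] at e1
    rw [← two_mul α] at e2
    rw [boundaryFun_of_pos h0, deriv_boundaryFun_of_pos h0 s hr, Real.rpow_two]
    push_cast at e1 e2 ⊢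
    linear_combination (-1 / (2 * α : ℂ)) * e1 - 1 / (2 * α : ℂ) * (2 * s * α - 1) * e2

/-- The boundary form of `macdonaldSol` in terms of `deltaBracket`. -/
theorem tendsto_boundary_macdonald {α : ℝ} (h0 : 0 ≤ α) (h1 : α < 1) (s : ℝ) {k : ℂ}
    (hk : 0 < k.im) :
    Tendsto (fun r => boundaryFun α s r * macdonaldSolDeriv α (-Complex.I * k) r -
      deriv (boundaryFun α s) r * macdonaldSol α (-Complex.I * k) r) (𝓝[>] 0)
      (𝓝 (-(Real.pi * Complex.exp (Real.pi / 2 * Complex.I * α) * (k / 2) ^ (α : ℂ) *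
        (Complex.Gamma (1 + α))⁻¹ * deltaBracket k α s))) := by
  have hp := re_neg_I_mul hk
  have hk0 : k ≠ 0 := fun h => by simp [h] at hk
  have hk2 : k / 2 ≠ 0 := div_ne_zero hk0 two_ne_zero
  have hpi : (Real.pi : ℂ) ≠ 0 := by exact_mod_cast Real.pi_ne_zero
  set p := -Complex.I * k with hpdef
  have hp0 : p ≠ 0 := fun h => by simp [h] at hp
  have hY := tendsto_rpow_mul_macdonald_one_sub hp h1
  rcases h0.eq_or_lt with rfl | h0
  · have h := (tendsto_macdonald_zero hp).sub (hY.const_mul (s * p))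
    have e : -2 * (Complex.log (p / 2) + Real.eulerMascheroniConstant) -
        s * p * ((p / 2) ^ (((0 : ℝ) : ℂ) - 1) * Complex.Gamma (1 - ((0 : ℝ) : ℂ))) =
        -(Real.pi * Complex.exp (Real.pi / 2 * Complex.I * (0 : ℝ)) *
          (k / 2) ^ (((0 : ℝ) : ℂ)) * (Complex.Gamma (1 + ((0 : ℝ) : ℂ)))⁻¹ *
            deltaBracket k 0 s) := by
      have : k / (2 * Complex.I) = p / 2 := by
        rw [hpdef]
        field_simp
        linear_combination Complex.I_sq
      rw [deltaBracket, if_pos rfl, this]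
      simp [Complex.cpow_neg_one]
      field_simp
      ring
    rw [e] at h
    refine h.congr' ?_
    filter_upwards [self_mem_nhdsWithin] with r hr
    have hr : 0 < r := hr
    have e1 : ((r ^ (1 / 2 : ℝ) : ℝ) : ℂ) * ((r ^ (1 / 2 - 1 : ℝ) : ℝ) : ℂ) = 1 := by
      rw [← ofReal_rpow_add hr]
      norm_num
    rw [boundaryFun_zero, deriv_boundaryFun_zero s hr, macdonaldSol, macdonaldSolDeriv, sub_zero,
      Real.rpow_one]
    push_cast
    linear_combination (-(s - Real.log r) * (1 / 2 * macdonald 0 (p * r) -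
      p * r * macdonald 1 (p * r)) +
      (1 / 2 * (s - Real.log r) - 1) * macdonald 0 (p * r)) * e1
  · have hX := tendsto_rpow_mul_macdonald hp h0
    have h2a := tendsto_ofReal_rpow_zero (mul_pos two_pos h0)
    have h := ((hY.const_mul (-p)).add ((((hX.const_mul (-(2 * α) : ℂ)).sub
      ((h2a.mul hY).const_mul p))).const_mul (2 * s * α - 1 : ℂ))).const_mul (1 / (2 * α) : ℂ)
    have ha : (α : ℂ) ≠ 0 := by exact_mod_cast h0.ne'
    have e : 1 / (2 * α : ℂ) * (-p * ((p / 2) ^ ((α : ℂ) - 1) * Complex.Gamma (1 - α)) +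
        (2 * s * α - 1) * (-(2 * α) * ((p / 2) ^ (-α : ℂ) * Complex.Gamma α) -
          p * (0 * ((p / 2) ^ ((α : ℂ) - 1) * Complex.Gamma (1 - α))))) =
        -(Real.pi * Complex.exp (Real.pi / 2 * Complex.I * α) * (k / 2) ^ (α : ℂ) *
          (Complex.Gamma (1 + α))⁻¹ * deltaBracket k α s) := by
      have hG := Complex.Gamma_mul_Gamma_one_sub α
      have hs : Complex.sin (Real.pi * α) ≠ 0 := by
        have := Real.sin_pos_of_pos_of_lt_pi (mul_pos Real.pi_pos h0)
          (by nlinarith [Real.pi_pos])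
        exact_mod_cast this.ne'
      have hGa : Complex.Gamma α ≠ 0 := Complex.Gamma_ne_zero_of_re_pos (by simpa using h0)
      have hGb : Complex.Gamma (1 - α) ≠ 0 := Complex.Gamma_ne_zero_of_re_pos (by simpa using h1)
      rw [eq_div_iff hs] at hG
      have e2 : Complex.exp (-(Real.pi / 2 * Complex.I * α)) =
          Complex.exp (Real.pi / 2 * Complex.I * α) *
            (Complex.cos (Real.pi * α) - Complex.I * Complex.sin (Real.pi * α)) := by
        have := Complex.exp_mul_I (-(Real.pi * α : ℂ))
        rw [Complex.cos_neg, Complex.sin_neg] at this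
        rw [show Complex.cos (Real.pi * α) - Complex.I * Complex.sin (Real.pi * α) =
          Complex.cos (Real.pi * α) + -Complex.sin (Real.pi * α) * Complex.I by ring, ← this,
          ← Complex.exp_add]
        congr 1
        ring
      have e3 : (k / 2) ^ (-2 * α : ℂ) = (k / 2) ^ (-α : ℂ) * (k / 2) ^ (-α : ℂ) := by
        rw [← Complex.cpow_add _ _ hk2]
        congr 1
        ring
      have e4 : (k / 2) ^ (α : ℂ) * (k / 2) ^ (-α : ℂ) = 1 := by
        rw [← Complex.cpow_add _ _ hk2, add_neg_cancel, Complex.cpow_zero]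
      rw [deltaBracket, if_neg h0.ne', Complex.cpow_sub _ _ (div_ne_zero hp0 two_ne_zero),
        Complex.cpow_one, cpow_neg_I_mul_div_two hk, cpow_neg_I_mul_div_two hk, e3,
        show -(Real.pi / 2 * Complex.I * -α : ℂ) = Real.pi / 2 * Complex.I * α by ring, e2,
        add_comm (1 : ℂ), Complex.Gamma_add_one _ ha, Complex.cot_eq_cos_div_sin]
      generalize Complex.exp (Real.pi / 2 * Complex.I * α) = E at *
      generalize Complex.sin (Real.pi * α) = S at *
      generalize Complex.cos (Real.pi * α) = C at *
      generalize Complex.Gamma (1 - α) = G at *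
      generalize Complex.Gamma α = G' at *
      generalize (k / 2) ^ (α : ℂ) = x at *
      generalize (k / 2) ^ (-α : ℂ) = y at *
      rw [← hG]
      field_simp
      linear_combination E * α * (2 * α * s - 1) * y * G' * e4
    rw [e] at h
    refine h.congr' ?_
    filter_upwards [self_mem_nhdsWithin] with r hr
    have hr : 0 < r := hr
    have e1 := rpow_wronskian_macdonald (-α) α p hr
    have e2 := rpow_wronskian_macdonald α α p hr
    have e3 : ((r ^ (1 - α) : ℝ) : ℂ) = ((r ^ (-α) : ℝ) : ℂ) * r := by
      rw [show 1 - α = -α + 1 by ring, ofReal_rpow_add hr, Real.rpow_one]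
    have e4 : ((r ^ (2 * α) : ℝ) : ℂ) * ((r ^ (1 - α) : ℝ) : ℂ) = ((r ^ α : ℝ) : ℂ) * r := by
      rw [← ofReal_rpow_add hr, show 2 * α + (1 - α) = α + 1 by ring, ofReal_rpow_add hr,
        Real.rpow_one]
    rw [boundaryFun_of_pos h0, deriv_boundaryFun_of_pos h0 s hr]
    push_cast at e1 e2 ⊢
    linear_combination (-1 / (2 * α : ℂ)) * e1 - 1 / (2 * α : ℂ) * (2 * s * α - 1) * e2 -
      1 / (2 * α : ℂ) * p * macdonald (1 - α) (p * r) * e3 -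
      1 / (2 * α : ℂ) * (2 * s * α - 1) * p * macdonald (1 - α) (p * r) * e4

/-! ### The resolvent -/

theorem IsRadialSol.isStrongSol {α : ℝ} {z : ℂ} {f f' : ℝ → ℂ} (h : IsRadialSol α z f f') :
    IsStrongSol α z 0 f f' where
  hasDerivAt := h.hasDerivAt
  locallyAC := LocallyAC.of_hasDerivAt h.hasDerivAt'
    (((continuousOn_radialPot α).sub continuousOn_const).mul fun r hr =>
      (h.hasDerivAt r hr).continuousAt.continuousWithinAt)
  ae_hasDerivAt := by
    filter_upwards [ae_restrict_mem measurableSet_Ioi] with r hr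
    simpa using h.hasDerivAt' r hr

/-- The coefficient `c` with `√r H_α^{(1)}(k r) = c · 2 √r K_α(-i k r)`. -/
noncomputable def hankelCoeff (α : ℝ) : ℂ :=
  (Real.pi * Complex.I * Complex.exp (Real.pi / 2 * Complex.I * α))⁻¹

/-- The coefficient `c` with `(iπ/2) √r J_α(k r) = c r^{1/2 + α} (1 / Γ(1 + α) + …)`. -/
noncomputable def besselCoeffAt (k : ℂ) (α : ℝ) : ℂ :=
  Complex.I * Real.pi / 2 * (k / 2) ^ (α : ℂ)

section Main

variable {α s : ℝ} {k : ℂ}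

theorem sqrt_mul_hankelH1 (h0 : 0 ≤ α) (h1 : α < 1) (hk : 0 < k.im) {r : ℝ} (hr : 0 < r) :
    hankelCoeff α * macdonaldSol α (-Complex.I * k) r = (√r : ℂ) * hankelH1 α (k * r) := by
  have hpi : (Real.pi : ℂ) ≠ 0 := by exact_mod_cast Real.pi_ne_zero
  rw [macdonaldSol, macdonald_eq_hankelH1 hk h0 h1 hr, hankelCoeff, Real.sqrt_eq_rpow]
  have := Complex.exp_ne_zero (Real.pi / 2 * Complex.I * α)
  have := Complex.I_ne_zero
  field_simp

theorem besselCoeffAt_mul_frobenius (hk : k ≠ 0) {r : ℝ} (hr : 0 < r) :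
    besselCoeffAt k α * frobenius α ((k / 2) ^ 2) r =
      Complex.I * Real.pi / 2 * ((√r : ℂ) * besselJ α (k * r)) := by
  rw [besselCoeffAt, mul_assoc, ← sqrt_mul_besselJ α hk hr, Real.sqrt_eq_rpow]

theorem deltaKernel_eq_greenKernel (s : ℝ) (h0 : 0 ≤ α) (h1 : α < 1) (hk : 0 < k.im) {r t : ℝ}
    (hr : 0 < r) (ht : 0 < t) :
    deltaKernel k α s r t = greenKernel
      (fun r => besselCoeffAt k α * frobenius α ((k / 2) ^ 2) r -
        deltaA k α s * hankelCoeff α * macdonaldSol α (-Complex.I * k) r)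
      (fun r => hankelCoeff α * macdonaldSol α (-Complex.I * k) r) r t := by
  have hk0 : k ≠ 0 := fun h => by simp [h] at hk
  have hmin : 0 < min r t := lt_min hr ht
  have hmax : 0 < max r t := lt_max_of_lt_left hr
  simp only [greenKernel]
  rw [mul_assoc (deltaA k α s), sqrt_mul_hankelH1 h0 h1 hk hmin, sqrt_mul_hankelH1 h0 h1 hk hmax,
    besselCoeffAt_mul_frobenius hk0 hmin, deltaKernel, Real.sqrt_mul hr.le]
  push_cast
  rcases le_total r t with h | h
  · rw [min_eq_left h, max_eq_right h]
    ring
  · rw [min_eq_right h, max_eq_left h]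
    ring

theorem isFundamentalPair_delta (s : ℝ) (h0 : 0 ≤ α) (h1 : α < 1) (hk : 0 < k.im) :
    IsFundamentalPair α (k ^ 2) (-1)
      (fun r => besselCoeffAt k α * frobenius α ((k / 2) ^ 2) r -
        deltaA k α s * hankelCoeff α * macdonaldSol α (-Complex.I * k) r)
      (fun r => besselCoeffAt k α * frobeniusDeriv α ((k / 2) ^ 2) r -
        deltaA k α s * hankelCoeff α * macdonaldSolDeriv α (-Complex.I * k) r)
      (fun r => hankelCoeff α * macdonaldSol α (-Complex.I * k) r)
      (fun r => hankelCoeff α * macdonaldSolDeriv α (-Complex.I * k) r) := by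
  have hk0 : k ≠ 0 := fun h => by simp [h] at hk
  have hp := re_neg_I_mul hk
  have s1 := isRadialSol_frobenius (ν := α) (α := α) (by linarith) rfl ((k / 2) ^ 2)
  have s2 := isRadialSol_macdonald α hp
  have z1 : 4 * (k / 2) ^ 2 = k ^ 2 := by ring
  have z2 : -(-Complex.I * k) ^ 2 = k ^ 2 := by
    linear_combination (-k ^ 2) * Complex.I_sq
  rw [z1] at s1
  rw [z2] at s2
  have sg := (s1.const_mul (besselCoeffAt k α)).sub (s2.const_mul (deltaA k α s * hankelCoeff α))
  have sh := s2.const_mul (hankelCoeff α)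
  refine ⟨sg.hasDerivAt, sg.hasDerivAt', sh.hasDerivAt, sh.hasDerivAt', fun r hr => ?_, by simp⟩
  have w := s1.wronskian_eq_of_tendsto s2 (tendsto_wronskian_regular hp h0 h1) hr
  have e : besselCoeffAt k α * hankelCoeff α * (-2 * (-Complex.I * k / 2) ^ (-α : ℂ)) = -1 := by
    have hpi : (Real.pi : ℂ) ≠ 0 := by exact_mod_cast Real.pi_ne_zero
    have e4 : (k / 2) ^ (α : ℂ) * (k / 2) ^ (-α : ℂ) = 1 := by
      rw [← Complex.cpow_add _ _ (div_ne_zero hk0 two_ne_zero), add_neg_cancel, Complex.cpow_zero]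
    rw [cpow_neg_I_mul_div_two hk, besselCoeffAt, hankelCoeff,
      show -(Real.pi / 2 * Complex.I * -α : ℂ) = Real.pi / 2 * Complex.I * α by ring]
    have := Complex.exp_ne_zero (Real.pi / 2 * Complex.I * α)
    have := Complex.I_ne_zero
    field_simp
    linear_combination -e4
  rw [← e, ← w]
  ring

/-- The boundary form of `√r H_α^{(1)}(k r)`. -/
theorem tendsto_boundary_hankel (s : ℝ) (h0 : 0 ≤ α) (h1 : α < 1) (hk : 0 < k.im) :
    Tendsto (fun r => boundaryFun α s r * (hankelCoeff α * macdonaldSolDeriv α (-Complex.I * k) r) -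
      deriv (boundaryFun α s) r * (hankelCoeff α * macdonaldSol α (-Complex.I * k) r)) (𝓝[>] 0)
      (𝓝 (Complex.I * (k / 2) ^ (α : ℂ) * (Complex.Gamma (1 + α))⁻¹ * deltaBracket k α s)) := by
  have h := (tendsto_boundary_macdonald h0 h1 s hk).const_mul (hankelCoeff α)
  have e : hankelCoeff α * -(Real.pi * Complex.exp (Real.pi / 2 * Complex.I * α) *
      (k / 2) ^ (α : ℂ) * (Complex.Gamma (1 + α))⁻¹ * deltaBracket k α s) =
      Complex.I * (k / 2) ^ (α : ℂ) * (Complex.Gamma (1 + α))⁻¹ * deltaBracket k α s := by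
    have hpi : (Real.pi : ℂ) ≠ 0 := by exact_mod_cast Real.pi_ne_zero
    rw [hankelCoeff]
    have := Complex.exp_ne_zero (Real.pi / 2 * Complex.I * α)
    rw [mul_inv, mul_inv, Complex.inv_I]
    field_simp
  rw [e] at h
  refine h.congr fun r => ?_
  ring

theorem tendsto_boundary_left (h0 : 0 ≤ α) (h1 : α < 1) (hk : 0 < k.im)
    (hD : deltaBracket k α s ≠ 0) :
    Tendsto (fun r => boundaryFun α s r * (besselCoeffAt k α * frobeniusDeriv α ((k / 2) ^ 2) r -
        deltaA k α s * hankelCoeff α * macdonaldSolDeriv α (-Complex.I * k) r) -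
      deriv (boundaryFun α s) r * (besselCoeffAt k α * frobenius α ((k / 2) ^ 2) r -
        deltaA k α s * hankelCoeff α * macdonaldSol α (-Complex.I * k) r)) (𝓝[>] 0) (𝓝 0) := by
  have h := ((tendsto_boundary_frobenius h0 s ((k / 2) ^ 2)).const_mul (besselCoeffAt k α)).sub
    ((tendsto_boundary_hankel s h0 h1 hk).const_mul (deltaA k α s))
  have e : besselCoeffAt k α * (Complex.Gamma (1 + α))⁻¹ - deltaA k α s *
      (Complex.I * (k / 2) ^ (α : ℂ) * (Complex.Gamma (1 + α))⁻¹ * deltaBracket k α s) = 0 := by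
    rw [besselCoeffAt, deltaA]
    field_simp
    ring
  rw [e] at h
  refine h.congr fun r => ?_
  ring

theorem macdonaldSol_ne_zero (h0 : 0 ≤ α) (h1 : α < 1) (hk : 0 < k.im) :
    ∃ r, 0 < r ∧ hankelCoeff α * macdonaldSol α (-Complex.I * k) r ≠ 0 := by
  by_contra! h
  have F := isFundamentalPair_delta 0 h0 h1 hk
  have hd : hankelCoeff α * macdonaldSolDeriv α (-Complex.I * k) 1 = 0 :=
    (F.deriv₂ 1 one_pos).unique ((hasDerivAt_const (1 : ℝ) (0 : ℂ)).congr_of_eventuallyEq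
      ((lt_mem_nhds one_pos).mono fun r hr => h r hr))
  have := F.wronskian_eq 1 one_pos
  simp only [hd, h 1 one_pos, mul_zero, sub_zero] at this
  simp at this

/-- When `deltaBracket` does not vanish, the kernel `deltaKernel` defines the resolvent. -/
theorem exists_isResolventAt (h0 : 0 ≤ α) (h1 : α < 1) (hk : 0 < k.im)
    (hD : deltaBracket k α s ≠ 0) :
    ∃ R : L2HalfLine →L[ℂ] L2HalfLine, IsResolventAt (deltaHamiltonian α s) (k ^ 2) R ∧
      HasIntegralKernel R (deltaKernel k α s) := by
  have hk0 : k ≠ 0 := fun h => by simp [h] at hk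
  have F := isFundamentalPair_delta s h0 h1 hk
  obtain ⟨C, β, M, hβ, H⟩ := exists_hasKernelBounds h0 h1 hk (besselCoeffAt k α) (hankelCoeff α)
    (deltaA k α s * hankelCoeff α)
  obtain ⟨C', hC'⟩ := exists_norm_macdonaldSolDeriv_le α (re_neg_I_mul hk)
  have hpk : (-Complex.I * k).re = k.im := by simp
  rw [hpk] at hC'
  have hC : 0 ≤ C := nonneg_of_mul_nonneg_left (H.nonneg 1) (by positivity)
  have hw : ∀ r : ℝ, 1 ≤ r → C * (1 + |r| ^ (-β)) ≤ max (C * 2) (‖hankelCoeff α‖ * C') := by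
    intro r hr
    refine le_trans ?_ (le_max_left _ _)
    have : |r| ^ (-β) ≤ 1 := Real.rpow_le_one_of_one_le_of_nonpos
      (hr.trans (le_abs_self r)) (neg_nonpos.2 hβ)
    gcongr
    linarith
  refine ⟨H.toCLM, F.isResolventAt H (F.left_eq_zero_of_memLp hk
    (B := max (C * 2) (‖hankelCoeff α‖ * C')) ?_ ?_ ?_ H.memLp_right)
    (tendsto_boundary_left h0 h1 hk hD) (tendsto_boundary_hankel s h0 h1 hk) ?_,
    H.hasIntegralKernel fun r t hr ht => deltaKernel_eq_greenKernel s h0 h1 hk hr ht⟩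
  · exact fun r hr => (H.bound_left r (one_pos.trans_le hr)).trans
      (mul_le_mul_of_nonneg_right (hw r hr) (Real.exp_pos _).le)
  · exact fun r hr => (H.bound_right r (one_pos.trans_le hr)).trans
      (mul_le_mul_of_nonneg_right (hw r hr) (Real.exp_pos _).le)
  · intro r hr
    rw [norm_mul]
    refine (mul_le_mul_of_nonneg_left (hC' r hr) (norm_nonneg _)).trans ?_
    rw [← mul_assoc]
    exact mul_le_mul_of_nonneg_right (le_max_right _ _) (Real.exp_pos _).le
  · have hG : Complex.Gamma (1 + α) ≠ 0 := Complex.Gamma_ne_zero_of_re_pos (by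
      simp
      linarith)
    have hk2 : (k / 2) ^ (α : ℂ) ≠ 0 := by
      simp [Complex.cpow_eq_zero_iff, hk0]
    exact mul_ne_zero (mul_ne_zero (mul_ne_zero Complex.I_ne_zero hk2) (inv_ne_zero hG)) hD

/-- When `deltaBracket` vanishes, `√r H_α^{(1)}(k r)` is an eigenfunction. -/
theorem not_mem_resolventSet (h0 : 0 ≤ α) (h1 : α < 1) (hk : 0 < k.im)
    (hD : deltaBracket k α s = 0) : k ^ 2 ∉ pmapResolventSet (deltaHamiltonian α s) := by
  obtain ⟨C, β, M, -, H⟩ := exists_hasKernelBounds h0 h1 hk 0 (hankelCoeff α) 0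
  have F := isFundamentalPair_delta s h0 h1 hk
  have hb := tendsto_boundary_hankel s h0 h1 hk
  rw [hD, mul_zero] at hb
  exact not_mem_resolventSet_of_strongSol (IsRadialSol.isStrongSol ⟨F.deriv₂, F.deriv₂'⟩)
    H.memLp_right hb (macdonaldSol_ne_zero h0 h1 hk)

end Main

end AnyonDelta

theorem mainTheorem6 (α s : ℝ) (hα0 : 0 ≤ α) (hα1 : α < 1) (k : ℂ) (hk0 : 0 < k.arg)
    (hk1 : k.arg < Real.pi) :
    (k ^ 2 ∈ AnyonDelta.pmapResolventSet (AnyonDelta.deltaHamiltonian α s) ↔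
      AnyonDelta.deltaBracket k α s ≠ 0) ∧
    ∀ R : AnyonDelta.L2HalfLine →L[ℂ] AnyonDelta.L2HalfLine,
      AnyonDelta.IsResolventAt (AnyonDelta.deltaHamiltonian α s) (k ^ 2) R →
        AnyonDelta.HasIntegralKernel R (AnyonDelta.deltaKernel k α s) := by
  have hk : 0 < k.im := by
    have hne : k ≠ 0 := fun h => by simp [h] at hk0
    rw [← Complex.norm_mul_sin_arg k]
    exact mul_pos (norm_pos_iff.2 hne) (Real.sin_pos_of_pos_of_lt_pi hk0 hk1)
  have hiff : k ^ 2 ∈ AnyonDelta.pmapResolventSet (AnyonDelta.deltaHamiltonian α s) →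
      AnyonDelta.deltaBracket k α s ≠ 0 := fun h hD =>
    AnyonDelta.not_mem_resolventSet hα0 hα1 hk hD h
  refine ⟨⟨hiff, fun hD => ?_⟩, fun R hR => ?_⟩
  · obtain ⟨R, hR, -⟩ := AnyonDelta.exists_isResolventAt hα0 hα1 hk hD
    exact ⟨R, hR⟩
  · obtain ⟨R', hR', hK⟩ := AnyonDelta.exists_isResolventAt hα0 hα1 hk (hiff ⟨R, hR⟩)
    rw [hR.unique hR']
    exact hK
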